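/- Let $S=\mathbb{H}^2/\Gamma$ be a complete hyperbolic surface of finite area, and let $M=(S^1_\infty\times S^1_\infty\setminus\text{diagonal})/(\mathbb{Z}/2)$ be the open Möbius band of unoriented geodesics of $\mathbb{H}^2$. A geodesic lamination on $S$ is given by the set of lifts of its leaves, a closed $\Gamma$-invariant set of pairwise non-crossing geodesics in $M$; it is maximal if it is maximal under inclusion among geodesic laminations, and finite if its lifted leaves form finitely many $\Gamma$-orbits. A measured lamination is a locally finite $\Gamma$-invariant Borel measure on $M$ whose support is a geodesic lamination (the zero measure is allowed), and $\mathcal{ML}(S)$, the space of measured laminations, has the weak topology: the coarsest for which $\mu\mapsto\int_M f\,d\mu$ is continuous for every compactly supported continuous $f\colon M\to\mathbb{R}$. Let $\lambda$ be a maximal geodesic lamination on $S$ with finitely many leaves. A transverse intersection point $y$ of a geodesic $m$ with a leaf $l$ of $\lambda$ is a boundary intersection if (in $\mathbb{H}^2$) the leaves of $\lambda$ which $m$ crosses immediately before $l$ and those which it crosses immediately after $l$ are asymptotic to $l$ on opposite sides of $m$. (If there is a next leaf, only that leaf matters; if leaves of $\lambda$ accumulate on $l$, all sufficiently near leaves matter.)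 For a measured lamination $\mu$ the alternation number $a(\lambda,\mu)\in[0,\infty]$ is the total $\mu$-transverse measure of the set of boundary intersection points of $\lambda$ and $\mu$ on $S$. Then, for this fixed $\lambda$, $a(\lambda,\mu)<\infty$ for every measured lamination $\mu$ on $S$, and $\mu\mapsto a(\lambda,\mu)$ is a continuous function on $\mathcal{ML}(S)$ (in particular on its subspace of compactly supported measured laminations). -/

import Mathlib

open MeasureTheory Topology
open scoped UpperHalfPlane ENNReal MatrixGroups

noncomputable section

namespace HypLam

/-! ### Complete hyperbolic surfaces of finite area

The hyperbolic plane is the upper half plane `ℍ` with its hyperbolic area `volume`, and its circle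
at infinity is `OnePoint ℝ = ℝ ∪ {∞}`.  The group `GL (Fin 2) ℝ` acts on both: a matrix of positive
determinant acts by its Moebius transformation, a matrix of negative determinant by the
corresponding orientation reversing isometry; scalar matrices act trivially, and every isometry of
`ℍ` arises.  A complete hyperbolic surface is a quotient `S = ℍ / Γ`. -/

/-- `Γ` acts on the hyperbolic plane properly discontinuously and freely (apart from the elements
of `Γ` that act trivially), and the complete hyperbolic surface `ℍ / Γ` has finite area. -/
structure IsFiniteAreaSurfaceGroup (Γ : Subgroup (GL (Fin 2) ℝ)) : Prop where
  properlyDiscontinuous : ProperlyDiscontinuousSMul Γ ℍ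
  free : ∀ γ ∈ Γ, ∀ z : ℍ, γ • z = z → ∀ w : ℍ, γ • w = w
  finite_area : ∃ F : Set ℍ, MeasurableSet F ∧ volume F < ⊤ ∧ ∀ z : ℍ, ∃ γ ∈ Γ, γ • z ∈ F

/-! ### Geodesics of the hyperbolic plane -/

/-- Homogeneous coordinates of a point of the circle at infinity: `[1 : 0]` for `∞` and `[t : 1]`
for a real number `t`. -/
def homCoord (a : OnePoint ℝ) : Fin 2 → ℝ :=
  a.elim ![1, 0] (fun t => ![t, 1])

/-- The determinant of the homogeneous coordinates of two points at infinity. -/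
def bracket (a b : OnePoint ℝ) : ℝ :=
  homCoord a 0 * homCoord b 1 - homCoord a 1 * homCoord b 0

/-- The points `a`, `b` separate the points `c`, `d` on the circle at infinity:
`c` and `d` lie in different components of the complement of `{a, b}` (equivalently, the four points
are distinct and their cross ratio is negative). -/
def Separates (a b c d : OnePoint ℝ) : Prop :=
  bracket a c * bracket a d * bracket b c * bracket b d < 0

/-- The open Moebius band `(S¹ × S¹ - diagonal) / (ℤ / 2)` of unoriented geodesics of the hyperbolic
plane, a geodesic being given by its unordered pair of distinct ends at infinity.  It has the
quotient topology. -/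
def Geodesic : Type := {s : Sym2 (OnePoint ℝ) // ¬ s.IsDiag}

instance : TopologicalSpace Geodesic :=
  inferInstanceAs (TopologicalSpace {s : Sym2 (OnePoint ℝ) // ¬ s.IsDiag})

instance : MeasurableSpace Geodesic := borel Geodesic

instance : BorelSpace Geodesic := ⟨rfl⟩

/-- `g.HasEnds a b`: the ends of the geodesic `g` are `a` and `b`, in either order. -/
def Geodesic.HasEnds (g : Geodesic) (a b : OnePoint ℝ) : Prop := g.1 = s(a, b)

/-- Isometries of the hyperbolic plane act on geodesics through their ends. -/
instance : MulAction (GL (Fin 2) ℝ) Geodesic where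
  smul γ g := ⟨g.1.map (γ • ·), fun h =>
    g.2 ((Sym2.isDiag_map (MulAction.injective γ)).1 h)⟩
  one_smul g := Subtype.ext (by
    change g.1.map (fun a => (1 : GL (Fin 2) ℝ) • a) = g.1
    simp)
  mul_smul γ δ g := Subtype.ext (by
    change g.1.map (fun a => (γ * δ) • a) = (g.1.map (fun a => δ • a)).map (fun a => γ • a)
    rw [Sym2.map_map]
    congr 1
    funext a
    exact mul_smul γ δ a)

/-- The set of points of a geodesic: the half circle or vertical half line with the given ends. -/
def Geodesic.points (g : Geodesic) : Set ℍ :=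
  {z | ∃ a b : OnePoint ℝ, g.HasEnds a b ∧
    homCoord a 1 * homCoord b 1 * Complex.normSq (z : ℂ)
      - (homCoord a 0 * homCoord b 1 + homCoord a 1 * homCoord b 0) * z.re
      + homCoord a 0 * homCoord b 0 = 0}

/-- Two geodesics cross: the ends of one separate the ends of the other. -/
def Crosses (g h : Geodesic) : Prop :=
  ∃ a b c d : OnePoint ℝ, g.HasEnds a b ∧ h.HasEnds c d ∧ Separates a b c d

/-! ### Geodesic laminations and measured laminations -/

/-- The closed set `Λ` of geodesics is the set of all lifts of the leaves of a geodesic lamination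
of `ℍ / Γ`. -/
structure IsLamination (Γ : Subgroup (GL (Fin 2) ℝ)) (Λ : Set Geodesic) : Prop where
  isClosed : IsClosed Λ
  invariant : ∀ γ ∈ Γ, ∀ g ∈ Λ, γ • g ∈ Λ
  not_crosses : ∀ g ∈ Λ, ∀ h ∈ Λ, ¬ Crosses g h

/-- `Λ` is a maximal geodesic lamination: it is maximal among all geodesic laminations. -/
def IsMaximalLamination (Γ : Subgroup (GL (Fin 2) ℝ)) (Λ : Set Geodesic) : Prop :=
  Maximal (IsLamination Γ) Λ

/-- The lamination has finitely many leaves in `ℍ / Γ`, that is, its lifted leaves form finitely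
many `Γ`-orbits. -/
def HasFinitelyManyLeaves (Γ : Subgroup (GL (Fin 2) ℝ)) (Λ : Set Geodesic) : Prop :=
  ∃ F : Set Geodesic, F.Finite ∧ ∀ g ∈ Λ, ∃ f ∈ F, ∃ γ ∈ Γ, g = γ • f

/-- The space `ML(S)` of measured laminations on `S = ℍ / Γ`: the locally finite `Γ`-invariant Borel
measures on the Moebius band of geodesics whose support is a geodesic lamination (which is then the
underlying lamination, on which the measure has full support).  The zero measure is the empty
lamination. -/
structure MeasuredLamination (Γ : Subgroup (GL (Fin 2) ℝ)) where
  toMeasure : Measure Geodesic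
  finite_of_isCompact : ∀ K : Set Geodesic, IsCompact K → toMeasure K < ⊤
  invariant : ∀ γ ∈ Γ, ∀ A : Set Geodesic, MeasurableSet A →
    toMeasure ((fun g => γ • g) ⁻¹' A) = toMeasure A
  isLamination_support : IsLamination Γ toMeasure.support

/-- The topology of `ML(S)` is the weak topology on locally finite measures on the Moebius band: the
coarsest one for which integration of each compactly supported continuous function is continuous. -/
instance (Γ : Subgroup (GL (Fin 2) ℝ)) : TopologicalSpace (MeasuredLamination Γ) :=
  ⨅ f : CompactlySupportedContinuousMap Geodesic ℝ,
    TopologicalSpace.induced (fun μ => ∫ g, f g ∂μ.toMeasure) inferInstance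

/-! ### The alternation number -/

/-- Let the leaf with ends `c`, `d` cross the geodesic with ends `p`, `q`.  Then
`AsymptoticToward Λ c d p q` says that the leaves of `Λ` that cross this geodesic immediately after
`(c, d)`, on the way to `q`, are asymptotic to `(c, d)` at its end `c`: some leaf `(c, d')` of `Λ`
crosses the geodesic further toward `q`.  (As leaves do not cross, all leaves in between, and in
particular the next one if there is a next one, then have the end `c` too, and no leaf with the end
`d` other than `(c, d)` crosses the geodesic further toward `q`.) -/
def AsymptoticToward (Λ : Set Geodesic) (c d p q : OnePoint ℝ) : Prop :=
  ∃ l' ∈ Λ, ∃ d' : OnePoint ℝ, l'.HasEnds c d' ∧ d' ≠ d ∧ Separates c d' p q ∧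
    ¬ Separates c d d' q

/-- The geodesic `m` crosses the leaf `l` of `Λ` in a boundary intersection: the leaves of `Λ`
that `m` crosses immediately after `l` and those that it crosses immediately before `l` are
asymptotic to `l` on different sides of `m`. -/
def IsBoundaryIntersection (Λ : Set Geodesic) (l m : Geodesic) : Prop :=
  ∃ c d p q : OnePoint ℝ, l.HasEnds c d ∧ m.HasEnds p q ∧ Separates c d p q ∧
    AsymptoticToward Λ c d p q ∧ AsymptoticToward Λ d c q p

/-- The total transverse `μ`-measure of the boundary intersection points in `A`, a set of
points of the hyperbolic plane: along each leaf `l`, one measures the set of those geodesics that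
cross `l` at a point of `A` in a boundary intersection. -/
def boundaryMass (Λ : Set Geodesic) (μ : Measure Geodesic) (A : Set ℍ) : ℝ≥0∞ :=
  ∑' l : Λ, μ {m | IsBoundaryIntersection Λ l m ∧ (l.1.points ∩ m.points ∩ A).Nonempty}

/-- The alternation number `a(λ, μ)`: the total transverse `μ`-measure of the set of boundary
intersection points on the surface `S = ℍ / Γ`, that is, the supremum of the measures of its parts
that lie in a Borel set `A` which projects injectively to `S`.  (The supremum is attained at every
Borel set of representatives of the `Γ`-orbits.) -/
def alternationNumber (Γ : Subgroup (GL (Fin 2) ℝ)) (Λ : Set Geodesic)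
    (μ : MeasuredLamination Γ) : ℝ≥0∞ :=
  ⨆ (A : Set ℍ) (_ : MeasurableSet A) (_ : ∀ z ∈ A, ∀ γ ∈ Γ, γ • z ∈ A → γ • z = z),
    boundaryMass Λ μ.toMeasure A

end HypLam

end

/-!
# Continuity of the alternation number

Let `R` be a set of representatives of the finitely many leaves of `Λ` on the surface, and choose on
each `r ∈ R` a set `D r` of representatives of its points modulo its stabilizer.  The boundary mass
is a `Γ`-invariant measure on the hyperbolic plane, so its supremum over the sets injecting into the
surface is attained at `⋃ r ∈ R, D r`, and the alternation number of `μ` is the sum over `r ∈ R` of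
the `μ`-measures of the sets of geodesics that cross `D r` in a boundary intersection
(`alternationNumber_eq_sum`).  Each of these finitely many functions of `μ` is finite and continuous
because it is trapped between the measures of an open set and of a compact set that have equal
measure at a given `μ₀` (`IsTame`, `IsTame.continuous`).

Suppose first that no nontrivial element of `Γ` preserves the leaf `r`, moved to the geodesic from
`0` to `∞` by conjugation.  As there are finitely many leaves, the leaves asymptotic to `r` at
either end do not accumulate at it (`exists_isolated`), so on either side there is a next one.  The
geodesics crossing `r` in a boundary intersection therefore form two open rectangles, such as the
set of geodesics from `(α, ∞)` to `(-β, 0)`, where the leaves from `∞` to `α` and from `0` to `-β`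
are next to `r`.  The geodesics in the boundary of such a rectangle end at one of four given points
at infinity (`isOpenCompact_joining`), and here the two special features of measured laminations come
in: they are carried by simple geodesics, and they are invariant (`exists_endNeighborhood`).
* At a cusp, every geodesic close to one ending at the cusp crosses its translate under the parabolic
  element, unless it ends at the cusp too.
* At a fixed point of a dilation in `Γ`, the geodesics ending there form a null set, except for the
  axis, since they are wandering under the dilation.
* At any other point the geodesics ending there form a null set, because a ray to this point returns
  infinitely often to a compact part of the surface (`IsFiniteAreaSurfaceGroup.recurrent`), which
  gives infinitely many translates of a compact set of such geodesics inside one compact set.  The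
  recurrence holds as otherwise, the area being finite, points far out on the ray would be moved very
  little by nontrivial elements of `Γ`; by the Margulis lemma these elements commute, and then, by
  discreteness, some of them would fix the point at infinity.
The axes of dilations that occur are treated separately: an axis asymptotic to a leaf is a leaf, and
a side of an ideal triangle of leaves is not an axis.

If the leaf `r` covers a closed leaf, then either no geodesic or every geodesic that crosses it does
so in a boundary intersection, and the measure in question is that of a fundamental domain for the
action of the stabilizer on the set of all geodesics crossing `r`.  It can be computed with another
fundamental domain, whose boundary is a null set (`isTame_crossHeight`).
-/

namespace HypLam

/-! ### Homogeneous coordinates and the action on the circle at infinity -/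

@[simp] lemma homCoord_infty_zero : homCoord OnePoint.infty 0 = 1 := rfl
@[simp] lemma homCoord_infty_one : homCoord OnePoint.infty 1 = 0 := rfl
@[simp] lemma homCoord_coe_zero (t : ℝ) : homCoord (t : OnePoint ℝ) 0 = t := rfl
@[simp] lemma homCoord_coe_one (t : ℝ) : homCoord (t : OnePoint ℝ) 1 = 1 := rfl

lemma homCoord_sq_pos (a : OnePoint ℝ) : 0 < homCoord a 0 ^ 2 + homCoord a 1 ^ 2 := by
  induction a using OnePoint.rec with
  | infty => simp
  | coe t => simp; positivity

lemma bracket_self (a : OnePoint ℝ) : bracket a a = 0 := by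
  unfold bracket; ring

lemma bracket_swap (a b : OnePoint ℝ) : bracket b a = - bracket a b := by
  unfold bracket; ring

lemma bracket_eq_zero_iff {a b : OnePoint ℝ} : bracket a b = 0 ↔ a = b := by
  constructor
  · intro h
    induction a using OnePoint.rec <;> induction b using OnePoint.rec <;>
      simp_all [bracket, sub_eq_zero]
  · rintro rfl; exact bracket_self a

lemma exists_homCoord_smul (γ : GL (Fin 2) ℝ) (a : OnePoint ℝ) :
    ∃ k : ℝ, k ≠ 0 ∧ γ 0 0 * homCoord a 0 + γ 0 1 * homCoord a 1 = k * homCoord (γ • a) 0 ∧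
      γ 1 0 * homCoord a 0 + γ 1 1 * homCoord a 1 = k * homCoord (γ • a) 1 := by
  have hdet : γ 0 0 * γ 1 1 - γ 0 1 * γ 1 0 ≠ 0 := by
    rw [← Matrix.det_fin_two]; exact γ.det_ne_zero
  induction a using OnePoint.rec with
  | infty =>
    rw [OnePoint.smul_infty_eq_ite]
    split_ifs with h
    · exact ⟨γ 0 0, by rintro h0; simp [h, h0] at hdet, by simp, by simp [h]⟩
    · exact ⟨γ 1 0, h, by simp; field_simp, by simp⟩
  | coe t =>
    rw [OnePoint.smul_some_eq_ite]
    split_ifs with h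
    · refine ⟨γ 0 0 * t + γ 0 1, fun h0 => hdet ?_, by simp, by simp [h]⟩
      linear_combination (γ 0 0) * h - γ 1 0 * h0
    · exact ⟨γ 1 0 * t + γ 1 1, h, by simp [mul_div_cancel₀ _ h], by simp⟩

/-- A factor by which the matrix `γ`, applied to the homogeneous coordinates of `a`, differs from
the homogeneous coordinates of `γ • a`. -/
noncomputable def scaleFactor (γ : GL (Fin 2) ℝ) (a : OnePoint ℝ) : ℝ :=
  (exists_homCoord_smul γ a).choose

lemma scaleFactor_ne_zero (γ : GL (Fin 2) ℝ) (a : OnePoint ℝ) : scaleFactor γ a ≠ 0 :=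
  (exists_homCoord_smul γ a).choose_spec.1

lemma scaleFactor_mul_zero (γ : GL (Fin 2) ℝ) (a : OnePoint ℝ) :
    scaleFactor γ a * homCoord (γ • a) 0 = γ 0 0 * homCoord a 0 + γ 0 1 * homCoord a 1 :=
  (exists_homCoord_smul γ a).choose_spec.2.1.symm

lemma scaleFactor_mul_one (γ : GL (Fin 2) ℝ) (a : OnePoint ℝ) :
    scaleFactor γ a * homCoord (γ • a) 1 = γ 1 0 * homCoord a 0 + γ 1 1 * homCoord a 1 :=
  (exists_homCoord_smul γ a).choose_spec.2.2.symm

lemma bracket_smul (γ : GL (Fin 2) ℝ) (a b : OnePoint ℝ) :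
    scaleFactor γ a * scaleFactor γ b * bracket (γ • a) (γ • b) =
      (γ 0 0 * γ 1 1 - γ 0 1 * γ 1 0) * bracket a b := by
  have h1 := scaleFactor_mul_zero γ a
  have h2 := scaleFactor_mul_one γ a
  have h3 := scaleFactor_mul_zero γ b
  have h4 := scaleFactor_mul_one γ b
  unfold bracket
  calc _ = (scaleFactor γ a * homCoord (γ • a) 0) * (scaleFactor γ b * homCoord (γ • b) 1)
      - (scaleFactor γ a * homCoord (γ • a) 1) * (scaleFactor γ b * homCoord (γ • b) 0) := by ring
    _ = _ := by rw [h1, h2, h3, h4]; ring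

lemma entries_det_ne_zero (γ : GL (Fin 2) ℝ) : γ 0 0 * γ 1 1 - γ 0 1 * γ 1 0 ≠ 0 := by
  rw [← Matrix.det_fin_two]; exact γ.det_ne_zero

lemma mul_neg_iff_pos_left {x y : ℝ} (hx : 0 < x) : x * y < 0 ↔ y < 0 := by
  rw [mul_neg_iff]; constructor
  · rintro (h | h)
    · exact h.2
    · exact absurd h.1 (not_lt.2 hx.le)
  · exact fun h => Or.inl ⟨hx, h⟩

lemma separates_smul (γ : GL (Fin 2) ℝ) {a b c d : OnePoint ℝ} :
    Separates (γ • a) (γ • b) (γ • c) (γ • d) ↔ Separates a b c d := by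
  unfold Separates
  have e1 := bracket_smul γ a c
  have e2 := bracket_smul γ a d
  have e3 := bracket_smul γ b c
  have e4 := bracket_smul γ b d
  have ha := scaleFactor_ne_zero γ a
  have hb := scaleFactor_ne_zero γ b
  have hc := scaleFactor_ne_zero γ c
  have hd := scaleFactor_ne_zero γ d
  have hdet := entries_det_ne_zero γ
  set D := γ 0 0 * γ 1 1 - γ 0 1 * γ 1 0
  have key : (scaleFactor γ a * scaleFactor γ b * scaleFactor γ c * scaleFactor γ d) ^ 2 *
      (bracket (γ • a) (γ • c) * bracket (γ • a) (γ • d) * bracket (γ • b) (γ • c) *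
        bracket (γ • b) (γ • d)) =
      (D ^ 2) ^ 2 * (bracket a c * bracket a d * bracket b c * bracket b d) := by
    calc _ = (scaleFactor γ a * scaleFactor γ c * bracket (γ • a) (γ • c)) *
          (scaleFactor γ a * scaleFactor γ d * bracket (γ • a) (γ • d)) *
          (scaleFactor γ b * scaleFactor γ c * bracket (γ • b) (γ • c)) *
          (scaleFactor γ b * scaleFactor γ d * bracket (γ • b) (γ • d)) := by ring
      _ = _ := by rw [e1, e2, e3, e4]; ring
  have p1 : 0 < (scaleFactor γ a * scaleFactor γ b * scaleFactor γ c * scaleFactor γ d) ^ 2 := by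
    positivity
  have p2 : 0 < (D ^ 2) ^ 2 := by positivity
  rw [← mul_neg_iff_pos_left p1, key, mul_neg_iff_pos_left p2]

lemma Separates.swap_left {a b c d : OnePoint ℝ} (h : Separates a b c d) : Separates b a c d := by
  unfold Separates at *; linarith

lemma Separates.swap_right {a b c d : OnePoint ℝ} (h : Separates a b c d) :
    Separates a b d c := by
  unfold Separates at *; linarith

lemma Separates.symm {a b c d : OnePoint ℝ} (h : Separates a b c d) : Separates c d a b := by
  unfold Separates at *
  rw [bracket_swap a c, bracket_swap b c, bracket_swap a d, bracket_swap b d]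
  linarith

/-! ### Geodesics and their ends -/

/-- The geodesic with the ends `a` and `b`. -/
def geod (a b : OnePoint ℝ) (h : a ≠ b) : Geodesic := ⟨s(a, b), by simpa using h⟩

lemma hasEnds_geod {a b : OnePoint ℝ} (h : a ≠ b) : (geod a b h).HasEnds a b := rfl

lemma Geodesic.exists_hasEnds (g : Geodesic) : ∃ a b, g.HasEnds a b := by
  obtain ⟨s, hs⟩ := g
  induction s using Sym2.ind with
  | _ a b => exact ⟨a, b, rfl⟩

lemma Geodesic.HasEnds.ne {g : Geodesic} {a b : OnePoint ℝ} (h : g.HasEnds a b) : a ≠ b := by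
  intro hab
  apply g.2
  unfold Geodesic.HasEnds at h
  rw [h, hab]; simp

lemma Geodesic.HasEnds.symm {g : Geodesic} {a b : OnePoint ℝ} (h : g.HasEnds a b) :
    g.HasEnds b a := by
  unfold Geodesic.HasEnds at *
  rw [h, Sym2.eq_swap]

lemma Geodesic.HasEnds.eq {g g' : Geodesic} {a b : OnePoint ℝ} (h : g.HasEnds a b)
    (h' : g'.HasEnds a b) : g = g' := Subtype.ext (Eq.trans h (Eq.symm h'))

lemma Geodesic.HasEnds.cases {g : Geodesic} {a b c d : OnePoint ℝ} (h : g.HasEnds a b)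
    (h' : g.HasEnds c d) : (a = c ∧ b = d) ∨ (a = d ∧ b = c) := by
  unfold Geodesic.HasEnds at *
  rw [h] at h'
  simpa using h'

lemma Geodesic.HasEnds.snd_eq {g : Geodesic} {a b c : OnePoint ℝ} (h : g.HasEnds a b)
    (h' : g.HasEnds a c) : b = c := by
  rcases h.cases h' with ⟨_, h⟩ | ⟨h1, h2⟩
  · exact h
  · rw [h2, h1]

lemma Geodesic.HasEnds.smul {g : Geodesic} {a b : OnePoint ℝ} (h : g.HasEnds a b)
    (γ : GL (Fin 2) ℝ) : (γ • g).HasEnds (γ • a) (γ • b) := by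
  unfold Geodesic.HasEnds at *
  change g.1.map (γ • ·) = _
  rw [h]; rfl

lemma crosses_iff {g h : Geodesic} {a b c d : OnePoint ℝ} (hg : g.HasEnds a b)
    (hh : h.HasEnds c d) : Crosses g h ↔ Separates a b c d := by
  refine ⟨?_, fun s => ⟨a, b, c, d, hg, hh, s⟩⟩
  rintro ⟨a', b', c', d', hg', hh', s⟩
  rcases hg.cases hg' with ⟨rfl, rfl⟩ | ⟨rfl, rfl⟩ <;>
    rcases hh.cases hh' with ⟨rfl, rfl⟩ | ⟨rfl, rfl⟩
  · exact s
  · exact s.swap_right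
  · exact s.swap_left
  · exact s.swap_right.swap_left

lemma crosses_smul (γ : GL (Fin 2) ℝ) {g h : Geodesic} :
    Crosses (γ • g) (γ • h) ↔ Crosses g h := by
  obtain ⟨a, b, hg⟩ := g.exists_hasEnds
  obtain ⟨c, d, hh⟩ := h.exists_hasEnds
  rw [crosses_iff hg hh, crosses_iff (hg.smul γ) (hh.smul γ), separates_smul]

@[simp] lemma separates_infty_zero {p q : ℝ} :
    Separates OnePoint.infty ((0 : ℝ) : OnePoint ℝ) p q ↔ p * q < 0 := by
  simp [Separates, bracket]

lemma separates_infty_coe {t p q : ℝ} :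
    Separates OnePoint.infty (t : OnePoint ℝ) p q ↔ (p - t) * (q - t) < 0 := by
  simp only [Separates, bracket, homCoord_infty_zero, homCoord_infty_one, homCoord_coe_zero,
    homCoord_coe_one]
  ring_nf

lemma separates_coe {a b c d : ℝ} :
    Separates (a : OnePoint ℝ) b c d ↔ (a - c) * (a - d) * (b - c) * (b - d) < 0 := by
  simp [Separates, bracket]

lemma Separates.ne {a b c d : OnePoint ℝ} (h : Separates a b c d) :
    a ≠ c ∧ a ≠ d ∧ b ≠ c ∧ b ≠ d := by
  unfold Separates at h
  refine ⟨?_, ?_, ?_, ?_⟩ <;> rintro rfl <;> simp [bracket_self] at h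

/-- A geodesic that crosses the imaginary axis has one positive and one negative end. -/
lemma exists_of_separates_infty_zero {p q : OnePoint ℝ}
    (h : Separates OnePoint.infty ((0 : ℝ) : OnePoint ℝ) p q) :
    ∃ s t : ℝ, p = s ∧ q = t ∧ s * t < 0 := by
  obtain ⟨h1, h2, -, -⟩ := h.ne
  induction p using OnePoint.rec with
  | infty => simp at h1
  | coe s =>
    induction q using OnePoint.rec with
    | infty => simp at h2
    | coe t => exact ⟨s, t, rfl, rfl, separates_infty_zero.1 h⟩

/-! ### Points of geodesics -/

/-- The equation of the geodesic with the ends `a` and `b`. -/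
noncomputable def lineForm (a b : OnePoint ℝ) (z : ℂ) : ℝ :=
  homCoord a 1 * homCoord b 1 * Complex.normSq z
      - (homCoord a 0 * homCoord b 1 + homCoord a 1 * homCoord b 0) * z.re
      + homCoord a 0 * homCoord b 0

lemma lineForm_swap (a b : OnePoint ℝ) (z : ℂ) : lineForm a b z = lineForm b a z := by
  unfold lineForm; ring

lemma mem_points_iff {g : Geodesic} {a b : OnePoint ℝ} (h : g.HasEnds a b) {z : ℍ} :
    z ∈ g.points ↔ lineForm a b z = 0 := by
  refine ⟨?_, fun hz => ⟨a, b, h, hz⟩⟩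
  rintro ⟨a', b', h', hz⟩
  change lineForm a' b' z = 0 at hz
  rcases h.cases h' with ⟨rfl, rfl⟩ | ⟨rfl, rfl⟩
  · exact hz
  · rwa [lineForm_swap]

lemma lineForm_smul (γ : GL (Fin 2) ℝ) (a b : OnePoint ℝ) (z : ℍ) :
    scaleFactor γ a * scaleFactor γ b * Complex.normSq (UpperHalfPlane.denom γ z) *
      lineForm (γ • a) (γ • b) (γ • z : ℍ) =
    (γ 0 0 * γ 1 1 - γ 0 1 * γ 1 0) ^ 2 * lineForm a b z := by
  have hd := UpperHalfPlane.denom_ne_zero γ z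
  have hn : Complex.normSq (UpperHalfPlane.denom γ z) ≠ 0 := by simp
  have h1 := scaleFactor_mul_zero γ a
  have h2 := scaleFactor_mul_one γ a
  have h3 := scaleFactor_mul_zero γ b
  have h4 := scaleFactor_mul_one γ b
  have e1 : Complex.normSq (UpperHalfPlane.denom γ z) * Complex.normSq ((γ • z : ℍ) : ℂ) =
      Complex.normSq (UpperHalfPlane.num γ z) := by
    rw [UpperHalfPlane.coe_smul, Complex.normSq_eq_norm_sq, Complex.normSq_eq_norm_sq,
      Complex.normSq_eq_norm_sq, UpperHalfPlane.norm_σ, norm_div]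
    have : ‖UpperHalfPlane.denom γ z‖ ≠ 0 := by simp
    field_simp
  have e2 : Complex.normSq (UpperHalfPlane.denom γ z) * ((γ • z : ℍ) : ℂ).re =
      (UpperHalfPlane.num γ z).re * (UpperHalfPlane.denom γ z).re +
      (UpperHalfPlane.num γ z).im * (UpperHalfPlane.denom γ z).im := by
    rw [UpperHalfPlane.coe_re, UpperHalfPlane.re_smul, Complex.div_re]
    field_simp
  unfold lineForm
  calc _ = (scaleFactor γ a * homCoord (γ • a) 1) * (scaleFactor γ b * homCoord (γ • b) 1) *
        (Complex.normSq (UpperHalfPlane.denom γ z) * Complex.normSq ((γ • z : ℍ) : ℂ)) -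
        ((scaleFactor γ a * homCoord (γ • a) 0) * (scaleFactor γ b * homCoord (γ • b) 1) +
        (scaleFactor γ a * homCoord (γ • a) 1) * (scaleFactor γ b * homCoord (γ • b) 0)) *
        (Complex.normSq (UpperHalfPlane.denom γ z) * ((γ • z : ℍ) : ℂ).re) +
        (scaleFactor γ a * homCoord (γ • a) 0) * (scaleFactor γ b * homCoord (γ • b) 0) *
        Complex.normSq (UpperHalfPlane.denom γ z) := by ring
    _ = _ := by
      rw [e1, e2, h1, h2, h3, h4]
      simp only [UpperHalfPlane.num, UpperHalfPlane.denom, Complex.normSq_apply, Complex.add_re,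
        Complex.mul_re, Complex.ofReal_re, Complex.ofReal_im, Complex.add_im, Complex.mul_im]
      ring

lemma smul_mem_points_iff (γ : GL (Fin 2) ℝ) {g : Geodesic} {z : ℍ} :
    γ • z ∈ (γ • g).points ↔ z ∈ g.points := by
  obtain ⟨a, b, h⟩ := g.exists_hasEnds
  rw [mem_points_iff h, mem_points_iff (h.smul γ)]
  have key := lineForm_smul γ a b z
  have hd := UpperHalfPlane.denom_ne_zero γ z
  have hn : Complex.normSq (UpperHalfPlane.denom γ z) ≠ 0 := by simp
  have ha := scaleFactor_ne_zero γ a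
  have hb := scaleFactor_ne_zero γ b
  have hdet := entries_det_ne_zero γ
  constructor
  · intro h0
    rw [h0, mul_zero] at key
    simpa [hdet] using key.symm
  · intro h0
    rw [h0, mul_zero] at key
    simpa [ha, hb, hn, hd] using key

lemma mem_points_infty_zero {g : Geodesic}
    (h : g.HasEnds OnePoint.infty ((0 : ℝ) : OnePoint ℝ)) {z : ℍ} :
    z ∈ g.points ↔ z.re = 0 := by
  rw [mem_points_iff h]; simp [lineForm]

lemma mem_points_coe {g : Geodesic} {p q : ℝ} (h : g.HasEnds p q) {z : ℍ} :
    z ∈ g.points ↔ z.re ^ 2 + z.im ^ 2 - (p + q) * z.re + p * q = 0 := by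
  rw [mem_points_iff h]; simp [lineForm, Complex.normSq_apply, sq]

/-! ### Moving geodesics into standard position -/

/-- The inverse of the matrix whose columns are homogeneous coordinates of two points at
infinity moves these points to `∞` and `0`. -/
lemma exists_smul_eq_infty_zero {a b : OnePoint ℝ} (h : a ≠ b) :
    ∃ g : GL (Fin 2) ℝ, g • a = OnePoint.infty ∧ g • b = ((0 : ℝ) : OnePoint ℝ) := by
  have hb : bracket a b ≠ 0 := fun h0 => h (bracket_eq_zero_iff.1 h0)
  let g : GL (Fin 2) ℝ := Matrix.GeneralLinearGroup.mkOfDetNeZero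
    !![homCoord a 0, homCoord b 0; homCoord a 1, homCoord b 1] (by
      rw [Matrix.det_fin_two_of]; unfold bracket at hb; intro h0; apply hb; linarith)
  have e00 : g 0 0 = homCoord a 0 := rfl
  have e01 : g 0 1 = homCoord b 0 := rfl
  have e10 : g 1 0 = homCoord a 1 := rfl
  have e11 : g 1 1 = homCoord b 1 := rfl
  refine ⟨g⁻¹, ?_, ?_⟩
  · rw [inv_smul_eq_iff, OnePoint.smul_infty_eq_ite, e10, e00]
    induction a using OnePoint.rec <;> simp
  · rw [inv_smul_eq_iff, OnePoint.smul_some_eq_ite, e10, e00, e11, e01]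
    induction b using OnePoint.rec <;> simp

lemma eq_infty_or_coe (a : OnePoint ℝ) : a = OnePoint.infty ∨ ∃ t : ℝ, a = t := by
  induction a using OnePoint.rec with
  | infty => exact Or.inl rfl
  | coe t => exact Or.inr ⟨t, rfl⟩

/-- Two different geodesics with a common point cross. -/
lemma crosses_of_mem_points {g h : Geodesic} (hne : g ≠ h) {z : ℍ} (hg : z ∈ g.points)
    (hh : z ∈ h.points) : Crosses g h := by
  obtain ⟨a, b, hab⟩ := g.exists_hasEnds
  obtain ⟨γ, ha, hb⟩ := exists_smul_eq_infty_zero hab.ne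
  rw [← crosses_smul γ]
  have hab' := hab.smul γ
  rw [ha, hb] at hab'
  have hg' := (smul_mem_points_iff γ).2 hg
  have hh' := (smul_mem_points_iff γ).2 hh
  have hne' : γ • g ≠ γ • h := fun e => hne (MulAction.injective γ e)
  generalize γ • g = g' at *
  generalize γ • h = h' at *
  generalize γ • z = w at *
  rw [mem_points_infty_zero hab'] at hg'
  obtain ⟨p, q, hpq⟩ := h'.exists_hasEnds
  rw [crosses_iff hab' hpq]
  have hw := w.im_pos
  rcases eq_infty_or_coe p with rfl | ⟨s, rfl⟩ <;> rcases eq_infty_or_coe q with rfl | ⟨t, rfl⟩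
  · exact absurd rfl hpq.ne
  · rw [mem_points_iff hpq] at hh'
    simp [lineForm, hg'] at hh'
    subst hh'
    exact absurd (hab'.eq hpq) hne'
  · rw [mem_points_iff hpq] at hh'
    simp [lineForm, hg'] at hh'
    subst hh'
    exact absurd (hab'.eq hpq.symm) hne'
  · rw [mem_points_coe hpq, hg'] at hh'
    rw [separates_infty_zero]
    nlinarith

/-! ### The topology of the circle at infinity -/

/-- The entries of the orthogonal projection of the plane onto the line with homogeneous
coordinates `a`. -/
noncomputable def dirEntry (i j : Fin 2) (a : OnePoint ℝ) : ℝ :=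
  homCoord a i * homCoord a j / (homCoord a 0 ^ 2 + homCoord a 1 ^ 2)

lemma tendsto_inv_one_add_sq :
    Filter.Tendsto (fun t : ℝ => (t ^ 2 + 1)⁻¹) (Filter.cocompact ℝ) (𝓝 0) := by
  refine Filter.Tendsto.inv_tendsto_atTop ?_
  refine Filter.tendsto_atTop_mono (fun t => ?_) (tendsto_norm_cocompact_atTop (E := ℝ))
  rw [Real.norm_eq_abs]
  nlinarith [sq_nonneg (|t| - 1), sq_abs t, abs_nonneg t]

lemma continuous_dirEntry (i j : Fin 2) : Continuous (dirEntry i j) := by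
  have h11 : Continuous (dirEntry 1 1) := by
    rw [OnePoint.continuous_iff, Filter.coclosedCompact_eq_cocompact]
    refine ⟨?_, ?_⟩
    · simpa [dirEntry] using tendsto_inv_one_add_sq
    · simp only [dirEntry, homCoord_coe_one, homCoord_coe_zero]
      exact Continuous.div (by fun_prop) (by fun_prop) (fun t => by positivity)
  have h01 : Continuous (dirEntry 0 1) := by
    rw [OnePoint.continuous_iff, Filter.coclosedCompact_eq_cocompact]
    refine ⟨?_, ?_⟩
    · simp only [dirEntry, homCoord_coe_one, homCoord_coe_zero, homCoord_infty_zero,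
        homCoord_infty_one]
      have h : Filter.Tendsto (fun t : ℝ => ‖t‖⁻¹) (Filter.cocompact ℝ) (𝓝 0) :=
        (tendsto_norm_cocompact_atTop (E := ℝ)).inv_tendsto_atTop
      have h2 : Filter.Tendsto (fun t : ℝ => t * 1 / (t ^ 2 + 1 ^ 2)) (Filter.cocompact ℝ)
          (𝓝 0) := by
        refine squeeze_zero_norm (fun t => ?_) h
        rcases eq_or_ne t 0 with rfl | ht
        · simp
        have : 0 < |t| := abs_pos.2 ht
        rw [norm_div, Real.norm_eq_abs, Real.norm_eq_abs, mul_one,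
          abs_of_pos (show (0 : ℝ) < t ^ 2 + 1 ^ 2 by positivity), div_le_iff₀ (by positivity)]
        rw [Real.norm_eq_abs, inv_mul_eq_div, le_div_iff₀ this]
        nlinarith [sq_abs t]
      simpa using h2
    · simp only [dirEntry, homCoord_coe_one, homCoord_coe_zero]
      exact Continuous.div (by fun_prop) (by fun_prop) (fun t => by positivity)
  have h00 : Continuous (dirEntry 0 0) := by
    have : dirEntry 0 0 = fun a => 1 - dirEntry 1 1 a := by
      funext a
      have := homCoord_sq_pos a
      unfold dirEntry; field_simp; ring
    rw [this]; fun_prop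
  have h10 : Continuous (dirEntry 1 0) := by
    have : dirEntry 1 0 = dirEntry 0 1 := by
      funext a; unfold dirEntry; ring
    rwa [this]
  fin_cases i <;> fin_cases j <;> assumption

/-- The square of the sine of the angle between the lines with homogeneous coordinates `a`, `b`:
a continuous measure of how far `a` and `b` are from each other. -/
noncomputable def chord (a b : OnePoint ℝ) : ℝ :=
  bracket a b ^ 2 / ((homCoord a 0 ^ 2 + homCoord a 1 ^ 2) * (homCoord b 0 ^ 2 + homCoord b 1 ^ 2))

lemma chord_eq (a b : OnePoint ℝ) : chord a b = dirEntry 0 0 a * dirEntry 1 1 b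
    - 2 * (dirEntry 0 1 a * dirEntry 0 1 b) + dirEntry 1 1 a * dirEntry 0 0 b := by
  have h1 := (homCoord_sq_pos a).ne'
  have h2 := (homCoord_sq_pos b).ne'
  unfold chord dirEntry bracket
  field_simp
  ring

lemma chord_comm (a b : OnePoint ℝ) : chord a b = chord b a := by
  unfold chord; rw [bracket_swap a b]; ring

lemma chord_eq_zero_iff {a b : OnePoint ℝ} : chord a b = 0 ↔ a = b := by
  have h1 := (homCoord_sq_pos a).ne'
  have h2 := (homCoord_sq_pos b).ne'
  unfold chord
  rw [div_eq_zero_iff]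
  simp [h1, h2, bracket_eq_zero_iff]

lemma chord_nonneg (a b : OnePoint ℝ) : 0 ≤ chord a b := by
  unfold chord; positivity

lemma continuous_chord : Continuous fun p : OnePoint ℝ × OnePoint ℝ => chord p.1 p.2 := by
  simp only [chord_eq]
  have := continuous_dirEntry
  fun_prop

lemma isEmbedding_chord : IsEmbedding (fun a c : OnePoint ℝ => chord a c) := by
  refine (Continuous.isClosedEmbedding ?_ ?_).isEmbedding
  · exact continuous_pi fun c => continuous_chord.comp (by fun_prop : Continuous fun a => (a, c))
  · intro a b h
    have := congrFun h b
    simp only [chord_eq_zero_iff.2 (rfl : b = b)] at this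
    exact chord_eq_zero_iff.1 this

/-- `stretch γ a` is the factor by which `γ` stretches the squared length of the vectors on the
line with homogeneous coordinates `a`. -/
noncomputable def stretch (γ : GL (Fin 2) ℝ) (a : OnePoint ℝ) : ℝ :=
  (γ 0 0 ^ 2 + γ 1 0 ^ 2) * dirEntry 0 0 a + 2 * (γ 0 0 * γ 0 1 + γ 1 0 * γ 1 1) * dirEntry 0 1 a +
    (γ 0 1 ^ 2 + γ 1 1 ^ 2) * dirEntry 1 1 a

lemma stretch_eq (γ : GL (Fin 2) ℝ) (a : OnePoint ℝ) :
    stretch γ a = scaleFactor γ a ^ 2 * (homCoord (γ • a) 0 ^ 2 + homCoord (γ • a) 1 ^ 2) /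
      (homCoord a 0 ^ 2 + homCoord a 1 ^ 2) := by
  have h1 := (homCoord_sq_pos a).ne'
  have e0 := scaleFactor_mul_zero γ a
  have e1 := scaleFactor_mul_one γ a
  have : scaleFactor γ a ^ 2 * (homCoord (γ • a) 0 ^ 2 + homCoord (γ • a) 1 ^ 2) =
      (scaleFactor γ a * homCoord (γ • a) 0) ^ 2 + (scaleFactor γ a * homCoord (γ • a) 1) ^ 2 := by
    ring
  rw [this, e0, e1]
  unfold stretch dirEntry
  field_simp
  ring

lemma stretch_pos (γ : GL (Fin 2) ℝ) (a : OnePoint ℝ) : 0 < stretch γ a := by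
  rw [stretch_eq]
  have h1 := homCoord_sq_pos a
  have h2 := homCoord_sq_pos (γ • a)
  have h3 := scaleFactor_ne_zero γ a
  positivity

lemma chord_smul (γ : GL (Fin 2) ℝ) (a b : OnePoint ℝ) :
    chord (γ • a) (γ • b) =
      (γ 0 0 * γ 1 1 - γ 0 1 * γ 1 0) ^ 2 * chord a b / (stretch γ a * stretch γ b) := by
  have key := bracket_smul γ a b
  rw [stretch_eq, stretch_eq]
  unfold chord
  have h1 := (homCoord_sq_pos a).ne'
  have h2 := (homCoord_sq_pos b).ne'
  have h3 := (homCoord_sq_pos (γ • a)).ne'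
  have h4 := (homCoord_sq_pos (γ • b)).ne'
  have h5 := scaleFactor_ne_zero γ a
  have h6 := scaleFactor_ne_zero γ b
  field_simp
  linear_combination (scaleFactor γ a * scaleFactor γ b * bracket (γ • a) (γ • b) +
    (γ 0 0 * γ 1 1 - γ 0 1 * γ 1 0) * bracket a b) * key

instance : ContinuousConstSMul (GL (Fin 2) ℝ) (OnePoint ℝ) where
  continuous_const_smul γ := by
    rw [isEmbedding_chord.continuous_iff]
    refine continuous_pi fun c => ?_
    have : ((fun a c : OnePoint ℝ => chord a c) ∘ fun x => γ • x) = fun a c =>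
        (γ 0 0 * γ 1 1 - γ 0 1 * γ 1 0) ^ 2 * chord a (γ⁻¹ • c) /
          (stretch γ a * stretch γ (γ⁻¹ • c)) := by
      funext a c
      rw [← chord_smul, smul_inv_smul]; rfl
    rw [this]
    refine Continuous.div ?_ ?_ fun a => (mul_pos (stretch_pos _ _) (stretch_pos _ _)).ne'
    · exact continuous_const.mul
        (continuous_chord.comp (by fun_prop : Continuous fun a => (a, γ⁻¹ • c)))
    · have := continuous_dirEntry
      unfold stretch
      fun_prop

/-! ### The topology of the space of geodesics -/

lemma continuous_sym2_mk : Continuous fun p : OnePoint ℝ × OnePoint ℝ => s(p.1, p.2) :=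
  continuous_coinduced_rng

lemma continuous_sym2_iff {X : Type*} [TopologicalSpace X] {f : Sym2 (OnePoint ℝ) → X} :
    Continuous f ↔ Continuous fun p : OnePoint ℝ × OnePoint ℝ => f s(p.1, p.2) :=
  continuous_coinduced_dom

lemma isOpen_sym2_iff {U : Set (Sym2 (OnePoint ℝ))} :
    IsOpen U ↔ IsOpen {p : OnePoint ℝ × OnePoint ℝ | s(p.1, p.2) ∈ U} :=
  isOpen_coinduced

instance : CompactSpace (Sym2 (OnePoint ℝ)) := Quot.compactSpace

/-- The product of the distances from the two points of `s` to a point `c`. -/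
noncomputable def chordProd (c : OnePoint ℝ) : Sym2 (OnePoint ℝ) → ℝ :=
  Sym2.lift ⟨fun a b => chord a c * chord b c, fun _ _ => mul_comm _ _⟩

lemma continuous_chordProd (s : Sym2 (OnePoint ℝ)) : Continuous fun c => chordProd c s := by
  induction s using Sym2.ind with
  | _ a b =>
    have := continuous_chord
    change Continuous fun c => chord a c * chord b c
    exact (this.comp (by fun_prop : Continuous fun c => (a, c))).mul
      (this.comp (by fun_prop : Continuous fun c => (b, c)))

lemma chordProd_injective {s t : Sym2 (OnePoint ℝ)} (h : ∀ c, chordProd c s = chordProd c t) :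
    s = t := by
  refine Sym2.ext fun c => ?_
  have hmem : ∀ u : Sym2 (OnePoint ℝ), c ∈ u ↔ chordProd c u = 0 := by
    intro u
    induction u using Sym2.ind with
    | _ a b =>
      change _ ↔ chord a c * chord b c = 0
      rw [mul_eq_zero, chord_eq_zero_iff, chord_eq_zero_iff, Sym2.mem_iff]
      simp only [eq_comm]
  rw [hmem, hmem, h]

/-- Unordered pairs of points at infinity are determined by countably many continuous functions. -/
lemma isEmbedding_chordProd :
    IsEmbedding fun (s : Sym2 (OnePoint ℝ)) (r : ℚ) => chordProd ((r : ℝ) : OnePoint ℝ) s := by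
  refine (Continuous.isClosedEmbedding ?_ ?_).isEmbedding
  · refine continuous_pi fun r => ?_
    rw [continuous_sym2_iff]
    have := continuous_chord
    change Continuous fun p : OnePoint ℝ × OnePoint ℝ => chord p.1 _ * chord p.2 _
    exact (this.comp (by fun_prop : Continuous fun p : OnePoint ℝ × OnePoint ℝ =>
        (p.1, ((r : ℝ) : OnePoint ℝ)))).mul
      (this.comp (by fun_prop : Continuous fun p : OnePoint ℝ × OnePoint ℝ =>
        (p.2, ((r : ℝ) : OnePoint ℝ))))
  · intro s t h
    refine chordProd_injective fun c => ?_
    have hd : DenseRange fun r : ℚ => ((r : ℝ) : OnePoint ℝ) :=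
      OnePoint.denseRange_coe.comp Rat.denseRange_cast OnePoint.continuous_coe
    exact congrFun (hd.equalizer (continuous_chordProd s) (continuous_chordProd t)
      (funext fun r => congrFun h r)) c

instance : T2Space (Sym2 (OnePoint ℝ)) := isEmbedding_chordProd.t2Space
instance : SecondCountableTopology (Sym2 (OnePoint ℝ)) :=
  isEmbedding_chordProd.secondCountableTopology

lemma isClosed_isDiag : IsClosed {s : Sym2 (OnePoint ℝ) | s.IsDiag} := by
  have : {s : Sym2 (OnePoint ℝ) | s.IsDiag} = Set.range fun a => s(a, a) := by
    ext s
    induction s using Sym2.ind with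
    | _ a b =>
      simp only [Set.mem_ofPred_eq, Sym2.mk_isDiag_iff, Set.mem_range, Sym2.eq_iff]
      grind
  rw [this]
  exact (isCompact_range (continuous_sym2_mk.comp (by fun_prop : Continuous fun a => (a, a)))).isClosed

lemma isOpenEmbedding_val :
    IsOpenEmbedding (fun g : Geodesic => (g.1 : Sym2 (OnePoint ℝ))) :=
  isClosed_isDiag.isOpen_compl.isOpenEmbedding_subtypeVal

lemma continuous_val : Continuous (fun g : Geodesic => (g.1 : Sym2 (OnePoint ℝ))) :=
  isOpenEmbedding_val.continuous

instance : T2Space Geodesic := isOpenEmbedding_val.isEmbedding.t2Space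
instance : SecondCountableTopology Geodesic :=
  isOpenEmbedding_val.isEmbedding.secondCountableTopology
instance : LocallyCompactSpace Geodesic := isOpenEmbedding_val.locallyCompactSpace

instance : ContinuousConstSMul (GL (Fin 2) ℝ) Geodesic where
  continuous_const_smul γ := by
    rw [isOpenEmbedding_val.isEmbedding.continuous_iff]
    have : Continuous fun s : Sym2 (OnePoint ℝ) => s.map (γ • ·) := by
      rw [continuous_sym2_iff]
      exact continuous_sym2_mk.comp
        (by fun_prop : Continuous fun p : OnePoint ℝ × OnePoint ℝ => (γ • p.1, γ • p.2))
    exact this.comp continuous_val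

/-- The function on geodesics given by a symmetric function of the two ends. -/
noncomputable def endsFun (F : OnePoint ℝ → OnePoint ℝ → ℝ) (hF : ∀ a b, F a b = F b a)
    (g : Geodesic) : ℝ :=
  Sym2.lift ⟨F, hF⟩ g.1

lemma endsFun_eq {F : OnePoint ℝ → OnePoint ℝ → ℝ} (hF : ∀ a b, F a b = F b a) {g : Geodesic}
    {a b : OnePoint ℝ} (h : g.HasEnds a b) : endsFun F hF g = F a b := by
  unfold endsFun
  rw [show g.1 = s(a, b) from h]; rfl

lemma continuous_endsFun {F : OnePoint ℝ → OnePoint ℝ → ℝ} (hF : ∀ a b, F a b = F b a)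
    (hc : Continuous fun p : OnePoint ℝ × OnePoint ℝ => F p.1 p.2) :
    Continuous (endsFun F hF) := by
  have : Continuous (Sym2.lift ⟨F, hF⟩) := by
    rw [continuous_sym2_iff]; exact hc
  exact this.comp continuous_val

/-- The distance between the ends of a geodesic. -/
noncomputable def endDist : Geodesic → ℝ := endsFun chord chord_comm

lemma endDist_eq {g : Geodesic} {a b : OnePoint ℝ} (h : g.HasEnds a b) :
    endDist g = chord a b := endsFun_eq _ h

lemma continuous_endDist : Continuous endDist := continuous_endsFun _ continuous_chord

lemma endDist_pos (g : Geodesic) : 0 < endDist g := by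
  obtain ⟨a, b, h⟩ := g.exists_hasEnds
  rw [endDist_eq h]
  exact lt_of_le_of_ne (chord_nonneg _ _) fun h0 => h.ne (chord_eq_zero_iff.1 h0.symm)

/-- The geodesics whose ends stay a definite distance apart form a compact set. -/
lemma isCompact_le_endDist {ε : ℝ} (hε : 0 < ε) : IsCompact {g : Geodesic | ε ≤ endDist g} := by
  rw [isOpenEmbedding_val.isEmbedding.isCompact_iff]
  have hc : Continuous (Sym2.lift ⟨chord, chord_comm⟩) := by
    rw [continuous_sym2_iff]; exact continuous_chord
  have : (fun g : Geodesic => (g.1 : Sym2 (OnePoint ℝ))) '' {g : Geodesic | ε ≤ endDist g} =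
      {s | ε ≤ Sym2.lift ⟨chord, chord_comm⟩ s} := by
    ext s
    constructor
    · rintro ⟨g, hg, rfl⟩; exact hg
    · intro hs
      refine ⟨⟨s, ?_⟩, hs, rfl⟩
      induction s using Sym2.ind with
      | _ a b =>
        intro hd
        have hab : a = b := by simpa using hd
        change ε ≤ chord a b at hs
        rw [chord_eq_zero_iff.2 hab] at hs
        linarith
  rw [this]
  exact (isClosed_le continuous_const hc).isCompact

/-- The geodesics with one end in `U` and one end in `V`. -/
def joining (U V : Set (OnePoint ℝ)) : Set Geodesic :=
  {g | ∃ a ∈ U, ∃ b ∈ V, g.HasEnds a b}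

lemma isOpen_joining {U V : Set (OnePoint ℝ)} (hU : IsOpen U) (hV : IsOpen V) :
    IsOpen (joining U V) := by
  have : IsOpen {s : Sym2 (OnePoint ℝ) | ∃ a ∈ U, ∃ b ∈ V, s = s(a, b)} := by
    rw [isOpen_sym2_iff]
    have : {p : OnePoint ℝ × OnePoint ℝ | s(p.1, p.2) ∈
        {s : Sym2 (OnePoint ℝ) | ∃ a ∈ U, ∃ b ∈ V, s = s(a, b)}} = U ×ˢ V ∪ V ×ˢ U := by
      ext ⟨p, q⟩
      simp only [Set.mem_ofPred_eq, Sym2.eq_iff, Set.mem_union, Set.mem_prod]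
      constructor
      · rintro ⟨a, ha, b, hb, ⟨rfl, rfl⟩ | ⟨rfl, rfl⟩⟩
        · exact Or.inl ⟨ha, hb⟩
        · exact Or.inr ⟨hb, ha⟩
      · rintro (⟨hp, hq⟩ | ⟨hp, hq⟩)
        · exact ⟨p, hp, q, hq, Or.inl ⟨rfl, rfl⟩⟩
        · exact ⟨q, hq, p, hp, Or.inr ⟨rfl, rfl⟩⟩
    rw [this]
    exact (hU.prod hV).union (hV.prod hU)
  exact this.preimage continuous_val

lemma isCompact_joining {U V : Set (OnePoint ℝ)} (hU : IsCompact U) (hV : IsCompact V)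
    (hd : Disjoint U V) : IsCompact (joining U V) := by
  rw [isOpenEmbedding_val.isEmbedding.isCompact_iff]
  have : (fun g : Geodesic => (g.1 : Sym2 (OnePoint ℝ))) '' joining U V =
      (fun p : OnePoint ℝ × OnePoint ℝ => s(p.1, p.2)) '' (U ×ˢ V) := by
    ext s
    constructor
    · rintro ⟨g, ⟨a, ha, b, hb, h⟩, rfl⟩
      exact ⟨(a, b), ⟨ha, hb⟩, Eq.symm h⟩
    · rintro ⟨⟨a, b⟩, ⟨ha, hb⟩, rfl⟩
      exact ⟨geod a b (fun h => Set.disjoint_left.1 hd ha (h ▸ hb)), ⟨a, ha, b, hb, rfl⟩, rfl⟩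
  rw [this]
  exact (hU.prod hV).image continuous_sym2_mk

/-- The geodesics with the end `e`. -/
def endingAt (e : OnePoint ℝ) : Set Geodesic := {g | ∃ b, g.HasEnds e b}

lemma mem_endingAt_iff {e : OnePoint ℝ} {g : Geodesic} {a b : OnePoint ℝ} (h : g.HasEnds a b) :
    g ∈ endingAt e ↔ e = a ∨ e = b := by
  constructor
  · rintro ⟨b', h'⟩
    rcases h.cases h' with ⟨rfl, rfl⟩ | ⟨rfl, rfl⟩
    · exact Or.inl rfl
    · exact Or.inr rfl
  · rintro (rfl | rfl)
    · exact ⟨b, h⟩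
    · exact ⟨a, h.symm⟩

/-- Crossing a fixed geodesic is an open condition. -/
lemma isOpen_crosses (g : Geodesic) : IsOpen {h | Crosses g h} := by
  obtain ⟨a, b, hab⟩ := g.exists_hasEnds
  obtain ⟨γ, ha, hb⟩ := exists_smul_eq_infty_zero hab.ne
  let F : OnePoint ℝ → OnePoint ℝ → ℝ := fun p q => dirEntry 0 1 p * dirEntry 0 1 q
  have hF : ∀ p q, F p q = F q p := fun p q => mul_comm _ _
  have hc : Continuous (endsFun F hF) := by
    refine continuous_endsFun hF ?_
    have := continuous_dirEntry
    fun_prop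
  have : {h | Crosses g h} = {h | endsFun F hF (γ • h) < 0} := by
    ext h
    obtain ⟨p, q, hpq⟩ := h.exists_hasEnds
    have hab' := hab.smul γ
    rw [ha, hb] at hab'
    rw [Set.mem_ofPred_eq, Set.mem_ofPred_eq, ← crosses_smul γ, crosses_iff hab' (hpq.smul γ),
      endsFun_eq hF (hpq.smul γ)]
    generalize γ • p = p
    generalize γ • q = q
    have h1 := homCoord_sq_pos p
    have h2 := homCoord_sq_pos q
    have : F p q = (homCoord p 0 * homCoord p 1 * (homCoord q 0 * homCoord q 1)) /
        ((homCoord p 0 ^ 2 + homCoord p 1 ^ 2) * (homCoord q 0 ^ 2 + homCoord q 1 ^ 2)) := by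
      simp only [F, dirEntry]; field_simp
    rw [this, div_neg_iff]
    have h3 := mul_pos h1 h2
    have h4 := h3.not_gt
    simp only [h3, h4, and_false, and_true, false_or, Separates, bracket, homCoord_infty_zero,
      homCoord_infty_one, homCoord_coe_zero, homCoord_coe_one]
    ring_nf
  rw [this]
  exact isOpen_lt (hc.comp (continuous_const_smul γ)) continuous_const

/-! ### Discrete groups of isometries -/

lemma mem_center_iff {γ : GL (Fin 2) ℝ} :
    γ ∈ Subgroup.center (GL (Fin 2) ℝ) ↔ γ 0 1 = 0 ∧ γ 1 0 = 0 ∧ γ 0 0 = γ 1 1 := by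
  rw [Matrix.GeneralLinearGroup.mem_center_iff_val_mem_range_scalar]
  constructor
  · rintro ⟨r, hr⟩
    rw [← hr]; simp
  · rintro ⟨h1, h2, h3⟩
    refine ⟨γ 0 0, ?_⟩
    ext i j
    fin_cases i <;> fin_cases j <;> simp [h1, h2, h3]

lemma smul_onePoint_of_mem_center {γ : GL (Fin 2) ℝ}
    (h : γ ∈ Subgroup.center (GL (Fin 2) ℝ)) (a : OnePoint ℝ) : γ • a = a := by
  obtain ⟨h1, h2, h3⟩ := mem_center_iff.1 h
  have hd := entries_det_ne_zero γ
  have h4 : γ 1 1 ≠ 0 := by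
    intro h0; simp [h1, h2, h3, h0] at hd
  rcases eq_infty_or_coe a with rfl | ⟨t, rfl⟩
  · simp [OnePoint.smul_infty_eq_ite, h2]
  · simp [OnePoint.smul_some_eq_ite, h1, h2, h3, h4]

lemma smul_upperHalfPlane_of_mem_center {γ : GL (Fin 2) ℝ}
    (h : γ ∈ Subgroup.center (GL (Fin 2) ℝ)) (z : ℍ) : γ • z = z :=
  UpperHalfPlane.forall_smul_eq_self_iff_mem_center.2 h z

namespace IsFiniteAreaSurfaceGroup

variable {Γ : Subgroup (GL (Fin 2) ℝ)}

lemma finite_inter (hΓ : IsFiniteAreaSurfaceGroup Γ) {K L : Set ℍ} (hK : IsCompact K)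
    (hL : IsCompact L) : {γ | γ ∈ Γ ∧ ∃ z ∈ K, γ • z ∈ L}.Finite := by
  have h := hΓ.properlyDiscontinuous.finite_disjoint_inter_image hK hL
  refine (h.image Subtype.val).subset ?_
  rintro γ ⟨hγ, z, hz, hz'⟩
  exact ⟨⟨γ, hγ⟩, ⟨γ • z, ⟨z, hz, rfl⟩, hz'⟩, rfl⟩

lemma countable (hΓ : IsFiniteAreaSurfaceGroup Γ) : Countable Γ := by
  have : (Γ : Set (GL (Fin 2) ℝ)).Countable := by
    have h : (Γ : Set (GL (Fin 2) ℝ)) ⊆ ⋃ n : ℕ, {γ | γ ∈ Γ ∧ ∃ z ∈ ({UpperHalfPlane.I} : Set ℍ),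
        γ • z ∈ Metric.closedBall UpperHalfPlane.I (n : ℝ)} := by
      intro γ hγ
      obtain ⟨n, hn⟩ := exists_nat_ge (dist (γ • UpperHalfPlane.I) UpperHalfPlane.I)
      exact Set.mem_iUnion.2 ⟨n, hγ, _, rfl, hn⟩
    refine (Set.countable_iUnion fun n => ?_).mono h
    exact (hΓ.finite_inter isCompact_singleton (isCompact_closedBall _ _)).countable
  exact this.to_subtype

lemma mem_center_of_smul_eq (hΓ : IsFiniteAreaSurfaceGroup Γ) {γ : GL (Fin 2) ℝ} (hγ : γ ∈ Γ)
    {z : ℍ} (hz : γ • z = z) : γ ∈ Subgroup.center (GL (Fin 2) ℝ) :=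
  UpperHalfPlane.forall_smul_eq_self_iff_mem_center.1 (hΓ.free γ hγ z hz)

lemma not_isElliptic (hΓ : IsFiniteAreaSurfaceGroup Γ) {γ : GL (Fin 2) ℝ} (hγ : γ ∈ Γ)
    (hdet : 0 < γ.val.det) : ¬ γ.IsElliptic := by
  intro h
  have := hΓ.mem_center_of_smul_eq hγ
    ((UpperHalfPlane.gl_smul_eq_self_iff_eq_fixedPt hdet h).2 rfl)
  obtain ⟨h1, h2, h3⟩ := mem_center_iff.1 this
  have h4 : γ.val.discr < 0 := h
  rw [Matrix.discr_fin_two, Matrix.trace_fin_two, Matrix.det_fin_two] at h4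
  nlinarith

lemma four_mul_det_le (hΓ : IsFiniteAreaSurfaceGroup Γ) {γ : GL (Fin 2) ℝ} (hγ : γ ∈ Γ)
    (hdet : 0 < γ.val.det) : 4 * (γ 0 0 * γ 1 1 - γ 0 1 * γ 1 0) ≤ (γ 0 0 + γ 1 1) ^ 2 := by
  have h4 : ¬ γ.val.discr < 0 := hΓ.not_isElliptic hγ hdet
  rw [Matrix.discr_fin_two, Matrix.trace_fin_two, Matrix.det_fin_two] at h4
  linarith

/-- Half turns, reflections and the elements exchanging the ends of a geodesic have trace zero,
and each of them has a fixed point. -/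
lemma trace_ne_zero (hΓ : IsFiniteAreaSurfaceGroup Γ) {γ : GL (Fin 2) ℝ} (hγ : γ ∈ Γ)
    (hc : γ ∉ Subgroup.center (GL (Fin 2) ℝ)) : γ 0 0 + γ 1 1 ≠ 0 := by
  intro h0
  rcases γ.det_ne_zero.lt_or_gt with h | h
  · obtain ⟨z, hz⟩ := (UpperHalfPlane.exists_gl_smul_eq_self_iff_trace_eq_zero h).2
      (by rw [Matrix.trace_fin_two]; exact h0)
    exact hc (hΓ.mem_center_of_smul_eq hγ hz)
  · have h1 := hΓ.four_mul_det_le hγ h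
    rw [Matrix.det_fin_two] at h
    rw [h0] at h1
    linarith

lemma sq_notMem_center (hΓ : IsFiniteAreaSurfaceGroup Γ) {γ : GL (Fin 2) ℝ} (hγ : γ ∈ Γ)
    (hc : γ ∉ Subgroup.center (GL (Fin 2) ℝ)) : γ * γ ∉ Subgroup.center (GL (Fin 2) ℝ) := by
  intro h
  have ht := hΓ.trace_ne_zero hγ hc
  obtain ⟨h1, h2, h3⟩ := mem_center_iff.1 h
  simp only [Units.val_mul, Matrix.mul_apply, Fin.sum_univ_two] at h1 h2 h3
  apply hc
  rw [mem_center_iff]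
  refine ⟨mul_left_cancel₀ ht ?_, mul_left_cancel₀ ht ?_, mul_left_cancel₀ ht ?_⟩ <;> linarith

end IsFiniteAreaSurfaceGroup

/-! ### Conjugation -/

/-- The group `g Γ g⁻¹`. -/
def conjGroup (g : GL (Fin 2) ℝ) (Γ : Subgroup (GL (Fin 2) ℝ)) : Subgroup (GL (Fin 2) ℝ) :=
  Γ.map (MulAut.conj g).toMonoidHom

lemma mem_conjGroup {g γ : GL (Fin 2) ℝ} {Γ : Subgroup (GL (Fin 2) ℝ)} :
    γ ∈ conjGroup g Γ ↔ g⁻¹ * γ * g ∈ Γ := by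
  unfold conjGroup
  rw [Subgroup.mem_map]
  constructor
  · rintro ⟨δ, hδ, rfl⟩
    simpa [mul_assoc] using hδ
  · intro h
    exact ⟨_, h, by simp [mul_assoc]⟩

lemma conj_mem_conjGroup {g γ : GL (Fin 2) ℝ} {Γ : Subgroup (GL (Fin 2) ℝ)} (h : γ ∈ Γ) :
    g * γ * g⁻¹ ∈ conjGroup g Γ := by
  rw [mem_conjGroup]; simpa [mul_assoc] using h

lemma conj_mem_center_iff {g γ : GL (Fin 2) ℝ} :
    g * γ * g⁻¹ ∈ Subgroup.center (GL (Fin 2) ℝ) ↔ γ ∈ Subgroup.center (GL (Fin 2) ℝ) :=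
  (Subgroup.Normal.mem_comm_iff inferInstance).trans (by simp)

lemma measurePreserving_smul (γ : GL (Fin 2) ℝ) :
    MeasurePreserving (fun z : ℍ => γ • z) volume volume :=
  MeasureTheory.measurePreserving_smul γ volume

lemma IsFiniteAreaSurfaceGroup.conj {Γ : Subgroup (GL (Fin 2) ℝ)}
    (hΓ : IsFiniteAreaSurfaceGroup Γ) (g : GL (Fin 2) ℝ) :
    IsFiniteAreaSurfaceGroup (conjGroup g Γ) where
  properlyDiscontinuous := by
    refine ⟨fun {K L} hK hL => ?_⟩
    have h := hΓ.finite_inter (hK.image (continuous_const_smul g⁻¹))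
      (hL.image (continuous_const_smul g⁻¹))
    have h2 := h.image (fun γ => g * γ * g⁻¹)
    refine Set.Finite.of_finite_image (f := Subtype.val) (h2.subset ?_)
      Subtype.val_injective.injOn
    rintro _ ⟨⟨γ, hγ⟩, ⟨_, ⟨z, hz, rfl⟩, hz'⟩, rfl⟩
    refine ⟨g⁻¹ * γ * g, ⟨mem_conjGroup.1 hγ, g⁻¹ • z, ⟨z, hz, rfl⟩, γ • z, hz', ?_⟩, ?_⟩
    · simp [mul_smul]
    · simp [mul_assoc]
  free := by
    intro γ hγ z hz w
    have h1 : (g⁻¹ * γ * g) • (g⁻¹ • z) = g⁻¹ • z := by simp [mul_smul, hz]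
    have h2 := hΓ.free _ (mem_conjGroup.1 hγ) _ h1 (g⁻¹ • w)
    have h3 : g⁻¹ • γ • w = g⁻¹ • w := by simpa [mul_smul] using h2
    exact MulAction.injective _ h3
  finite_area := by
    obtain ⟨F, hF, hvol, hcov⟩ := hΓ.finite_area
    refine ⟨(fun z => g⁻¹ • z) ⁻¹' F, (measurePreserving_smul g⁻¹).measurable hF, ?_, fun z => ?_⟩
    · rwa [(measurePreserving_smul g⁻¹).measure_preimage hF.nullMeasurableSet]
    · obtain ⟨γ, hγ, h⟩ := hcov (g⁻¹ • z)
      refine ⟨g * γ * g⁻¹, conj_mem_conjGroup hγ, ?_⟩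
      simpa [mul_smul] using h

/-! ### Comparing measures of sets of representatives -/

/-- A set that meets each orbit at most once has at most the measure of any set that meets all
orbits through it. -/
lemma measure_le_of_injecting {Γ : Subgroup (GL (Fin 2) ℝ)} (hΓ : IsFiniteAreaSurfaceGroup Γ)
    {ν : Measure ℍ}
    (hν : ∀ γ ∈ Γ, ∀ A : Set ℍ, MeasurableSet A → ν ((fun z => γ • z) ⁻¹' A) = ν A)
    {A D : Set ℍ} (hA : MeasurableSet A) (hD : MeasurableSet D)
    (hinj : ∀ z ∈ A, ∀ γ ∈ Γ, γ • z ∈ A → γ ∈ Subgroup.center (GL (Fin 2) ℝ))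
    (hcov : ∀ z ∈ A, ∃ γ ∈ Γ, γ • z ∈ D) : ν A ≤ ν D := by
  have := hΓ.countable
  let N := (Subgroup.center (GL (Fin 2) ℝ)).subgroupOf Γ
  have : Countable (Γ ⧸ N) := Quotient.countable
  let φ : Γ ⧸ N → GL (Fin 2) ℝ := fun i => (Quotient.out i : Γ)
  have hφ : ∀ i, φ i ∈ Γ := fun i => (Quotient.out i : Γ).2
  have hm : ∀ γ : GL (Fin 2) ℝ, Measurable fun z : ℍ => γ • z :=
    fun γ => (continuous_const_smul γ).measurable
  calc ν A ≤ ν (⋃ i, A ∩ (fun z => φ i • z) ⁻¹' D) := by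
        refine measure_mono fun z hz => ?_
        obtain ⟨γ, hγ, h⟩ := hcov z hz
        refine Set.mem_iUnion.2 ⟨QuotientGroup.mk (⟨γ, hγ⟩ : Γ), hz, ?_⟩
        obtain ⟨⟨n, hn⟩, hn'⟩ := QuotientGroup.mk_out_eq_mul N (⟨γ, hγ⟩ : Γ)
        have e : φ (QuotientGroup.mk (⟨γ, hγ⟩ : Γ)) = γ * n := congrArg Subtype.val hn'
        rw [Set.mem_preimage, e, mul_smul, smul_upperHalfPlane_of_mem_center (γ := (n : GL (Fin 2) ℝ))
          (Subgroup.mem_subgroupOf.1 hn)]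
        exact h
    _ ≤ ∑' i, ν (A ∩ (fun z => φ i • z) ⁻¹' D) := measure_iUnion_le _
    _ = ∑' i, ν ((fun z => (φ i)⁻¹ • z) ⁻¹' A ∩ D) := by
        congr 1; funext i
        rw [← hν (φ i) (hφ i) _ ((hm _ hA).inter hD)]
        congr 1; ext z; simp
    _ = ν (⋃ i, (fun z => (φ i)⁻¹ • z) ⁻¹' A ∩ D) := by
        rw [measure_iUnion _ fun i => (hm _ hA).inter hD]
        intro i j hij
        rw [Function.onFun, Set.disjoint_left]
        rintro z ⟨h1, -⟩ ⟨h2, -⟩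
        apply hij
        have h3 : ((φ j)⁻¹ * φ i) • ((φ i)⁻¹ • z) ∈ A := by simpa [mul_smul] using h2
        have h4 := hinj _ h1 _ (Γ.mul_mem (Γ.inv_mem (hφ j)) (hφ i)) h3
        have h5 : (Quotient.out j : Γ)⁻¹ * (Quotient.out i : Γ) ∈ N :=
          Subgroup.mem_subgroupOf.2 h4
        have h6 := QuotientGroup.eq.2 h5
        rwa [QuotientGroup.out_eq', QuotientGroup.out_eq', eq_comm] at h6
    _ ≤ ν D := measure_mono (Set.iUnion_subset fun i => Set.inter_subset_right)

/-! ### Geodesic rays towards a point at infinity -/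

lemma dist_smul_smul (γ : GL (Fin 2) ℝ) (z w : ℍ) : dist (γ • z) (γ • w) = dist z w := by
  have h : ∀ z w : ℍ, Real.cosh (dist z w) = 1 + dist (z : ℂ) w ^ 2 / (2 * z.im * w.im) :=
    UpperHalfPlane.cosh_dist
  have key : Real.cosh (dist (γ • z) (γ • w)) = Real.cosh (dist z w) := by
    rw [h, h]
    congr 1
    have hz := UpperHalfPlane.denom_ne_zero γ z
    have hw := UpperHalfPlane.denom_ne_zero γ w
    have hz' : 0 < ‖UpperHalfPlane.denom γ z‖ := norm_pos_iff.2 hz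
    have hw' : 0 < ‖UpperHalfPlane.denom γ w‖ := norm_pos_iff.2 hw
    have hd : |γ.det.val| ≠ 0 := by
      rw [abs_ne_zero, Matrix.GeneralLinearGroup.val_det_apply]; exact γ.det_ne_zero
    have e : ((γ • z : ℍ) : ℂ) - ((γ • w : ℍ) : ℂ) = UpperHalfPlane.σ γ
        ((γ.det.val : ℂ) * (z - w) / (UpperHalfPlane.denom γ z * UpperHalfPlane.denom γ w)) := by
      rw [UpperHalfPlane.coe_smul, UpperHalfPlane.coe_smul, ← map_sub]
      congr 1
      rw [div_sub_div _ _ hz hw]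
      congr 1
      simp only [UpperHalfPlane.num, UpperHalfPlane.denom, Matrix.GeneralLinearGroup.val_det_apply,
        Matrix.det_fin_two]
      push_cast
      ring
    rw [dist_eq_norm, e, UpperHalfPlane.norm_σ, UpperHalfPlane.im_smul_eq_div_normSq,
      UpperHalfPlane.im_smul_eq_div_normSq, Complex.normSq_eq_norm_sq, Complex.normSq_eq_norm_sq,
      dist_eq_norm, norm_div, norm_mul, norm_mul, Complex.norm_real, Real.norm_eq_abs]
    have := z.im_pos
    have := w.im_pos
    field_simp
  exact Real.cosh_strictMonoOn.injOn dist_nonneg dist_nonneg key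

/-- The point of the imaginary axis at height `exp s`. -/
noncomputable def axisPt (s : ℝ) : ℍ := ⟨⟨0, Real.exp s⟩, Real.exp_pos s⟩

@[simp] lemma axisPt_re (s : ℝ) : (axisPt s).re = 0 := rfl
@[simp] lemma axisPt_im (s : ℝ) : (axisPt s).im = Real.exp s := rfl

lemma volume_ball_eq (z w : ℍ) (r : ℝ) :
    volume (Metric.ball z r) = volume (Metric.ball w r) := by
  obtain ⟨g, hg⟩ := MulAction.exists_smul_eq (GL (Fin 2) ℝ) z w
  have : Metric.ball z r = (fun x : ℍ => g • x) ⁻¹' Metric.ball w r := by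
    ext x
    rw [Set.mem_preimage, Metric.mem_ball, Metric.mem_ball, ← hg, dist_smul_smul]
  rw [this, (measurePreserving_smul g).measure_preimage
    Metric.isOpen_ball.measurableSet.nullMeasurableSet]

lemma volume_ball_pos (z : ℍ) {r : ℝ} (hr : 0 < r) : 0 < volume (Metric.ball z r) := by
  rw [pos_iff_ne_zero]
  intro h0
  rw [UpperHalfPlane.volume_def] at h0
  have h1 := withDensity_absolutelyContinuous' (μ := volume.comap UpperHalfPlane.coe)
    (f := fun z : ℍ => (((1 / NNReal.mk z.im z.im_pos.le : NNReal) ^ 2 : NNReal) : ℝ≥0∞)) (by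
      refine Measurable.aemeasurable ?_
      refine measurable_coe_nnreal_ennreal.comp (Measurable.pow_const ?_ _)
      refine Measurable.const_div ?_ _
      exact UpperHalfPlane.continuous_im.measurable.subtype_mk) (by
      refine Filter.Eventually.of_forall fun z => ?_
      have : NNReal.mk z.im z.im_pos.le ≠ 0 := fun h => z.im_pos.ne' (congrArg NNReal.toReal h)
      exact_mod_cast pow_ne_zero 2 (one_div_ne_zero this))
  have h2 := h1 h0
  rw [UpperHalfPlane.measurableEmbedding_coe.comap_apply] at h2
  have h3 : IsOpen (UpperHalfPlane.coe '' Metric.ball z r) :=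
    UpperHalfPlane.isOpenEmbedding_coe.isOpenMap _ Metric.isOpen_ball
  exact (h3.measure_pos volume ⟨_, z, Metric.mem_ball_self hr, rfl⟩).ne' h2

/-- If the imaginary axis leaves every compact subset of the surface in the direction of `∞`, then
the injectivity radius tends to zero along it: otherwise the surface would contain infinitely many
disjoint discs of the same size. -/
lemma IsFiniteAreaSurfaceGroup.exists_dist_lt {Γ : Subgroup (GL (Fin 2) ℝ)}
    (hΓ : IsFiniteAreaSurfaceGroup Γ)
    (hdiv : ∀ R : ℝ, ∃ T : ℝ, ∀ s, T ≤ s → ∀ γ ∈ Γ, R < dist (γ • axisPt s) UpperHalfPlane.I)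
    {ε : ℝ} (hε : 0 < ε) :
    ∃ T : ℝ, ∀ s, T ≤ s → ∃ γ ∈ Γ, γ ∉ Subgroup.center (GL (Fin 2) ℝ) ∧
      dist (γ • axisPt s) (axisPt s) < ε := by
  by_contra! hcon
  obtain ⟨f, hf, hfar⟩ := exists_seq_of_forall_finset_exists
    (fun s : ℝ => ∀ γ ∈ Γ, γ ∉ Subgroup.center (GL (Fin 2) ℝ) →
      ε ≤ dist (γ • axisPt s) (axisPt s))
    (fun s t => ∀ γ ∈ Γ, ε ≤ dist (γ • axisPt t) (axisPt s)) (by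
      intro S hS
      obtain ⟨B, hB⟩ := (S.image fun s => dist UpperHalfPlane.I (axisPt s)).exists_le
      obtain ⟨T, hT⟩ := hdiv (B + ε)
      obtain ⟨t, ht, h⟩ := hcon T
      refine ⟨t, h, fun s hs γ hγ => ?_⟩
      have h1 := hB _ (Finset.mem_image_of_mem _ hs)
      have h2 := hT t ht γ hγ
      have h3 := dist_triangle (γ • axisPt t) (axisPt s) UpperHalfPlane.I
      rw [dist_comm (axisPt s)] at h3
      linarith)
  obtain ⟨F, hF, hFfin, hcov⟩ := hΓ.finite_area
  have hfar' : ∀ m n, m ≠ n → ∀ γ ∈ Γ, ε ≤ dist (γ • axisPt (f m)) (axisPt (f n)) := by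
    intro m n hmn γ hγ
    rcases lt_or_gt_of_ne hmn with h | h
    · have h1 := hfar m n h γ⁻¹ (Γ.inv_mem hγ)
      rwa [← dist_smul_smul γ, smul_inv_smul, dist_comm] at h1
    · exact hfar n m h γ hγ
  have hclose : ∀ m n, ∀ γ ∈ Γ, ∀ z ∈ Metric.ball (axisPt (f m)) (ε / 2),
      γ • z ∈ Metric.ball (axisPt (f n)) (ε / 2) → dist (γ • axisPt (f m)) (axisPt (f n)) < ε := by
    intro m n γ hγ z hz hz'
    have h1 := dist_triangle (γ • axisPt (f m)) (γ • z) (axisPt (f n))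
    rw [dist_smul_smul, dist_comm (axisPt (f m))] at h1
    rw [Metric.mem_ball] at hz hz'
    linarith
  set v := volume (Metric.ball UpperHalfPlane.I (ε / 2)) with hv
  have hvpos : 0 < v := volume_ball_pos _ (by linarith)
  have hbound : ∀ N : ℕ, N * v ≤ volume F := by
    intro N
    have hdisj : Pairwise (Function.onFun Disjoint fun n : ℕ => Metric.ball (axisPt (f n)) (ε / 2)) := by
      intro m n hmn
      rw [Function.onFun, Set.disjoint_left]
      intro z hz hz'
      have h1 := hclose m n 1 Γ.one_mem z hz (by simpa using hz')
      have h2 := hfar' m n hmn 1 Γ.one_mem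
      linarith
    have hA : volume (⋃ n ∈ Finset.range N, Metric.ball (axisPt (f n)) (ε / 2)) = N * v := by
      rw [measure_biUnion_finset (fun m _ n _ hmn => hdisj hmn)
        fun n _ => Metric.isOpen_ball.measurableSet]
      simp [volume_ball_eq _ UpperHalfPlane.I, hv]
    rw [← hA]
    refine measure_le_of_injecting hΓ ?_ ?_ hF ?_ fun z _ => hcov z
    · intro γ _ A hA
      exact (measurePreserving_smul γ).measure_preimage hA.nullMeasurableSet
    · exact Finset.measurableSet_biUnion _ fun n _ => Metric.isOpen_ball.measurableSet
    · intro z hz γ hγ hz'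
      simp only [Set.mem_iUnion] at hz hz'
      obtain ⟨m, -, hm⟩ := hz
      obtain ⟨n, -, hn⟩ := hz'
      have h1 := hclose m n γ hγ z hm hn
      by_contra hcen
      rcases eq_or_ne m n with rfl | hmn
      · exact absurd h1 (not_lt.2 (hf m γ hγ hcen))
      · exact absurd h1 (not_lt.2 (hfar' m n hmn γ hγ))
  have : volume F = ⊤ := by
    by_contra hne
    obtain ⟨N, hN⟩ := ENNReal.exists_nat_mul_gt hvpos.ne' hne
    exact absurd (hbound N) (not_le.2 hN)
  exact hFfin.ne this

/-! ### Small displacements -/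

/-- The group of the matrices of determinant one that act like an element of `Γ`. -/
def unimodularGroup (Γ : Subgroup (GL (Fin 2) ℝ)) : Subgroup (GL (Fin 2) ℝ) where
  carrier := {M | M.val.det = 1 ∧ ∃ c ∈ Subgroup.center (GL (Fin 2) ℝ), c * M ∈ Γ}
  one_mem' := ⟨by simp, 1, one_mem _, by simp [Γ.one_mem]⟩
  mul_mem' := by
    rintro M N ⟨hM, c, hc, hcM⟩ ⟨hN, d, hd, hdN⟩
    refine ⟨by simp [hM, hN], c * d, mul_mem hc hd, ?_⟩
    have : c * d * (M * N) = c * M * (d * N) := by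
      have := Subgroup.mem_center_iff.1 hd M
      rw [mul_assoc, mul_assoc, ← mul_assoc d M N, ← this, mul_assoc]
    rw [this]; exact Γ.mul_mem hcM hdN
  inv_mem' := by
    rintro M ⟨hM, c, hc, hcM⟩
    refine ⟨by simp [hM], c⁻¹, inv_mem hc, ?_⟩
    have h := Subgroup.mem_center_iff.1 (inv_mem hc) M⁻¹
    rw [← h, ← mul_inv_rev]
    exact Γ.inv_mem hcM

lemma exists_smul_eq_of_mem_unimodularGroup {Γ : Subgroup (GL (Fin 2) ℝ)} {M : GL (Fin 2) ℝ}
    (h : M ∈ unimodularGroup Γ) : ∃ γ ∈ Γ, (∀ z : ℍ, γ • z = M • z) ∧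
      (∀ a : OnePoint ℝ, γ • a = M • a) ∧ (γ ∈ Subgroup.center (GL (Fin 2) ℝ) ↔
        M ∈ Subgroup.center (GL (Fin 2) ℝ)) := by
  obtain ⟨-, c, hc, hcM⟩ := h
  refine ⟨c * M, hcM, fun z => ?_, fun a => ?_, ?_⟩
  · rw [mul_smul, smul_upperHalfPlane_of_mem_center hc]
  · rw [mul_smul, smul_onePoint_of_mem_center hc]
  · exact Subgroup.mul_mem_cancel_left _ hc

lemma exists_mem_unimodularGroup {Γ : Subgroup (GL (Fin 2) ℝ)} {γ : GL (Fin 2) ℝ} (h : γ ∈ Γ)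
    (hdet : 0 < γ.val.det) : ∃ M ∈ unimodularGroup Γ, (∀ z : ℍ, M • z = γ • z) ∧
      (M ∈ Subgroup.center (GL (Fin 2) ℝ) ↔ γ ∈ Subgroup.center (GL (Fin 2) ℝ)) := by
  have hs : 0 < Real.sqrt γ.val.det := Real.sqrt_pos.2 hdet
  let c : GL (Fin 2) ℝ := Matrix.GeneralLinearGroup.scalar (Fin 2) (Units.mk0 _ hs.ne')
  have hc : c ∈ Subgroup.center (GL (Fin 2) ℝ) := by
    rw [mem_center_iff]; simp [c]
  refine ⟨c⁻¹ * γ, ⟨?_, c, hc, by simpa using h⟩, fun z => ?_, ?_⟩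
  · have hcdet : c.val.det = γ.val.det := by
      have : c.val.det = Real.sqrt γ.val.det * Real.sqrt γ.val.det := by
        rw [Matrix.det_fin_two]; simp [c]
      rw [this, Real.mul_self_sqrt hdet.le]
    rw [Units.val_mul, Matrix.det_mul, Matrix.coe_units_inv, Matrix.det_nonsing_inv, hcdet]
    simp [hdet.ne']
  · rw [mul_smul, smul_upperHalfPlane_of_mem_center (inv_mem hc)]
  · exact Subgroup.mul_mem_cancel_left _ (inv_mem hc)

/-- For a matrix `M` of determinant one this is `2 (cosh d - 1)`, where `d` is the distance by
which `M` moves the point `axisPt s`. -/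
noncomputable def displacement (s : ℝ) (M : GL (Fin 2) ℝ) : ℝ :=
  (M 0 0 - M 1 1) ^ 2 + (M 0 1 * Real.exp (-s) + M 1 0 * Real.exp s) ^ 2

lemma two_mul_cosh_dist {M : GL (Fin 2) ℝ} (hM : M.val.det = 1) (s : ℝ) :
    2 * Real.cosh (dist (M • axisPt s) (axisPt s)) = 2 + displacement s M := by
  have hd := UpperHalfPlane.denom_ne_zero M (axisPt s)
  have hpos : 0 < M.det.val := by
    rw [Matrix.GeneralLinearGroup.val_det_apply, hM]; exact one_pos
  have hes := Real.exp_pos s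
  have e0 : ((axisPt s : ℍ) : ℂ) = ⟨0, Real.exp s⟩ := rfl
  rw [UpperHalfPlane.cosh_dist, UpperHalfPlane.im_smul_eq_div_normSq, dist_eq_norm,
    UpperHalfPlane.coe_smul_of_det_pos hpos, div_sub' hd, norm_div, div_pow,
    ← Complex.normSq_eq_norm_sq, ← Complex.normSq_eq_norm_sq]
  have hn : Complex.normSq (UpperHalfPlane.denom M (axisPt s)) ≠ 0 := by simp
  rw [Matrix.GeneralLinearGroup.val_det_apply, hM, abs_one, axisPt_im]
  have e1 : Complex.normSq (UpperHalfPlane.num M (axisPt s) -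
      UpperHalfPlane.denom M (axisPt s) * (axisPt s)) =
      Real.exp s ^ 2 * displacement s M := by
    rw [e0]
    simp only [UpperHalfPlane.num, UpperHalfPlane.denom, Complex.normSq_apply, Complex.add_re,
      Complex.mul_re, Complex.ofReal_re, Complex.ofReal_im, Complex.add_im, Complex.mul_im,
      Complex.sub_re, Complex.sub_im, displacement, Real.exp_neg]
    field_simp
    ring
  rw [e1]
  field_simp

lemma displacement_nonneg (s : ℝ) (M : GL (Fin 2) ℝ) : 0 ≤ displacement s M := by
  unfold displacement; positivity

lemma displacement_add_one_le (s : ℝ) {M : GL (Fin 2) ℝ} (hM : M.val.det = 1)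
    (ht : 4 ≤ (M 0 0 + M 1 1) ^ 2) : displacement (s + 1) M ≤ 40 * displacement s M := by
  rw [Matrix.det_fin_two] at hM
  have h1 : Real.exp (s + 1) = Real.exp 1 * Real.exp s := by rw [add_comm, Real.exp_add]
  have h2 : Real.exp (-(s + 1)) * Real.exp 1 = Real.exp (-s) := by
    rw [← Real.exp_add]; ring_nf
  have h3 : Real.exp 1 < 3 := by linarith [Real.exp_one_lt_d9]
  have h4 : 1 ≤ Real.exp 1 := Real.one_le_exp zero_le_one
  have h5 : Real.exp (-s) * Real.exp s = 1 := by rw [← Real.exp_add]; simp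
  unfold displacement
  rw [h1]
  rw [← h2] at h5 ⊢
  generalize Real.exp (-(s + 1)) = u at *
  generalize Real.exp s = v at *
  generalize Real.exp 1 = e at *
  generalize M.val 0 0 = a at *
  generalize M.val 0 1 = b at *
  generalize M.val 1 0 = c at *
  generalize M.val 1 1 = d at *
  -- the trace condition bounds the antisymmetric part of the conjugated matrix
  have h6 : (b * (u * e) - c * v) ^ 2 ≤ (a - d) ^ 2 + (b * (u * e) + c * v) ^ 2 := by
    have : b * c = (b * (u * e)) * (c * v) := by
      calc b * c = b * c * (u * e * v) := by rw [h5]; ring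
        _ = _ := by ring
    nlinarith
  have h7 : (b * u) ^ 2 ≤ (b * (u * e)) ^ 2 := by
    have : (b * (u * e)) ^ 2 = (b * u) ^ 2 * e ^ 2 := by ring
    have he : 1 ≤ e ^ 2 := by nlinarith
    rw [this]
    nlinarith [mul_le_mul_of_nonneg_left he (sq_nonneg (b * u))]
  have h8 : (c * (e * v)) ^ 2 ≤ 9 * (c * v) ^ 2 := by
    have : (c * (e * v)) ^ 2 = (c * v) ^ 2 * e ^ 2 := by ring
    have he : e ^ 2 ≤ 9 := by nlinarith
    rw [this]
    nlinarith [mul_le_mul_of_nonneg_left he (sq_nonneg (c * v))]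
  nlinarith [sq_nonneg (b * u - c * (e * v)), sq_nonneg (b * (u * e)), sq_nonneg (c * v),
    sq_nonneg (a - d)]

lemma sum_sq_mul_le (a b c d a' b' c' d' : ℝ) :
    (a * a' + b * c') ^ 2 + (a * b' + b * d') ^ 2 + (c * a' + d * c') ^ 2 + (c * b' + d * d') ^ 2 ≤
      (a ^ 2 + b ^ 2 + c ^ 2 + d ^ 2) * (a' ^ 2 + b' ^ 2 + c' ^ 2 + d' ^ 2) := by
  nlinarith [sq_nonneg (a * c' - b * a'), sq_nonneg (a * d' - b * b'), sq_nonneg (c * c' - d * a'),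
    sq_nonneg (c * d' - d * b')]

/-- The squared norm of `A B - B A` for two matrices `A`, `B`, in terms of their traceless parts. -/
lemma sum_sq_commutator_le (a b c d a' b' c' d' : ℝ) :
    2 * (b * c' - c * b') ^ 2 + ((a - d) * b' - (a' - d') * b) ^ 2 +
      ((a' - d') * c - (a - d) * c') ^ 2 ≤
      4 * ((a - d) ^ 2 + b ^ 2 + c ^ 2) * ((a' - d') ^ 2 + b' ^ 2 + c' ^ 2) := by
  generalize a - d = A
  generalize a' - d' = A'
  nlinarith [sq_nonneg (b * b' + c * c'), sq_nonneg (A * A' + b * b'), sq_nonneg (A * A' + c * c'),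
    sq_nonneg (A * A'), sq_nonneg (b * b'), sq_nonneg (c * c'), sq_nonneg (A * b'),
    sq_nonneg (A * c'), sq_nonneg (A' * b), sq_nonneg (A' * c), sq_nonneg (b * c'),
    sq_nonneg (c * b')]

lemma traceless_le {a b c d : ℝ} (h : a * d - b * c = 1) (ht : 4 ≤ (a + d) ^ 2) :
    (a - d) ^ 2 + b ^ 2 + c ^ 2 ≤ 2 * ((a - d) ^ 2 + (b + c) ^ 2) := by
  nlinarith [sq_nonneg (a - d), sq_nonneg (b + c)]

/-- An estimate for the commutator of two matrices of determinant one, in terms of entries. -/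
lemma commutator_entries_le {a b c d a' b' c' d' x y z w : ℝ} (h : a * d - b * c = 1)
    (h' : a' * d' - b' * c' = 1) (ht : 4 ≤ (a + d) ^ 2) (ht' : 4 ≤ (a' + d') ^ 2)
    (hx : x = (b * c' - c * b') * (d * d' + b * c')
      + ((a - d) * b' - (a' - d') * b) * (-(c * d' + a * c')))
    (hy : y = (b * c' - c * b') * (-(d * b' + b * a'))
      + ((a - d) * b' - (a' - d') * b) * (c * b' + a * a'))
    (hz : z = ((a' - d') * c - (a - d) * c') * (d * d' + b * c')
      + (-(b * c' - c * b')) * (-(c * d' + a * c')))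
    (hw : w = ((a' - d') * c - (a - d) * c') * (-(d * b' + b * a'))
      + (-(b * c' - c * b')) * (c * b' + a * a')) :
    x ^ 2 + y ^ 2 + z ^ 2 + w ^ 2 ≤ 16 * ((a - d) ^ 2 + (b + c) ^ 2) *
      ((a' - d') ^ 2 + (b' + c') ^ 2) * ((a - d) ^ 2 + (b + c) ^ 2 + 2) *
      ((a' - d') ^ 2 + (b' + c') ^ 2 + 2) := by
  have e1 := sum_sq_mul_le (b * c' - c * b') ((a - d) * b' - (a' - d') * b)
    ((a' - d') * c - (a - d) * c') (-(b * c' - c * b')) (d * d' + b * c') (-(d * b' + b * a'))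
    (-(c * d' + a * c')) (c * b' + a * a')
  rw [← hx, ← hy, ← hz, ← hw] at e1
  have e2 := sum_sq_commutator_le a b c d a' b' c' d'
  have e3 := sum_sq_mul_le d (-b) (-c) a d' (-b') (-c') a'
  have e4 := traceless_le h ht
  have e5 := traceless_le h' ht'
  have n1 : a ^ 2 + b ^ 2 + c ^ 2 + d ^ 2 = (a - d) ^ 2 + (b + c) ^ 2 + 2 := by
    linear_combination 2 * h
  have n2 : a' ^ 2 + b' ^ 2 + c' ^ 2 + d' ^ 2 = (a' - d') ^ 2 + (b' + c') ^ 2 + 2 := by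
    linear_combination 2 * h'
  set P := (a - d) ^ 2 + (b + c) ^ 2 with hP
  set P' := (a' - d') ^ 2 + (b' + c') ^ 2 with hP'
  have p0 : 0 ≤ P := by positivity
  have p0' : 0 ≤ P' := by positivity
  have f1 : (b * c' - c * b') ^ 2 + ((a - d) * b' - (a' - d') * b) ^ 2 +
      ((a' - d') * c - (a - d) * c') ^ 2 + (-(b * c' - c * b')) ^ 2 ≤ 16 * P * P' := by
    have : ((a - d) ^ 2 + b ^ 2 + c ^ 2) * ((a' - d') ^ 2 + b' ^ 2 + c' ^ 2) ≤
        (2 * P) * (2 * P') := by gcongr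
    linarith
  have f2 : (d * d' + b * c') ^ 2 + (-(d * b' + b * a')) ^ 2 + (-(c * d' + a * c')) ^ 2
      + (c * b' + a * a') ^ 2 ≤ (P + 2) * (P' + 2) := by
    rw [← n1, ← n2]; linarith
  calc _ ≤ _ := e1
    _ ≤ (16 * P * P') * ((P + 2) * (P' + 2)) := by gcongr
    _ = _ := by ring

lemma sub_sq_add_add_sq_le (x y z w : ℝ) : (x - w) ^ 2 + (y + z) ^ 2 ≤
    2 * ((x - 1) ^ 2 + y ^ 2 + z ^ 2 + (w - 1) ^ 2) := by
  nlinarith [sq_nonneg (x - 1 + (w - 1)), sq_nonneg (y - z)]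

lemma commutator_scaled_entries_le {a b c d a' b' c' d' u v k00 k01 k10 k11 : ℝ}
    (h : a * d - b * c = 1) (h' : a' * d' - b' * c' = 1) (huv : u * v = 1)
    (ht : 4 ≤ (a + d) ^ 2) (ht' : 4 ≤ (a' + d') ^ 2)
    (h00 : k00 = ((a * a' + b * c') * d + (a * b' + b * d') * (-c)) * d' +
      ((a * a' + b * c') * (-b) + (a * b' + b * d') * a) * (-c'))
    (h01 : k01 = ((a * a' + b * c') * d + (a * b' + b * d') * (-c)) * (-b') +
      ((a * a' + b * c') * (-b) + (a * b' + b * d') * a) * a')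
    (h10 : k10 = ((c * a' + d * c') * d + (c * b' + d * d') * (-c)) * d' +
      ((c * a' + d * c') * (-b) + (c * b' + d * d') * a) * (-c'))
    (h11 : k11 = ((c * a' + d * c') * d + (c * b' + d * d') * (-c)) * (-b') +
      ((c * a' + d * c') * (-b) + (c * b' + d * d') * a) * a') :
    (k00 - 1) ^ 2 + (k01 * u) ^ 2 + (k10 * v) ^ 2 + (k11 - 1) ^ 2 ≤
      16 * ((a - d) ^ 2 + (b * u + c * v) ^ 2) *
      ((a' - d') ^ 2 + (b' * u + c' * v) ^ 2) * ((a - d) ^ 2 + (b * u + c * v) ^ 2 + 2) *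
      ((a' - d') ^ 2 + (b' * u + c' * v) ^ 2 + 2) := by
  have hu : u ≠ 0 := left_ne_zero_of_mul_eq_one huv
  obtain rfl : v = u⁻¹ := eq_inv_of_mul_eq_one_right huv
  have hdd : (1 : ℝ) = (a * d - b * c) * (a' * d' - b' * c') := by rw [h, h']; ring
  refine commutator_entries_le (by rw [← h]; field_simp) (by rw [← h']; field_simp) ht ht'
    ?_ ?_ ?_ ?_
  · rw [h00, hdd]; field_simp; ring
  · rw [h01]; field_simp; ring
  · rw [h10]; field_simp; ring
  · rw [h11, hdd]; field_simp; ring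

/-- The commutator of two matrices close to the identity is much closer to the identity than
either of them. -/
lemma displacement_commutator_le {s : ℝ} {M N : GL (Fin 2) ℝ} (hM : M.val.det = 1)
    (hN : N.val.det = 1) (htM : 4 ≤ (M 0 0 + M 1 1) ^ 2) (htN : 4 ≤ (N 0 0 + N 1 1) ^ 2) :
    displacement s (M * N * M⁻¹ * N⁻¹) ≤
        32 * displacement s M * displacement s N * (displacement s M + 2) * (displacement s N + 2)
      ∧ ((M * N * M⁻¹ * N⁻¹) 0 0 - 1) ^ 2 ≤
        16 * displacement s M * displacement s N * (displacement s M + 2) * (displacement s N + 2)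
      := by
  rw [Matrix.det_fin_two] at hM hN
  have h5 : Real.exp (-s) * Real.exp s = 1 := by rw [← Real.exp_add]; simp
  have hMi : ((M⁻¹ : GL (Fin 2) ℝ) : Matrix (Fin 2) (Fin 2) ℝ) =
      !![M 1 1, -M 0 1; -M 1 0, M 0 0] := by
    rw [Matrix.coe_units_inv, Matrix.inv_def, Matrix.adjugate_fin_two, Matrix.det_fin_two, hM]
    simp
  have hNi : ((N⁻¹ : GL (Fin 2) ℝ) : Matrix (Fin 2) (Fin 2) ℝ) =
      !![N 1 1, -N 0 1; -N 1 0, N 0 0] := by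
    rw [Matrix.coe_units_inv, Matrix.inv_def, Matrix.adjugate_fin_two, Matrix.det_fin_two, hN]
    simp
  set K := M * N * M⁻¹ * N⁻¹ with hK
  have hKm : (K : Matrix (Fin 2) (Fin 2) ℝ) = M.val * N.val * !![M 1 1, -M 0 1; -M 1 0, M 0 0] *
      !![N 1 1, -N 0 1; -N 1 0, N 0 0] := by
    rw [← hMi, ← hNi]; simp [hK]
  have k00 : K 0 0 = (M.val * N.val * !![M 1 1, -M 0 1; -M 1 0, M 0 0] *
      !![N 1 1, -N 0 1; -N 1 0, N 0 0]) 0 0 := by rw [hKm]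
  have k01 : K 0 1 = (M.val * N.val * !![M 1 1, -M 0 1; -M 1 0, M 0 0] *
      !![N 1 1, -N 0 1; -N 1 0, N 0 0]) 0 1 := by rw [hKm]
  have k10 : K 1 0 = (M.val * N.val * !![M 1 1, -M 0 1; -M 1 0, M 0 0] *
      !![N 1 1, -N 0 1; -N 1 0, N 0 0]) 1 0 := by rw [hKm]
  have k11 : K 1 1 = (M.val * N.val * !![M 1 1, -M 0 1; -M 1 0, M 0 0] *
      !![N 1 1, -N 0 1; -N 1 0, N 0 0]) 1 1 := by rw [hKm]
  simp only [Matrix.mul_apply, Fin.sum_univ_two, Matrix.of_apply, Matrix.cons_val', Matrix.cons_val_zero,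
    Matrix.cons_val_one, Matrix.cons_val_fin_one] at k00 k01 k10 k11
  clear_value K
  clear hMi hNi hKm
  have key := commutator_scaled_entries_le (k00 := K 0 0) (k01 := K 0 1) (k10 := K 1 0)
    (k11 := K 1 1) hM hN h5 htM htN (by rw [k00]) (by rw [k01]) (by rw [k10]) (by rw [k11])
  refine ⟨le_trans ?_ ((mul_le_mul_of_nonneg_left key zero_le_two).trans_eq ?_),
    le_trans ?_ (key.trans_eq ?_)⟩
  · exact sub_sq_add_add_sq_le _ _ _ _
  · simp only [displacement]; ring
  · exact le_add_of_le_of_nonneg (le_add_of_le_of_nonneg (le_add_of_nonneg_right (sq_nonneg _))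
      (sq_nonneg _)) (sq_nonneg _)
  · simp only [displacement]

variable {Γ : Subgroup (GL (Fin 2) ℝ)}

lemma IsFiniteAreaSurfaceGroup.four_le_trace_sq (hΓ : IsFiniteAreaSurfaceGroup Γ)
    {M : GL (Fin 2) ℝ} (hM : M ∈ unimodularGroup Γ) : 4 ≤ (M 0 0 + M 1 1) ^ 2 := by
  obtain ⟨hdet, c, hc, hcM⟩ := hM
  obtain ⟨h1, h2, h3⟩ := mem_center_iff.1 hc
  have hcd := entries_det_ne_zero c
  have hc0 : c 0 0 ≠ 0 := by
    rintro h0; rw [← h3, h0, h1] at hcd; simp at hcd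
  have hcM' : (c * M).val.det = c 0 0 ^ 2 := by
    rw [Units.val_mul, Matrix.det_mul, hdet, mul_one, Matrix.det_fin_two, h1, ← h3]; ring
  have h4 := hΓ.four_mul_det_le hcM (by rw [hcM']; positivity)
  rw [← Matrix.det_fin_two, hcM'] at h4
  have e0 : (c * M) 0 0 = c 0 0 * M 0 0 := by
    rw [Units.val_mul, Matrix.mul_apply, Fin.sum_univ_two, h1]; ring
  have e1 : (c * M) 1 1 = c 0 0 * M 1 1 := by
    rw [Units.val_mul, Matrix.mul_apply, Fin.sum_univ_two, h2, h3]; ring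
  rw [e0, e1, ← mul_add, mul_pow, mul_comm] at h4
  exact le_of_mul_le_mul_left h4 (by positivity)

lemma finite_det_one_multiples (γ : GL (Fin 2) ℝ) :
    {M : GL (Fin 2) ℝ | M.val.det = 1 ∧ ∃ c ∈ Subgroup.center (GL (Fin 2) ℝ), c * M = γ}.Finite := by
  by_cases hne : {M : GL (Fin 2) ℝ | M.val.det = 1 ∧
      ∃ c ∈ Subgroup.center (GL (Fin 2) ℝ), c * M = γ}.Nonempty
  · obtain ⟨M, hM, c, hc, rfl⟩ := hne
    refine (Set.toFinite ({M, -M} : Set (GL (Fin 2) ℝ))).subset ?_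
    rintro N ⟨hN, d, hd, hdN⟩
    have hcen : d⁻¹ * c ∈ Subgroup.center (GL (Fin 2) ℝ) := mul_mem (inv_mem hd) hc
    have hNM : N = d⁻¹ * c * M := by
      rw [mul_assoc, ← hdN, inv_mul_cancel_left]
    obtain ⟨h1, h2, h3⟩ := mem_center_iff.1 hcen
    generalize d⁻¹ * c = r at *
    have hr : r 0 0 ^ 2 = 1 := by
      rw [hNM, Units.val_mul, Matrix.det_mul, hM, Matrix.det_fin_two, h1, ← h3] at hN
      linarith
    have hent : ∀ i j, N i j = r 0 0 * M i j := by
      intro i j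
      rw [hNM, Units.val_mul, Matrix.mul_apply, Fin.sum_univ_two]
      fin_cases i <;> simp [h1, h2, h3]
    rcases sq_eq_one_iff.1 hr with h | h
    · left; ext i j; simp [hent, h]
    · right; rw [Set.mem_singleton_iff]; ext i j; simp [hent, h]
  · rw [Set.not_nonempty_iff_eq_empty.1 hne]; exact Set.finite_empty

lemma IsFiniteAreaSurfaceGroup.finite_unimodular (hΓ : IsFiniteAreaSurfaceGroup Γ) (z : ℍ)
    (R : ℝ) : {M | M ∈ unimodularGroup Γ ∧ dist (M • z) z ≤ R}.Finite := by
  have h := hΓ.finite_inter (isCompact_singleton (x := z)) (isCompact_closedBall z R)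
  refine (h.biUnion fun γ _ => finite_det_one_multiples γ).subset ?_
  rintro M ⟨⟨hdet, c, hc, hcM⟩, hd⟩
  refine Set.mem_biUnion (x := c * M) ⟨hcM, z, rfl, ?_⟩ ⟨hdet, c, hc, rfl⟩
  rw [mul_smul, smul_upperHalfPlane_of_mem_center hc]
  exact hd

/-- The elements that move `axisPt s` very little, apart from those that act trivially. -/
def smallElements (Γ : Subgroup (GL (Fin 2) ℝ)) (s : ℝ) : Set (GL (Fin 2) ℝ) :=
  {M | M ∈ unimodularGroup Γ ∧ M ∉ Subgroup.center (GL (Fin 2) ℝ) ∧ displacement s M ≤ 1 / 200}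

lemma IsFiniteAreaSurfaceGroup.finite_smallElements (hΓ : IsFiniteAreaSurfaceGroup Γ) (s : ℝ) :
    (smallElements Γ s).Finite := by
  refine (hΓ.finite_unimodular (axisPt s) 1).subset ?_
  rintro M ⟨hM, -, hd⟩
  refine ⟨hM, ?_⟩
  have h1 := two_mul_cosh_dist hM.1 s
  by_contra! hcon
  have h2 : Real.cosh 1 < Real.cosh (dist (M • axisPt s) (axisPt s)) := by
    rw [Real.cosh_lt_cosh, abs_one, abs_of_nonneg dist_nonneg]; exact hcon
  rw [Real.cosh_eq 1] at h2
  have h3 := Real.exp_one_gt_d9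
  have h4 := Real.exp_pos (-1)
  linarith

lemma IsFiniteAreaSurfaceGroup.displacement_pos (hΓ : IsFiniteAreaSurfaceGroup Γ)
    {M : GL (Fin 2) ℝ} (hM : M ∈ unimodularGroup Γ) (hc : M ∉ Subgroup.center (GL (Fin 2) ℝ))
    (s : ℝ) : 0 < displacement s M := by
  refine lt_of_le_of_ne (displacement_nonneg s M) fun h0 => hc ?_
  have h1 := two_mul_cosh_dist hM.1 s
  rw [← h0] at h1
  have h2 : Real.cosh (dist (M • axisPt s) (axisPt s)) = Real.cosh 0 := by
    rw [Real.cosh_zero]; linarith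
  have h3 := Real.cosh_strictMonoOn.injOn (Set.mem_Ici.2 dist_nonneg) (Set.mem_Ici.2 le_rfl) h2
  obtain ⟨γ, hγ, hz, -, hcen⟩ := exists_smul_eq_of_mem_unimodularGroup hM
  rw [← hcen]
  exact hΓ.mem_center_of_smul_eq hγ ((hz _).trans (dist_eq_zero.1 h3))

/-- The Margulis lemma: there is a nontrivial element that commutes with all elements moving a
given point very little, namely one that moves this point as little as possible. -/
lemma IsFiniteAreaSurfaceGroup.exists_commute (hΓ : IsFiniteAreaSurfaceGroup Γ) {s : ℝ}
    (hne : (smallElements Γ s).Nonempty) :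
    ∃ N ∈ smallElements Γ s, ∀ M ∈ smallElements Γ s, M * N = N * M := by
  obtain ⟨N, hN, hmin⟩ := Set.exists_min_image _ (displacement s) (hΓ.finite_smallElements s) hne
  refine ⟨N, hN, fun M hM => ?_⟩
  have hK : M * N * M⁻¹ * N⁻¹ ∈ unimodularGroup Γ :=
    mul_mem (mul_mem (mul_mem hM.1 hN.1) (inv_mem hM.1)) (inv_mem hN.1)
  obtain ⟨hle, h00⟩ := displacement_commutator_le (s := s) hM.1.1 hN.1.1
    (hΓ.four_le_trace_sq hM.1) (hΓ.four_le_trace_sq hN.1)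
  have hMs := hM.2.2
  have hNs := hN.2.2
  have hM0 := displacement_nonneg s M
  have hN0 := hΓ.displacement_pos hN.1 hN.2.1 s
  have hb : 16 * displacement s M * displacement s N * (displacement s M + 2) *
      (displacement s N + 2) ≤ 0.4 * displacement s N := by
    calc _ ≤ 16 * (1 / 200) * displacement s N * (1 / 200 + 2) * (1 / 200 + 2) := by gcongr
      _ ≤ _ := by nlinarith
  have hlt : displacement s (M * N * M⁻¹ * N⁻¹) < displacement s N := by
    calc _ ≤ 2 * (16 * displacement s M * displacement s N * (displacement s M + 2) *
      (displacement s N + 2)) := by linarith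
      _ < _ := by linarith
  have hcen : M * N * M⁻¹ * N⁻¹ ∈ Subgroup.center (GL (Fin 2) ℝ) := by
    by_contra hcen
    exact absurd (hmin _ ⟨hK, hcen, by linarith⟩) (not_le.2 hlt)
  have hone : M * N * M⁻¹ * N⁻¹ = 1 := by
    obtain ⟨h1, h2, h3⟩ := mem_center_iff.1 hcen
    have hdet := hK.1
    rw [Matrix.det_fin_two, h1, ← h3] at hdet
    generalize M * N * M⁻¹ * N⁻¹ = K at *
    have h4 : (K 0 0 - 1) * (K 0 0 + 1) = 0 := by linarith
    have h5 : K 0 0 + 1 ≠ 0 := by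
      intro h5
      have : K 0 0 = -1 := by linarith
      rw [this] at h00
      linarith
    have h6 : K 0 0 = 1 := by
      have := (mul_eq_zero.1 h4).resolve_right h5
      linarith
    ext i j
    fin_cases i <;> fin_cases j <;> simp [h1, h2, h6, ← h3]
  rw [mul_inv_eq_one, mul_inv_eq_iff_eq_mul] at hone
  exact hone

/-! ### Recurrence of geodesic rays -/

/-- Matrices that commute have proportional traceless parts. -/
lemma entries_of_commute {M N : GL (Fin 2) ℝ} (h : M * N = N * M) :
    M 0 1 * N 1 0 = N 0 1 * M 1 0 ∧
      (M 0 0 - M 1 1) * N 1 0 = (N 0 0 - N 1 1) * M 1 0 := by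
  have h0 : (M * N).val 0 0 = (N * M).val 0 0 := by rw [h]
  have h1 : (M * N).val 1 0 = (N * M).val 1 0 := by rw [h]
  simp only [Units.val_mul, Matrix.mul_apply, Fin.sum_univ_two] at h0 h1
  constructor
  · linarith
  · linarith

/-- If no nontrivial element of the group fixes `∞`, then the geodesic ray towards `∞` returns to
a compact part of the surface again and again. -/
theorem IsFiniteAreaSurfaceGroup.recurrent (hΓ : IsFiniteAreaSurfaceGroup Γ)
    (hfix : ∀ γ ∈ Γ, γ • (OnePoint.infty : OnePoint ℝ) = OnePoint.infty →
      γ ∈ Subgroup.center (GL (Fin 2) ℝ)) :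
    ∃ R : ℝ, ∀ T : ℝ, ∃ s, T ≤ s ∧ ∃ γ ∈ Γ, dist (γ • axisPt s) UpperHalfPlane.I ≤ R := by
  by_contra! hdiv
  have hfix' : ∀ M ∈ unimodularGroup Γ, M ∉ Subgroup.center (GL (Fin 2) ℝ) → M 1 0 ≠ 0 := by
    intro M hM hc h0
    obtain ⟨γ, hγ, -, ha, hcen⟩ := exists_smul_eq_of_mem_unimodularGroup hM
    refine hc (hcen.1 (hfix γ hγ ?_))
    rw [ha, OnePoint.smul_infty_eq_self_iff]; exact h0
  -- small elements exist at every height, and remain small over a unit length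
  obtain ⟨ε, hε, hcosh⟩ : ∃ ε > 0, 2 * Real.cosh (2 * ε) ≤ 2 + 1 / 8000 := by
    have h : Filter.Tendsto (fun ε : ℝ => 2 * Real.cosh (2 * ε)) (𝓝[>] 0) (𝓝 2) := by
      have : Continuous fun ε : ℝ => 2 * Real.cosh (2 * ε) := by fun_prop
      have h2 := (this.tendsto 0).mono_left (nhdsWithin_le_nhds (s := Set.Ioi (0 : ℝ)))
      simpa using h2
    obtain ⟨ε, h1, h2⟩ := ((h.eventually_le_const (by norm_num : (2:ℝ) < 2 + 1 / 8000)).and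
      self_mem_nhdsWithin).exists
    exact ⟨ε, h2, h1⟩
  obtain ⟨T, hT⟩ := hΓ.exists_dist_lt hdiv hε
  have hsmall : ∀ s, T ≤ s → ∃ M ∈ smallElements Γ s, M ∈ smallElements Γ (s + 1) := by
    intro s hs
    obtain ⟨γ, hγ, hc, hd⟩ := hT s hs
    have hdet : 0 < (γ * γ).val.det := by
      rw [Units.val_mul, Matrix.det_mul]
      exact mul_self_pos.2 γ.det_ne_zero
    obtain ⟨M, hM, hz, hcen⟩ := exists_mem_unimodularGroup (Γ.mul_mem hγ hγ) hdet
    have hMc : M ∉ Subgroup.center (GL (Fin 2) ℝ) := by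
      rw [hcen]; exact hΓ.sq_notMem_center hγ hc
    have hdist : dist (M • axisPt s) (axisPt s) ≤ 2 * ε := by
      rw [hz, mul_smul]
      have h1 := dist_triangle (γ • γ • axisPt s) (γ • axisPt s) (axisPt s)
      rw [dist_smul_smul] at h1
      linarith
    have h2 : displacement s M ≤ 1 / 8000 := by
      have h3 := two_mul_cosh_dist hM.1 s
      have h4 : Real.cosh (dist (M • axisPt s) (axisPt s)) ≤ Real.cosh (2 * ε) := by
        rw [Real.cosh_le_cosh, abs_of_nonneg dist_nonneg, abs_of_pos (by linarith)]
        exact hdist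
      linarith
    have h3 := displacement_add_one_le s hM.1 (hΓ.four_le_trace_sq hM)
    exact ⟨M, ⟨hM, hMc, by linarith⟩, ⟨hM, hMc, by linarith⟩⟩
  -- all small elements over the whole ray have proportional traceless parts
  let r : GL (Fin 2) ℝ → ℝ × ℝ := fun M => (M 0 1 / M 1 0, (M 0 0 - M 1 1) / M 1 0)
  have hr : ∀ s, ∀ M ∈ smallElements Γ s, ∀ M' ∈ smallElements Γ s, r M = r M' := by
    intro s M hM M' hM'
    obtain ⟨N, hN, hcomm⟩ := hΓ.exists_commute ⟨M, hM⟩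
    have key : ∀ M ∈ smallElements Γ s, r M = r N := by
      intro M hM
      obtain ⟨h1, h2⟩ := entries_of_commute (hcomm M hM)
      have h3 := hfix' M hM.1 hM.2.1
      have h4 := hfix' N hN.1 hN.2.1
      refine Prod.ext ?_ ?_
      · change M 0 1 / M 1 0 = N 0 1 / N 1 0
        rw [div_eq_div_iff h3 h4, h1]
      · change (M 0 0 - M 1 1) / M 1 0 = (N 0 0 - N 1 1) / N 1 0
        rw [div_eq_div_iff h3 h4, h2]
    rw [key M hM, key M' hM']
  choose! M hM hM' using hsmall
  have hTn : ∀ n : ℕ, T ≤ T + n := fun n => by simp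
  have hrn : ∀ n : ℕ, r (M (T + n)) = r (M T) := by
    intro n
    induction n with
    | zero => simp
    | succ n ih =>
      rw [← ih]
      have h1 := hM' (T + n) (hTn n)
      have h2 := hM (T + (n + 1 : ℕ)) (hTn _)
      have e : T + ((n + 1 : ℕ) : ℝ) = T + n + 1 := by push_cast; ring
      rw [e] at h2 ⊢
      exact hr _ _ h2 _ h1
  -- the entries in the lower left corner tend to zero
  have hc : ∀ n : ℕ, |M (T + n) 1 0| ≤ Real.exp (-(T + n)) := by
    intro n
    have h1 := hM (T + n) (hTn n)
    have h2 := hΓ.four_le_trace_sq h1.1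
    have h3 := h1.1.1
    have h4 := h1.2.2
    rw [Matrix.det_fin_two] at h3
    unfold displacement at h4
    have h5 : Real.exp (-(T + n)) * Real.exp (T + n) = 1 := by rw [← Real.exp_add]; simp
    have h6 : (M (T + n) 0 1 * Real.exp (-(T + n)) - M (T + n) 1 0 * Real.exp (T + n)) ^ 2 ≤
        1 / 200 := by
      have : M (T + n) 0 1 * M (T + n) 1 0 =
          (M (T + n) 0 1 * Real.exp (-(T + n))) * (M (T + n) 1 0 * Real.exp (T + n)) := by
        calc _ = M (T + n) 0 1 * M (T + n) 1 0 * (Real.exp (-(T + n)) * Real.exp (T + n)) := by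
              rw [h5, mul_one]
          _ = _ := by ring
      nlinarith
    have h7 : (M (T + n) 1 0 * Real.exp (T + n)) ^ 2 ≤ 1 := by
      nlinarith [sq_nonneg (M (T + n) 0 1 * Real.exp (-(T + n)) + M (T + n) 1 0 * Real.exp (T + n)),
        sq_nonneg (M (T + n) 0 1 * Real.exp (-(T + n))), sq_nonneg (M (T + n) 0 0 - M (T + n) 1 1)]
    have h8 : |M (T + n) 1 0| * Real.exp (T + n) ≤ 1 := by
      rw [← abs_of_pos (Real.exp_pos (T + n)), ← abs_mul]
      exact (sq_le_one_iff_abs_le_one _).1 h7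
    rw [Real.exp_neg, ← one_div, le_div_iff₀ (Real.exp_pos _)]
    exact h8
  have hc0 : Filter.Tendsto (fun n : ℕ => M (T + n) 1 0) Filter.atTop (𝓝 0) := by
    refine squeeze_zero_norm hc ?_
    refine Real.tendsto_exp_neg_atTop_nhds_zero.comp ?_
    exact Filter.tendsto_atTop_add_const_left _ _ tendsto_natCast_atTop_atTop
  have hne : ∀ n : ℕ, M (T + n) 1 0 ≠ 0 := fun n =>
    hfix' _ (hM _ (hTn n)).1 (hM _ (hTn n)).2.1
  -- so all matrices lie in a finite set
  have hdisp : ∃ R, ∀ n : ℕ, dist (M (T + n) • axisPt 0) (axisPt 0) ≤ R := by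
    have h1 : Filter.Tendsto (fun n : ℕ => ((r (M T)).2 * M (T + n) 1 0) ^ 2 +
        ((r (M T)).1 * M (T + n) 1 0 + M (T + n) 1 0) ^ 2) Filter.atTop (𝓝 0) := by
      have : Filter.Tendsto (fun n : ℕ => ((r (M T)).2 * M (T + n) 1 0) ^ 2 +
        ((r (M T)).1 * M (T + n) 1 0 + M (T + n) 1 0) ^ 2) Filter.atTop
        (𝓝 (((r (M T)).2 * 0) ^ 2 + ((r (M T)).1 * 0 + 0) ^ 2)) :=
        ((hc0.const_mul _).pow 2).add (((hc0.const_mul _).add hc0).pow 2)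
      simpa using this
    obtain ⟨B, hB⟩ := h1.bddAbove_range
    refine ⟨1 + B, fun n => ?_⟩
    have h2 := hB ⟨n, rfl⟩
    have h3 := two_mul_cosh_dist (hM _ (hTn n)).1.1 0
    have h4 : displacement 0 (M (T + n)) = ((r (M T)).2 * M (T + n) 1 0) ^ 2 +
        ((r (M T)).1 * M (T + n) 1 0 + M (T + n) 1 0) ^ 2 := by
      rw [← hrn n]
      simp only [r, displacement, neg_zero, Real.exp_zero, mul_one, div_mul_cancel₀ _ (hne n)]
    have h5 : dist (M (T + n) • axisPt 0) (axisPt 0) ≤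
        Real.cosh (dist (M (T + n) • axisPt 0) (axisPt 0)) := by
      have h6 := Real.add_one_le_exp (dist (M (T + n) • axisPt 0) (axisPt 0))
      rw [Real.cosh_eq]
      nlinarith [Real.exp_pos (dist (M (T + n) • axisPt 0) (axisPt 0)),
        Real.quadratic_le_exp_of_nonneg (dist_nonneg (x := M (T + n) • axisPt 0) (y := axisPt 0)),
        Real.exp_pos (-dist (M (T + n) • axisPt 0) (axisPt 0)), sq_nonneg (dist (M (T + n) • axisPt 0) (axisPt 0) - 1)]
    simp only at h2
    nlinarith
  obtain ⟨R, hR⟩ := hdisp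
  have hfin : (Set.range fun n : ℕ => M (T + n) 1 0).Finite := by
    refine ((hΓ.finite_unimodular (axisPt 0) R).image fun N => N 1 0).subset ?_
    rintro _ ⟨n, rfl⟩
    exact ⟨_, ⟨(hM _ (hTn n)).1, hR n⟩, rfl⟩
  have hmem : (0 : ℝ) ∈ Set.range fun n : ℕ => M (T + n) 1 0 :=
    hfin.isClosed.mem_of_tendsto hc0 (Filter.Eventually.of_forall fun n => ⟨n, rfl⟩)
  obtain ⟨n, hn⟩ := hmem
  exact hne n hn

/-! ### Invariant measures on the space of geodesics -/

/-- A geodesic whose image in the surface `ℍ / Γ` does not cross itself. -/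
def IsSimple (Γ : Subgroup (GL (Fin 2) ℝ)) (m : Geodesic) : Prop :=
  ∀ γ ∈ Γ, ¬ Crosses m (γ • m)

/-- The properties of the measures in `ML(S)` that are used below: they are locally finite,
invariant, and almost every geodesic is simple in the surface. -/
structure IsInvariantMeasure (Γ : Subgroup (GL (Fin 2) ℝ)) (ν : Measure Geodesic) : Prop where
  finite : ∀ K : Set Geodesic, IsCompact K → ν K < ⊤
  invariant : ∀ γ ∈ Γ, ∀ A : Set Geodesic, MeasurableSet A → ν ((fun g => γ • g) ⁻¹' A) = ν A
  simple : ∀ᵐ m ∂ν, IsSimple Γ m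

lemma measurable_smul_geodesic (γ : GL (Fin 2) ℝ) : Measurable fun m : Geodesic => γ • m :=
  (continuous_const_smul γ).measurable

lemma MeasuredLamination.isInvariantMeasure (μ : MeasuredLamination Γ) :
    IsInvariantMeasure Γ μ.toMeasure where
  finite := μ.finite_of_isCompact
  invariant := μ.invariant
  simple := by
    have h : ∀ᵐ m ∂μ.toMeasure, m ∈ μ.toMeasure.support := Measure.support_mem_ae
    filter_upwards [h] with m hm γ hγ
    exact μ.isLamination_support.not_crosses m hm _ (μ.isLamination_support.invariant γ hγ m hm)

lemma isSimple_smul_iff (g : GL (Fin 2) ℝ) {m : Geodesic} :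
    IsSimple (conjGroup g Γ) (g • m) ↔ IsSimple Γ m := by
  constructor
  · intro h γ hγ hc
    refine h _ (conj_mem_conjGroup hγ) ?_
    have : (g * γ * g⁻¹) • g • m = g • γ • m := by simp [mul_smul]
    rwa [this, crosses_smul]
  · intro h γ hγ hc
    refine h _ (mem_conjGroup.1 hγ) ?_
    rw [← crosses_smul g]
    have : g • (g⁻¹ * γ * g) • m = γ • g • m := by simp [mul_smul]
    rwa [this]

lemma IsInvariantMeasure.map {ν : Measure Geodesic} (h : IsInvariantMeasure Γ ν)
    (g : GL (Fin 2) ℝ) : IsInvariantMeasure (conjGroup g Γ) (ν.map fun m => g • m) where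
  finite K hK := by
    rw [Measure.map_apply (measurable_smul_geodesic g) hK.measurableSet]
    refine h.finite _ ?_
    have : (fun m : Geodesic => g • m) ⁻¹' K = (fun m => g⁻¹ • m) '' K := by
      ext m
      rw [Set.mem_preimage, Set.mem_image]
      exact ⟨fun hm => ⟨_, hm, inv_smul_smul _ _⟩, by rintro ⟨x, hx, rfl⟩; simpa using hx⟩
    rw [this]
    exact hK.image (continuous_const_smul g⁻¹)
  invariant γ hγ A hA := by
    have hm := measurable_smul_geodesic
    rw [Measure.map_apply (hm g) hA, Measure.map_apply (hm g) (hm γ hA)]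
    rw [← h.invariant _ (mem_conjGroup.1 hγ) _ (hm g hA)]
    congr 1
    ext m
    simp [mul_smul]
  simple := by
    have hm : MeasurableEmbedding fun m : Geodesic => g • m :=
      (Homeomorph.smul g).measurableEmbedding
    rw [hm.ae_map_iff]
    filter_upwards [h.simple] with m hm
    exact (isSimple_smul_iff g).2 hm

/-- A set with infinitely many translates in a compact set, no point of which lies in more than
`k` of them, is a null set. -/
lemma IsInvariantMeasure.measure_eq_zero_of_wandering {ν : Measure Geodesic}
    (h : IsInvariantMeasure Γ ν) {W K : Set Geodesic} (hW : MeasurableSet W) (hK : IsCompact K)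
    (γ : ℕ → GL (Fin 2) ℝ) (hγ : ∀ n, γ n ∈ Γ) (hsub : ∀ n, ∀ m, γ n • m ∈ W → m ∈ K) (k : ℕ)
    (hmult : ∀ m, ∀ s : Finset ℕ, (∀ n ∈ s, γ n • m ∈ W) → s.card ≤ k) : ν W = 0 := by
  classical
  have hmeas : ∀ n, MeasurableSet ((fun m => γ n • m) ⁻¹' W) :=
    fun n => measurable_smul_geodesic (γ n) hW
  have hbound : ∀ N : ℕ, N * ν W ≤ k * ν K := by
    intro N
    calc N * ν W = ∑ n ∈ Finset.range N, ν ((fun m => γ n • m) ⁻¹' W) := by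
          simp [h.invariant _ (hγ _) _ hW]
      _ = ∑ n ∈ Finset.range N, ∫⁻ m, ((fun m => γ n • m) ⁻¹' W).indicator 1 m ∂ν := by
          refine Finset.sum_congr rfl fun n _ => ?_
          rw [lintegral_indicator_one (hmeas n)]
      _ = ∫⁻ m, ∑ n ∈ Finset.range N, ((fun m => γ n • m) ⁻¹' W).indicator 1 m ∂ν :=
          (lintegral_finsetSum _ fun n _ => measurable_one.indicator (hmeas n)).symm
      _ ≤ ∫⁻ m, K.indicator (fun _ => (k : ℝ≥0∞)) m ∂ν := by
          refine lintegral_mono fun m => ?_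
          have e : ∑ n ∈ Finset.range N, ((fun m => γ n • m) ⁻¹' W).indicator (1 : Geodesic → ℝ≥0∞) m
              = (((Finset.range N).filter fun n => γ n • m ∈ W).card : ℝ≥0∞) := by
            rw [Finset.card_filter]
            push_cast
            refine Finset.sum_congr rfl fun n _ => ?_
            by_cases hn : γ n • m ∈ W <;> simp [hn]
          rw [e]
          by_cases hm : m ∈ K
          · rw [Set.indicator_of_mem hm]
            have := hmult m ((Finset.range N).filter fun n => γ n • m ∈ W)
              fun n hn => (Finset.mem_filter.1 hn).2
            exact Nat.cast_le.2 (by convert this)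
          · rw [Set.indicator_of_notMem hm, Finset.filter_false_of_mem]
            · simp
            · exact fun n _ hn => hm (hsub n m hn)
      _ = k * ν K := by rw [lintegral_indicator_const hK.measurableSet]
  by_contra hne
  obtain ⟨N, hN⟩ := ENNReal.exists_nat_mul_gt hne
    (ENNReal.mul_ne_top (ENNReal.natCast_ne_top k) (h.finite K hK).ne)
  exact absurd (hbound N) (not_le.2 hN)

lemma smul_mem_endingAt_iff (g : GL (Fin 2) ℝ) {e : OnePoint ℝ} {m : Geodesic} :
    g • m ∈ endingAt (g • e) ↔ m ∈ endingAt e := by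
  obtain ⟨a, b, h⟩ := m.exists_hasEnds
  rw [mem_endingAt_iff h, mem_endingAt_iff (h.smul g)]
  simp

lemma chord_infty_coe (q : ℝ) : chord OnePoint.infty (q : OnePoint ℝ) = 1 / (q ^ 2 + 1) := by
  simp [chord, bracket]

/-! ### Fixed points at infinity -/

/-- A geodesic that no nontrivial element of `Γ` leaves invariant. -/
def HasTrivialStabilizer (Γ : Subgroup (GL (Fin 2) ℝ)) (m : Geodesic) : Prop :=
  ∀ γ ∈ Γ, γ • m = m → γ ∈ Subgroup.center (GL (Fin 2) ℝ)

/-- Near a geodesic ending at a cusp, all simple geodesics end at this cusp: the other ones cross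
their images under the translation that fixes the cusp. -/
lemma exists_isOpen_of_translation {β : ℝ} (hβ : β ≠ 0) {γ : GL (Fin 2) ℝ} (hγ : γ ∈ Γ)
    (ht : ∀ t : ℝ, γ • (t : OnePoint ℝ) = ((t + β : ℝ) : OnePoint ℝ)) :
    ∃ V : Set Geodesic, IsOpen V ∧ endingAt OnePoint.infty ⊆ V ∧
      ∀ m ∈ V, IsSimple Γ m → m ∈ endingAt OnePoint.infty := by
  let F : OnePoint ℝ → OnePoint ℝ → ℝ := fun p q => dirEntry 1 1 p * dirEntry 1 1 q
  have hF : ∀ p q, F p q = F q p := fun p q => mul_comm _ _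
  have hc : Continuous (endsFun F hF) := by
    refine continuous_endsFun hF ?_
    have := continuous_dirEntry
    fun_prop
  refine ⟨{m | β ^ 2 * endsFun F hF m < endDist m}, isOpen_lt (by fun_prop) continuous_endDist,
    ?_, ?_⟩
  · rintro m ⟨b, hb⟩
    rw [Set.mem_ofPred_eq, endsFun_eq hF hb]
    have : F OnePoint.infty b = 0 := by simp [F, dirEntry]
    rw [this, mul_zero]
    exact endDist_pos m
  · intro m hm hs
    obtain ⟨p, q, h⟩ := m.exists_hasEnds
    rw [mem_endingAt_iff h]
    rcases eq_infty_or_coe p with rfl | ⟨p, rfl⟩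
    · exact Or.inl rfl
    rcases eq_infty_or_coe q with rfl | ⟨q, rfl⟩
    · exact Or.inr rfl
    exfalso
    rw [Set.mem_ofPred_eq, endsFun_eq hF h, endDist_eq h] at hm
    simp only [F, dirEntry, chord, bracket, homCoord_coe_zero, homCoord_coe_one] at hm
    have hp : 0 < p ^ 2 + 1 ^ 2 := by positivity
    have hq : 0 < q ^ 2 + 1 ^ 2 := by positivity
    have hm' : β ^ 2 < (p - q) ^ 2 := by
      have h1 := mul_lt_mul_of_pos_right hm (mul_pos hp hq)
      field_simp at h1
      linarith
    apply hs γ hγ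
    have h2 := h.smul γ
    rw [ht, ht] at h2
    rw [crosses_iff h h2, separates_coe]
    have hβ2 : 0 < β ^ 2 := by positivity
    nlinarith

/-- The other end of a geodesic ending at `∞`, as a bound on a compact set. -/
lemma isCompact_ending_infty (w C : ℝ) :
    IsCompact {m : Geodesic | ∃ q : ℝ, m.HasEnds OnePoint.infty q ∧ |q - w| ≤ C} := by
  have : {m : Geodesic | ∃ q : ℝ, m.HasEnds OnePoint.infty q ∧ |q - w| ≤ C} =
      joining {OnePoint.infty} ((fun t : ℝ => (t : OnePoint ℝ)) '' Metric.closedBall w C) := by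
    ext m
    constructor
    · rintro ⟨q, h, hq⟩
      exact ⟨_, rfl, _, ⟨q, by rwa [Metric.mem_closedBall, Real.dist_eq], rfl⟩, h⟩
    · rintro ⟨_, rfl, _, ⟨q, hq, rfl⟩, h⟩
      exact ⟨q, h, by rwa [Metric.mem_closedBall, Real.dist_eq] at hq⟩
  rw [this]
  refine isCompact_joining isCompact_singleton
    ((isCompact_closedBall w C).image OnePoint.continuous_coe) ?_
  rw [Set.disjoint_left]
  rintro _ rfl ⟨q, -, hq⟩
  exact OnePoint.coe_ne_infty q hq

/-- The geodesics ending at a fixed point of a hyperbolic element, except the axis of this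
element, form a null set: under iteration they accumulate on the axis. -/
lemma IsInvariantMeasure.measure_endingAt_of_dilation {ν : Measure Geodesic}
    (h : IsInvariantMeasure Γ ν) {w k : ℝ} (hk : 1 < k) {γ : GL (Fin 2) ℝ} (hγ : γ ∈ Γ)
    (hinf : γ • (OnePoint.infty : OnePoint ℝ) = OnePoint.infty)
    (ht : ∀ t : ℝ, ∃ t' : ℝ, γ • (t : OnePoint ℝ) = (t' : OnePoint ℝ) ∧
      |t' - w| = k * |t - w|) :
    ν {m | ∃ q : ℝ, m.HasEnds OnePoint.infty q ∧ q ≠ w} = 0 := by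
  have hk0 : 0 < k := by linarith
  have hiter : ∀ n : ℕ, ∀ t : ℝ, ∃ t' : ℝ, γ ^ n • (t : OnePoint ℝ) = (t' : OnePoint ℝ) ∧
      |t' - w| = k ^ n * |t - w| := by
    intro n
    induction n with
    | zero => intro t; exact ⟨t, by simp, by simp⟩
    | succ n ih =>
      intro t
      obtain ⟨t', h1, h2⟩ := ih t
      obtain ⟨t'', h3, h4⟩ := ht t'
      exact ⟨t'', by rw [pow_succ', mul_smul, h1, h3], by rw [h4, h2]; ring⟩
  have hinfn : ∀ n : ℕ, γ ^ n • (OnePoint.infty : OnePoint ℝ) = OnePoint.infty := by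
    intro n
    induction n with
    | zero => simp
    | succ n ih => rw [pow_succ', mul_smul, ih, hinf]
  have hpull : ∀ n : ℕ, ∀ m : Geodesic, ∀ q' : ℝ, (γ ^ n • m).HasEnds OnePoint.infty q' →
      ∃ q : ℝ, m.HasEnds OnePoint.infty q ∧ |q' - w| = k ^ n * |q - w| := by
    intro n m q' hm
    have h1 : m ∈ endingAt OnePoint.infty := by
      rw [← smul_mem_endingAt_iff (γ ^ n), hinfn]; exact ⟨_, hm⟩
    obtain ⟨b, hb⟩ := h1
    rcases eq_infty_or_coe b with rfl | ⟨q, rfl⟩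
    · exact absurd rfl hb.ne
    obtain ⟨q'', h2, h3⟩ := hiter n q
    have h4 := hb.smul (γ ^ n)
    rw [hinfn, h2] at h4
    have h5 := OnePoint.coe_injective (hm.snd_eq h4)
    exact ⟨q, hb, by rw [h5, h3]⟩
  have hclosed : ∀ C : ℝ, MeasurableSet
      {m : Geodesic | ∃ q : ℝ, m.HasEnds OnePoint.infty q ∧ |q - w| ≤ C} :=
    fun C => (isCompact_ending_infty w C).measurableSet
  -- a fundamental annulus is wandering
  have hW : ∀ r : ℝ, 0 < r →
      ν ({m : Geodesic | ∃ q : ℝ, m.HasEnds OnePoint.infty q ∧ |q - w| ≤ k * r} \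
        {m : Geodesic | ∃ q : ℝ, m.HasEnds OnePoint.infty q ∧ |q - w| ≤ r}) = 0 := by
    intro r hr
    have hmem : ∀ n m, γ ^ n • m ∈
        ({m : Geodesic | ∃ q : ℝ, m.HasEnds OnePoint.infty q ∧ |q - w| ≤ k * r} \
        {m : Geodesic | ∃ q : ℝ, m.HasEnds OnePoint.infty q ∧ |q - w| ≤ r}) →
        ∃ q : ℝ, m.HasEnds OnePoint.infty q ∧ r < k ^ n * |q - w| ∧
          k ^ n * |q - w| ≤ k * r := by
      rintro n m ⟨⟨q', hq', hle⟩, hnot⟩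
      obtain ⟨q, hq, he⟩ := hpull n m q' hq'
      refine ⟨q, hq, ?_, by rwa [← he]⟩
      rw [← he]
      by_contra! hcon
      exact hnot ⟨q', hq', hcon⟩
    refine h.measure_eq_zero_of_wandering ((hclosed _).diff (hclosed _))
      (isCompact_ending_infty w (k * r)) (fun n => γ ^ n) (fun n => Γ.pow_mem hγ n) ?_ 1 ?_
    · intro n m hm
      obtain ⟨q, hq, -, hle⟩ := hmem n m hm
      refine ⟨q, hq, le_trans ?_ hle⟩
      exact le_mul_of_one_le_left (abs_nonneg _) (one_le_pow₀ hk.le)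
    · intro m s hs
      rw [Finset.card_le_one]
      have key : ∀ i ∈ s, ∀ j ∈ s, ¬ i < j := by
        intro i hi j hj hij
        obtain ⟨q, hq, h1, -⟩ := hmem i m (hs i hi)
        obtain ⟨q', hq', -, h2⟩ := hmem j m (hs j hj)
        obtain rfl := OnePoint.coe_injective (hq.snd_eq hq')
        have h3 : k ^ (i + 1) ≤ k ^ j := pow_le_pow_right₀ hk.le hij
        have h4 : k ^ (i + 1) * |q - w| ≤ k * r :=
          (mul_le_mul_of_nonneg_right h3 (abs_nonneg _)).trans h2
        rw [pow_succ] at h4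
        nlinarith
      intro i hi j hj
      exact le_antisymm (not_lt.1 (key j hj i hi)) (not_lt.1 (key i hi j hj))
  -- all other geodesics lie in one of countably many annuli
  have hcov : {m : Geodesic | ∃ q : ℝ, m.HasEnds OnePoint.infty q ∧ q ≠ w} ⊆
      ⋃ n : ℤ, ({m : Geodesic | ∃ q : ℝ, m.HasEnds OnePoint.infty q ∧ |q - w| ≤ k * k ^ n} \
        {m : Geodesic | ∃ q : ℝ, m.HasEnds OnePoint.infty q ∧ |q - w| ≤ k ^ n}) := by
    rintro m ⟨q, hq, hqw⟩
    have hpos : 0 < |q - w| := abs_pos.2 (sub_ne_zero.2 hqw)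
    obtain ⟨n, h1, h2⟩ := exists_mem_Ioc_zpow hpos hk
    refine Set.mem_iUnion.2 ⟨n, ⟨q, hq, ?_⟩, ?_⟩
    · rwa [zpow_add_one₀ hk0.ne', mul_comm] at h2
    · rintro ⟨q', hq', hle⟩
      obtain rfl := OnePoint.coe_injective (hq.snd_eq hq')
      linarith
  exact measure_mono_null hcov (measure_iUnion_null fun n => hW _ (zpow_pos hk0 n))

/-! ### Points at infinity that are not fixed points -/

lemma two_mul_cosh_dist_I (γ : GL (Fin 2) ℝ) (s : ℝ) :
    2 * |γ 0 0 * γ 1 1 - γ 0 1 * γ 1 0| * Real.cosh (dist (γ • axisPt s) UpperHalfPlane.I) =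
      (γ 0 0 ^ 2 + γ 1 0 ^ 2) * Real.exp s + (γ 0 1 ^ 2 + γ 1 1 ^ 2) * Real.exp (-s) := by
  have hd := UpperHalfPlane.denom_ne_zero γ (axisPt s)
  have hes := Real.exp_pos s
  have e0 : ((axisPt s : ℍ) : ℂ) = ⟨0, Real.exp s⟩ := rfl
  have hdet : γ.det.val = γ 0 0 * γ 1 1 - γ 0 1 * γ 1 0 := by
    rw [Matrix.GeneralLinearGroup.val_det_apply, Matrix.det_fin_two]
  have hD := entries_det_ne_zero γ
  have hn : Complex.normSq (UpperHalfPlane.denom γ (axisPt s)) ≠ 0 := by simp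
  -- the orientation reversing case differs by a complex conjugation
  obtain ⟨ε, hε, hσ⟩ : ∃ ε : ℝ, |γ 0 0 * γ 1 1 - γ 0 1 * γ 1 0| =
      ε * (γ 0 0 * γ 1 1 - γ 0 1 * γ 1 0) ∧ ε ^ 2 = 1 ∧
      ‖((γ • axisPt s : ℍ) : ℂ) - Complex.I‖ = ‖UpperHalfPlane.num γ (axisPt s) /
        UpperHalfPlane.denom γ (axisPt s) - ε * Complex.I‖ := by
    rcases hD.lt_or_gt with h | h
    · have h' : ¬ (0 < γ.det.val) := by rw [hdet]; exact not_lt.2 h.le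
      refine ⟨-1, by rw [abs_of_neg h]; ring, by norm_num, ?_⟩
      rw [UpperHalfPlane.coe_smul, ← UpperHalfPlane.norm_σ γ, map_sub, UpperHalfPlane.σ_sq]
      simp [UpperHalfPlane.σ, show ¬ (0 < γ.val.det) from h']
    · have h' : 0 < γ.det.val := by rw [hdet]; exact h
      refine ⟨1, by rw [abs_of_pos h]; ring, by norm_num, ?_⟩
      rw [UpperHalfPlane.coe_smul, ← UpperHalfPlane.norm_σ γ, map_sub, UpperHalfPlane.σ_sq]
      simp [UpperHalfPlane.σ, show 0 < γ.val.det from h']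
  obtain ⟨hε2, hσ⟩ := hσ
  rw [UpperHalfPlane.cosh_dist, UpperHalfPlane.im_smul_eq_div_normSq, dist_eq_norm,
    UpperHalfPlane.coe_I, hσ, div_sub' hd, norm_div, div_pow,
    ← Complex.normSq_eq_norm_sq, ← Complex.normSq_eq_norm_sq, hdet, axisPt_im, UpperHalfPlane.I_im]
  have e1 : Complex.normSq (UpperHalfPlane.num γ (axisPt s) -
      UpperHalfPlane.denom γ (axisPt s) * (ε * Complex.I)) =
      (γ 0 0 ^ 2 + γ 1 0 ^ 2) * Real.exp s ^ 2 + (γ 0 1 ^ 2 + γ 1 1 ^ 2)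
        - 2 * |γ 0 0 * γ 1 1 - γ 0 1 * γ 1 0| * Real.exp s := by
    rw [e0, hε]
    simp only [UpperHalfPlane.num, UpperHalfPlane.denom, Complex.normSq_apply, Complex.add_re,
      Complex.mul_re, Complex.ofReal_re, Complex.ofReal_im, Complex.add_im, Complex.mul_im,
      Complex.sub_re, Complex.sub_im, Complex.I_re, Complex.I_im]
    linear_combination (γ 1 0 ^ 2 * Real.exp s ^ 2 + γ 1 1 ^ 2) * hε2
  rw [e1, Real.exp_neg]
  have hD' : |γ 0 0 * γ 1 1 - γ 0 1 * γ 1 0| ≠ 0 := abs_ne_zero.2 hD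
  field_simp
  ring

/-- If `∞` is not a fixed point, then the geodesics ending at `∞` form a null set: infinitely many
elements of the group move their ends near `∞` to a compact part of the hyperbolic plane. -/
lemma IsInvariantMeasure.measure_endingAt_of_recurrent {ν : Measure Geodesic}
    (h : IsInvariantMeasure Γ ν) (hΓ : IsFiniteAreaSurfaceGroup Γ)
    (hfix : ∀ γ ∈ Γ, γ • (OnePoint.infty : OnePoint ℝ) = OnePoint.infty →
      γ ∈ Subgroup.center (GL (Fin 2) ℝ)) :
    ν (endingAt OnePoint.infty) = 0 := by
  obtain ⟨R, hR⟩ := hΓ.recurrent hfix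
  obtain ⟨f, hf, hfne⟩ := exists_seq_of_forall_finset_exists
    (fun x : ℝ × GL (Fin 2) ℝ => 0 ≤ x.1 ∧ x.2 ∈ Γ ∧ dist (x.2 • axisPt x.1) UpperHalfPlane.I ≤ R)
    (fun x y => x.2 • (OnePoint.infty : OnePoint ℝ) ≠ y.2 • OnePoint.infty) (by
      intro S hS
      obtain ⟨B, hB⟩ := (S.image fun x => dist UpperHalfPlane.I (x.2⁻¹ • UpperHalfPlane.I)).exists_le
      obtain ⟨s, hs, γ, hγ, hd⟩ := hR (max 0 (B + R + 1))
      refine ⟨(s, γ), ⟨(le_max_left _ _).trans hs, hγ, hd⟩, fun x hx hxy => ?_⟩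
      obtain ⟨h1, h2, h3⟩ := hS x hx
      have hcen : x.2⁻¹ * γ ∈ Subgroup.center (GL (Fin 2) ℝ) :=
        hfix _ (Γ.mul_mem (Γ.inv_mem h2) hγ) (by rw [mul_smul, ← hxy, inv_smul_smul])
      have h4 := smul_upperHalfPlane_of_mem_center hcen (axisPt s)
      rw [mul_smul, inv_smul_eq_iff] at h4
      rw [h4, ← dist_smul_smul x.2⁻¹, inv_smul_smul] at hd
      have h5 := hB _ (Finset.mem_image_of_mem _ hx)
      have h6 := dist_triangle_right (axisPt s) UpperHalfPlane.I (x.2⁻¹ • UpperHalfPlane.I)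
      have h7 := UpperHalfPlane.dist_log_im_le (axisPt s) UpperHalfPlane.I
      simp only [axisPt_im, Real.log_exp, UpperHalfPlane.I_im, Real.log_one, Real.dist_eq,
        sub_zero] at h7
      have h8 := le_abs_self s
      have h9 := (le_max_right _ _).trans hs
      linarith)
  have hinj : ∀ m n, (f m).2 • (OnePoint.infty : OnePoint ℝ) = (f n).2 • OnePoint.infty → m = n := by
    intro m n hmn
    by_contra hne
    rcases lt_or_gt_of_ne hne with h1 | h1
    · exact hfne _ _ h1 hmn
    · exact hfne _ _ h1 hmn.symm
  have hnull : ∀ C : ℕ, ν {m : Geodesic | ∃ q : ℝ, m.HasEnds OnePoint.infty q ∧ |q - 0| ≤ C} = 0 := by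
    intro C
    have hε : 0 < 1 / (4 * Real.cosh R ^ 2 * (2 * (C : ℝ) ^ 2 + 2)) := by
      have := Real.cosh_pos R
      positivity
    refine h.measure_eq_zero_of_wandering (isCompact_ending_infty 0 C).measurableSet
      (isCompact_le_endDist hε) (fun n => (f n).2⁻¹) (fun n => Γ.inv_mem (hf n).2.1) ?_ 2 ?_
    · rintro n m ⟨q, hq, hqC⟩
      obtain ⟨hs, hγ, hd⟩ := hf n
      generalize (f n).1 = s at *
      generalize (f n).2 = γ at *
      have hm := hq.smul γ
      rw [smul_inv_smul] at hm
      rw [Set.mem_ofPred_eq, endDist_eq hm]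
      rw [sub_zero] at hqC
      have hid := two_mul_cosh_dist_I γ s
      have hcosh : Real.cosh (dist (γ • axisPt s) UpperHalfPlane.I) ≤ Real.cosh R := by
        rw [Real.cosh_le_cosh, abs_of_nonneg dist_nonneg]
        exact hd.trans (le_abs_self R)
      have hD := entries_det_ne_zero γ
      have hse : (γ 0 0 ^ 2 + γ 1 0 ^ 2) * ((γ 0 0 * q + γ 0 1) ^ 2 + (γ 1 0 * q + γ 1 1) ^ 2) ≤
          (γ 0 0 * γ 1 1 - γ 0 1 * γ 1 0) ^ 2 * (4 * Real.cosh R ^ 2 * (2 * (C : ℝ) ^ 2 + 2)) := by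
        set x := (γ 0 0 ^ 2 + γ 1 0 ^ 2) * Real.exp s with hx
        set y := (γ 0 1 ^ 2 + γ 1 1 ^ 2) * Real.exp (-s) with hy
        set X := 2 * |γ 0 0 * γ 1 1 - γ 0 1 * γ 1 0| * Real.cosh R with hX
        have hx0 : 0 ≤ x := by positivity
        have hy0 : 0 ≤ y := by positivity
        have hxy : x + y ≤ X := hid.symm.trans_le
          (mul_le_mul_of_nonneg_left hcosh (by positivity))
        have h1 : γ 0 0 ^ 2 + γ 1 0 ^ 2 ≤ x :=
          le_mul_of_one_le_right (by positivity) (Real.one_le_exp hs)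
        have h2 : (γ 0 0 ^ 2 + γ 1 0 ^ 2) * (γ 0 1 ^ 2 + γ 1 1 ^ 2) = x * y := by
          have : Real.exp s * Real.exp (-s) = 1 := by rw [← Real.exp_add]; simp
          rw [hx, hy]
          linear_combination -(γ 0 0 ^ 2 + γ 1 0 ^ 2) * (γ 0 1 ^ 2 + γ 1 1 ^ 2) * this
        have h3 : (γ 0 0 * q + γ 0 1) ^ 2 + (γ 1 0 * q + γ 1 1) ^ 2 ≤
            2 * ((γ 0 0 ^ 2 + γ 1 0 ^ 2) * q ^ 2 + (γ 0 1 ^ 2 + γ 1 1 ^ 2)) := by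
          nlinarith [sq_nonneg (γ 0 0 * q - γ 0 1), sq_nonneg (γ 1 0 * q - γ 1 1)]
        have hX2 : X ^ 2 = (γ 0 0 * γ 1 1 - γ 0 1 * γ 1 0) ^ 2 * (4 * Real.cosh R ^ 2) := by
          rw [hX, mul_pow, mul_pow, sq_abs]; ring
        have hq2 : q ^ 2 ≤ (C : ℝ) ^ 2 := by
          rw [← sq_abs q]; gcongr
        calc _ ≤ (γ 0 0 ^ 2 + γ 1 0 ^ 2) *
              (2 * ((γ 0 0 ^ 2 + γ 1 0 ^ 2) * q ^ 2 + (γ 0 1 ^ 2 + γ 1 1 ^ 2))) := by gcongr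
          _ = 2 * (γ 0 0 ^ 2 + γ 1 0 ^ 2) ^ 2 * q ^ 2 + 2 * (x * y) := by rw [← h2]; ring
          _ ≤ 2 * X ^ 2 * (C : ℝ) ^ 2 + 2 * (X * X) := by
              gcongr <;> linarith
          _ = _ := by linear_combination (2 * (C : ℝ) ^ 2 + 2) * hX2
      rw [← smul_inv_smul γ m] at hm
      rw [chord_smul, chord_infty_coe]
      have e1 : stretch γ OnePoint.infty = γ 0 0 ^ 2 + γ 1 0 ^ 2 := by simp [stretch, dirEntry]
      have e2 : stretch γ (q : OnePoint ℝ) * (q ^ 2 + 1) =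
          (γ 0 0 * q + γ 0 1) ^ 2 + (γ 1 0 * q + γ 1 1) ^ 2 := by
        have : q ^ 2 + 1 ≠ 0 := by positivity
        simp only [stretch, dirEntry, homCoord_coe_zero, homCoord_coe_one, one_pow]
        field_simp
        ring
      have p1 := stretch_pos γ OnePoint.infty
      have p2 := stretch_pos γ (q : OnePoint ℝ)
      have p3 : 0 < q ^ 2 + 1 := by positivity
      rw [← e2, ← e1] at hse
      have := Real.cosh_pos R
      rw [mul_one_div, div_div, div_le_div_iff₀ (by positivity) (by positivity), one_mul]
      linarith
    · classical
      intro m s hs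
      obtain ⟨a, b, hab⟩ := m.exists_hasEnds
      have hends : ∀ n ∈ s, (f n).2 • (OnePoint.infty : OnePoint ℝ) ∈
          ({a, b} : Finset (OnePoint ℝ)) := by
        intro n hn
        obtain ⟨q, hq, -⟩ := hs n hn
        have h1 : (f n).2⁻¹ • m ∈ endingAt ((f n).2⁻¹ • (f n).2 • (OnePoint.infty : OnePoint ℝ)) := by
          rw [inv_smul_smul]; exact ⟨_, hq⟩
        rw [smul_mem_endingAt_iff, mem_endingAt_iff hab] at h1
        simpa using h1
      calc s.card ≤ ({a, b} : Finset (OnePoint ℝ)).card :=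
            Finset.card_le_card_of_injOn _ hends fun i _ j _ hij => hinj i j hij
        _ ≤ 2 := Finset.card_le_two
  refine measure_mono_null (t := ⋃ C : ℕ,
    {m : Geodesic | ∃ q : ℝ, m.HasEnds OnePoint.infty q ∧ |q - 0| ≤ C}) ?_
    (measure_iUnion_null hnull)
  rintro m ⟨b, hb⟩
  rcases eq_infty_or_coe b with rfl | ⟨q, rfl⟩
  · exact absurd rfl hb.ne
  obtain ⟨C, hC⟩ := exists_nat_ge |q - 0|
  exact Set.mem_iUnion.2 ⟨C, q, hb, hC⟩

/-! ### Elements fixing the point `∞` -/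

lemma entries_ne_zero_of_fix {γ : GL (Fin 2) ℝ} (h : γ 1 0 = 0) : γ 0 0 ≠ 0 ∧ γ 1 1 ≠ 0 := by
  have := entries_det_ne_zero γ
  rw [h] at this
  constructor <;> rintro h0 <;> simp [h0] at this

lemma smul_coe_of_fix {γ : GL (Fin 2) ℝ} (h : γ 1 0 = 0) (t : ℝ) :
    γ • (t : OnePoint ℝ) = ((γ 0 0 / γ 1 1 * t + γ 0 1 / γ 1 1 : ℝ) : OnePoint ℝ) := by
  have h2 := (entries_ne_zero_of_fix h).2
  rw [OnePoint.smul_some_eq_ite, h]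
  simp [h2]
  field_simp

lemma smul_re_of_fix {γ : GL (Fin 2) ℝ} (h : γ 1 0 = 0) (z : ℍ) :
    (γ • z).re = γ 0 0 / γ 1 1 * z.re + γ 0 1 / γ 1 1 := by
  have h2 := (entries_ne_zero_of_fix h).2
  rw [UpperHalfPlane.re_smul]
  have : UpperHalfPlane.num γ z / UpperHalfPlane.denom γ z =
      ((γ 0 0 / γ 1 1 : ℝ) : ℂ) * z + ((γ 0 1 / γ 1 1 : ℝ) : ℂ) := by
    simp only [UpperHalfPlane.num, UpperHalfPlane.denom, h]
    have : ((γ 1 1 : ℝ) : ℂ) ≠ 0 := by exact_mod_cast h2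
    simp only [Complex.ofReal_zero, zero_mul, zero_add, Complex.ofReal_div]
    field_simp
  rw [this]
  simp

lemma smul_im_of_fix {γ : GL (Fin 2) ℝ} (h : γ 1 0 = 0) (z : ℍ) :
    (γ • z).im = |γ 0 0 / γ 1 1| * z.im := by
  have h2 := (entries_ne_zero_of_fix h).2
  rw [UpperHalfPlane.im_smul]
  have : UpperHalfPlane.num γ z / UpperHalfPlane.denom γ z =
      ((γ 0 0 / γ 1 1 : ℝ) : ℂ) * z + ((γ 0 1 / γ 1 1 : ℝ) : ℂ) := by
    simp only [UpperHalfPlane.num, UpperHalfPlane.denom, h]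
    have : ((γ 1 1 : ℝ) : ℂ) ≠ 0 := by exact_mod_cast h2
    simp only [Complex.ofReal_zero, zero_mul, zero_add, Complex.ofReal_div]
    field_simp
  rw [this]
  simp [-map_div₀, abs_mul, abs_of_pos z.im_pos]

/-- The factor by which an element that fixes `∞` dilates the real line. -/
noncomputable def dilation (γ : GL (Fin 2) ℝ) : ℝ := γ 0 0 / γ 1 1

lemma dilation_ne_zero {γ : GL (Fin 2) ℝ} (h : γ 1 0 = 0) : dilation γ ≠ 0 := by
  obtain ⟨h1, h2⟩ := entries_ne_zero_of_fix h
  exact div_ne_zero h1 h2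

lemma smul_sub_smul_of_fix {γ : GL (Fin 2) ℝ} (h : γ 1 0 = 0) {t t' w w' : ℝ}
    (ht : γ • (t : OnePoint ℝ) = (t' : OnePoint ℝ)) (hw : γ • (w : OnePoint ℝ) = (w' : OnePoint ℝ)) :
    t' - w' = dilation γ * (t - w) := by
  rw [smul_coe_of_fix h] at ht hw
  have e1 := OnePoint.coe_injective ht
  have e2 := OnePoint.coe_injective hw
  unfold dilation
  rw [← e1, ← e2]; ring

lemma fix_inv {γ : GL (Fin 2) ℝ} (h : γ 1 0 = 0) : γ⁻¹ 1 0 = 0 := by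
  rw [← OnePoint.smul_infty_eq_self_iff] at h ⊢
  rw [inv_smul_eq_iff, h]

lemma fix_mul {γ δ : GL (Fin 2) ℝ} (h : γ 1 0 = 0) (h' : δ 1 0 = 0) : (γ * δ) 1 0 = 0 := by
  rw [← OnePoint.smul_infty_eq_self_iff] at *
  rw [mul_smul, h', h]

lemma exists_smul_coe_of_fix {γ : GL (Fin 2) ℝ} (h : γ 1 0 = 0) (t : ℝ) :
    ∃ t' : ℝ, γ • (t : OnePoint ℝ) = (t' : OnePoint ℝ) := ⟨_, smul_coe_of_fix h t⟩

lemma dilation_mul {γ δ : GL (Fin 2) ℝ} (h : γ 1 0 = 0) (h' : δ 1 0 = 0) :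
    dilation (γ * δ) = dilation γ * dilation δ := by
  obtain ⟨a, ha⟩ := exists_smul_coe_of_fix h' 1
  obtain ⟨b, hb⟩ := exists_smul_coe_of_fix h' 0
  obtain ⟨a', ha'⟩ := exists_smul_coe_of_fix h a
  obtain ⟨b', hb'⟩ := exists_smul_coe_of_fix h b
  have h1 := smul_sub_smul_of_fix h' ha hb
  have h2 := smul_sub_smul_of_fix h ha' hb'
  have h3 := smul_sub_smul_of_fix (fix_mul h h') (t := 1) (w := 0) (t' := a') (w' := b')
    (by rw [mul_smul, ha, ha']) (by rw [mul_smul, hb, hb'])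
  rw [h2, h1] at h3
  linarith

lemma dilation_one : dilation 1 = 1 := by simp [dilation]

lemma dilation_inv {γ : GL (Fin 2) ℝ} (h : γ 1 0 = 0) : dilation γ⁻¹ = (dilation γ)⁻¹ := by
  have := dilation_mul h (fix_inv h)
  rw [mul_inv_cancel, dilation_one] at this
  exact eq_inv_of_mul_eq_one_right this.symm

/-- A dilation has a second fixed point. -/
lemma exists_fixed_of_dilation {γ : GL (Fin 2) ℝ} (h : γ 1 0 = 0) (hk : dilation γ ≠ 1) :
    ∃ w : ℝ, γ • (w : OnePoint ℝ) = (w : OnePoint ℝ) := by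
  refine ⟨γ 0 1 / γ 1 1 / (1 - dilation γ), ?_⟩
  rw [smul_coe_of_fix h]
  change (((dilation γ) * _ + _ : ℝ) : OnePoint ℝ) = _
  congr 1
  have : 1 - dilation γ ≠ 0 := sub_ne_zero.2 hk.symm
  field_simp
  ring

lemma abs_dilation_eq_one_iff (hΓ : IsFiniteAreaSurfaceGroup Γ) {γ : GL (Fin 2) ℝ} (hγ : γ ∈ Γ)
    (h : γ 1 0 = 0) : |dilation γ| = 1 ↔ dilation γ = 1 := by
  refine ⟨fun h1 => ?_, fun h1 => by rw [h1, abs_one]⟩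
  obtain ⟨h3, h4⟩ := entries_ne_zero_of_fix h
  rcases eq_or_eq_neg_of_abs_eq h1 with h2 | h2
  · exact h2
  · exfalso
    unfold dilation at h2
    rw [div_eq_iff h4] at h2
    have hc : γ ∉ Subgroup.center (GL (Fin 2) ℝ) := by
      intro hc
      have := (mem_center_iff.1 hc).2.2
      apply h4; linarith
    exact hΓ.trace_ne_zero hγ hc (by rw [h2]; ring)

/-- From a dilation one obtains, by squaring and possibly inverting, one with a factor greater than
one. -/
lemma exists_one_lt_dilation {γ : GL (Fin 2) ℝ} (hγ : γ ∈ Γ) (h : γ 1 0 = 0)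
    (hk : |dilation γ| ≠ 1) : ∃ δ ∈ Γ, δ 1 0 = 0 ∧ 1 < dilation δ ∧
      ∀ a : OnePoint ℝ, γ • a = a → δ • a = a := by
  have h0 := dilation_ne_zero h
  have hsq : dilation (γ * γ) = |dilation γ| ^ 2 := by rw [dilation_mul h h, sq_abs, sq]
  rcases hk.lt_or_gt with h1 | h1
  · refine ⟨(γ * γ)⁻¹, Γ.inv_mem (Γ.mul_mem hγ hγ), fix_inv (fix_mul h h), ?_, fun a ha => ?_⟩
    · rw [dilation_inv (fix_mul h h), hsq, ← inv_pow]
      exact one_lt_pow₀ ((one_lt_inv₀ (abs_pos.2 h0)).2 h1) two_ne_zero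
    · rw [inv_smul_eq_iff, mul_smul, ha, ha]
  · refine ⟨γ * γ, Γ.mul_mem hγ hγ, fix_mul h h, ?_, fun a ha => by rw [mul_smul, ha, ha]⟩
    rw [hsq]
    exact one_lt_pow₀ h1 two_ne_zero

lemma notMem_center_of_dilation_ne_one {γ : GL (Fin 2) ℝ} (hk : dilation γ ≠ 1) :
    γ ∉ Subgroup.center (GL (Fin 2) ℝ) := by
  intro hc
  obtain ⟨h1, h2, h3⟩ := mem_center_iff.1 hc
  apply hk
  unfold dilation
  rw [h3, div_self (entries_ne_zero_of_fix h2).2]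

lemma exists_endNeighborhood_infty (hΓ : IsFiniteAreaSurfaceGroup Γ) :
    ∃ V : Set Geodesic, IsOpen V ∧ (∀ m ∈ V, IsSimple Γ m → m ∈ endingAt OnePoint.infty) ∧
      ∀ ν : Measure Geodesic, IsInvariantMeasure Γ ν →
        ν {m | m ∈ endingAt OnePoint.infty ∧ m ∉ V ∧ HasTrivialStabilizer Γ m} = 0 := by
  by_cases hfix : ∀ γ ∈ Γ, γ • (OnePoint.infty : OnePoint ℝ) = OnePoint.infty →
      γ ∈ Subgroup.center (GL (Fin 2) ℝ)
  · exact ⟨∅, isOpen_empty, by simp, fun ν hν =>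
      measure_mono_null (fun m hm => hm.1) (hν.measure_endingAt_of_recurrent hΓ hfix)⟩
  push Not at hfix
  obtain ⟨γ, hγ, hinf, hc⟩ := hfix
  have h10 := OnePoint.smul_infty_eq_self_iff.1 hinf
  by_cases hk : |dilation γ| = 1
  · -- a cusp
    rw [abs_dilation_eq_one_iff hΓ hγ h10] at hk
    obtain ⟨h1, h2⟩ := entries_ne_zero_of_fix h10
    have hβ : γ 0 1 / γ 1 1 ≠ 0 := by
      refine div_ne_zero (fun h0 => hc ?_) h2
      rw [mem_center_iff]
      unfold dilation at hk
      rw [div_eq_one_iff_eq h2] at hk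
      exact ⟨h0, h10, hk⟩
    obtain ⟨V, hV, hsub, hs⟩ := exists_isOpen_of_translation hβ hγ (fun t => by
      rw [smul_coe_of_fix h10]
      change (((dilation γ) * _ + _ : ℝ) : OnePoint ℝ) = _
      rw [hk, one_mul])
    refine ⟨V, hV, hs, fun ν _ => ?_⟩
    refine measure_mono_null (fun m hm => ?_) (measure_empty (μ := ν))
    exact absurd (hsub hm.1) hm.2.1
  · -- a fixed point of a hyperbolic element
    obtain ⟨δ, hδ, hδ10, hδk, -⟩ := exists_one_lt_dilation hγ h10 hk
    obtain ⟨w, hw⟩ := exists_fixed_of_dilation hδ10 hδk.ne'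
    refine ⟨∅, isOpen_empty, by simp, fun ν hν => ?_⟩
    refine measure_mono_null ?_ (hν.measure_endingAt_of_dilation (w := w) hδk hδ
      (OnePoint.smul_infty_eq_self_iff.2 hδ10) fun t => ?_)
    · rintro m ⟨⟨b, hb⟩, -, hm⟩
      rcases eq_infty_or_coe b with rfl | ⟨q, rfl⟩
      · exact absurd rfl hb.ne
      refine ⟨q, hb, ?_⟩
      rintro rfl
      have h1 := hb.smul δ
      rw [hw, OnePoint.smul_infty_eq_self_iff.2 hδ10] at h1
      exact notMem_center_of_dilation_ne_one hδk.ne' (hm δ hδ (h1.eq hb))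
    · obtain ⟨t', ht'⟩ := exists_smul_coe_of_fix hδ10 t
      refine ⟨t', ht', ?_⟩
      rw [smul_sub_smul_of_fix hδ10 ht' hw, abs_mul, abs_of_pos (by linarith)]

lemma hasTrivialStabilizer_smul_iff (g : GL (Fin 2) ℝ) {m : Geodesic} :
    HasTrivialStabilizer (conjGroup g Γ) (g • m) ↔ HasTrivialStabilizer Γ m := by
  constructor
  · intro h γ hγ hm
    rw [← conj_mem_center_iff (g := g)]
    refine h _ (conj_mem_conjGroup hγ) ?_
    simp [mul_smul, hm]
  · intro h γ hγ hm
    have h1 := h _ (mem_conjGroup.1 hγ) (by simp [mul_smul, hm])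
    rw [← conj_mem_center_iff (g := g)] at h1
    simpa [mul_assoc] using h1

/-- Every point `e` at infinity has the following property: apart from a null set, and from
geodesics covering closed geodesics, the simple geodesics ending at `e` are isolated from the other
simple geodesics. -/
lemma exists_endNeighborhood (hΓ : IsFiniteAreaSurfaceGroup Γ) (e : OnePoint ℝ) :
    ∃ V : Set Geodesic, IsOpen V ∧ (∀ m ∈ V, IsSimple Γ m → m ∈ endingAt e) ∧
      ∀ ν : Measure Geodesic, IsInvariantMeasure Γ ν →
        ν {m | m ∈ endingAt e ∧ m ∉ V ∧ HasTrivialStabilizer Γ m} = 0 := by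
  obtain ⟨g, hg⟩ : ∃ g : GL (Fin 2) ℝ, g • e = OnePoint.infty := by
    obtain ⟨b, hb⟩ := exists_ne e
    obtain ⟨g, hg, -⟩ := exists_smul_eq_infty_zero hb.symm
    exact ⟨g, hg⟩
  obtain ⟨V, hV, hs, hnull⟩ := exists_endNeighborhood_infty (hΓ.conj g)
  refine ⟨(fun m => g • m) ⁻¹' V, hV.preimage (continuous_const_smul g), fun m hm hsm => ?_,
    fun ν hν => ?_⟩
  · have := hs _ hm ((isSimple_smul_iff g).2 hsm)
    rwa [← hg, smul_mem_endingAt_iff] at this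
  · have h := hnull _ (hν.map g)
    have hemb : MeasurableEmbedding fun m : Geodesic => g • m :=
      (Homeomorph.smul g).measurableEmbedding
    rw [hemb.map_apply] at h
    refine measure_mono_null ?_ h
    rintro m ⟨h1, h2, h3⟩
    refine ⟨?_, h2, (hasTrivialStabilizer_smul_iff g).2 h3⟩
    rw [← hg, smul_mem_endingAt_iff]; exact h1

variable {Λ : Set Geodesic}

/-! ### Leaves of laminations -/

/-- The geodesic with the ends `a` and `b` is a leaf of `Λ`. -/
def IsLeaf (Λ : Set Geodesic) (a b : OnePoint ℝ) : Prop := ∃ l ∈ Λ, l.HasEnds a b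

lemma IsLeaf.symm {a b : OnePoint ℝ} (h : IsLeaf Λ a b) : IsLeaf Λ b a := by
  obtain ⟨l, hl, h⟩ := h
  exact ⟨l, hl, h.symm⟩

lemma IsLeaf.ne {a b : OnePoint ℝ} (h : IsLeaf Λ a b) : a ≠ b := by
  obtain ⟨l, hl, h⟩ := h
  exact h.ne

lemma Geodesic.HasEnds.mem_iff_isLeaf {m : Geodesic} {a b : OnePoint ℝ} (h : m.HasEnds a b) :
    m ∈ Λ ↔ IsLeaf Λ a b := by
  refine ⟨fun hm => ⟨m, hm, h⟩, ?_⟩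
  rintro ⟨l, hl, h'⟩
  rwa [h.eq h']

lemma IsLamination.not_separates (hΛ : IsLamination Γ Λ) {a b c d : OnePoint ℝ}
    (h : IsLeaf Λ a b) (h' : IsLeaf Λ c d) : ¬ Separates a b c d := by
  obtain ⟨l, hl, e⟩ := h
  obtain ⟨l', hl', e'⟩ := h'
  rw [← crosses_iff e e']
  exact hΛ.not_crosses l hl l' hl'

lemma IsLamination.isLeaf_smul (hΛ : IsLamination Γ Λ) {γ : GL (Fin 2) ℝ} (hγ : γ ∈ Γ)
    {a b : OnePoint ℝ} (h : IsLeaf Λ a b) : IsLeaf Λ (γ • a) (γ • b) := by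
  obtain ⟨l, hl, e⟩ := h
  exact ⟨_, hΛ.invariant γ hγ l hl, e.smul γ⟩

/-- The image of the set `Λ` of geodesics under the isometry `g`, written as the preimage under
`g⁻¹`. -/
def conjLam (g : GL (Fin 2) ℝ) (Λ : Set Geodesic) : Set Geodesic := {m | g⁻¹ • m ∈ Λ}

lemma smul_mem_conjLam {g : GL (Fin 2) ℝ} {m : Geodesic} : g • m ∈ conjLam g Λ ↔ m ∈ Λ := by
  simp [conjLam]

lemma isLeaf_conjLam {g : GL (Fin 2) ℝ} {a b : OnePoint ℝ} :
    IsLeaf (conjLam g Λ) (g • a) (g • b) ↔ IsLeaf Λ a b := by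
  constructor
  · rintro ⟨l, hl, h⟩
    refine ⟨_, hl, ?_⟩
    simpa using h.smul g⁻¹
  · rintro ⟨l, hl, h⟩
    exact ⟨g • l, smul_mem_conjLam.2 hl, h.smul g⟩

lemma IsLamination.conj (hΛ : IsLamination Γ Λ) (g : GL (Fin 2) ℝ) :
    IsLamination (conjGroup g Γ) (conjLam g Λ) where
  isClosed := hΛ.isClosed.preimage (continuous_const_smul g⁻¹)
  invariant γ hγ m hm := by
    have := hΛ.invariant _ (mem_conjGroup.1 hγ) _ hm
    simpa [conjLam, mul_smul] using this
  not_crosses m hm m' hm' h := hΛ.not_crosses _ hm _ hm' ((crosses_smul g⁻¹).2 h)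

lemma HasFinitelyManyLeaves.conj (h : HasFinitelyManyLeaves Γ Λ) (g : GL (Fin 2) ℝ) :
    HasFinitelyManyLeaves (conjGroup g Γ) (conjLam g Λ) := by
  obtain ⟨F, hF, hcov⟩ := h
  refine ⟨(fun m => g • m) '' F, hF.image _, fun m hm => ?_⟩
  obtain ⟨f, hf, γ, hγ, e⟩ := hcov _ hm
  refine ⟨_, ⟨f, hf, rfl⟩, _, conj_mem_conjGroup hγ, ?_⟩
  rw [inv_smul_eq_iff] at e
  simp [e, mul_smul]

/-! ### Convergence of leaves -/

lemma continuous_geod_infty :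
    Continuous fun t : ℝ => geod OnePoint.infty t (OnePoint.infty_ne_coe t) := by
  refine Continuous.subtype_mk ?_ _
  exact continuous_sym2_mk.comp (continuous_const.prodMk OnePoint.continuous_coe)

lemma IsLamination.isClosed_isLeaf_infty (hΛ : IsLamination Γ Λ) :
    IsClosed {t : ℝ | IsLeaf Λ OnePoint.infty t} := by
  have : {t : ℝ | IsLeaf Λ OnePoint.infty t} =
      (fun t : ℝ => geod OnePoint.infty t (OnePoint.infty_ne_coe t)) ⁻¹' Λ := by
    ext t
    exact (Geodesic.HasEnds.mem_iff_isLeaf (hasEnds_geod _)).symm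
  rw [this]
  exact hΛ.isClosed.preimage continuous_geod_infty

/-! ### Geodesics with nontrivial stabilizer -/

/-- A nontrivial element that leaves the geodesic from `0` to `∞` invariant is a dilation about `0`:
it does not exchange the ends as it would then have a fixed point in the hyperbolic plane. -/
lemma smul_eq_of_stabilizer (hΓ : IsFiniteAreaSurfaceGroup Γ) {γ : GL (Fin 2) ℝ} (hγ : γ ∈ Γ)
    (hc : γ ∉ Subgroup.center (GL (Fin 2) ℝ)) {m : Geodesic}
    (hm : m.HasEnds OnePoint.infty ((0 : ℝ) : OnePoint ℝ)) (hs : γ • m = m) :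
    γ 1 0 = 0 ∧ γ 0 1 = 0 ∧ |dilation γ| ≠ 1 := by
  have h1 := hm.smul γ
  rw [hs] at h1
  rcases hm.cases h1 with ⟨h2, h3⟩ | ⟨h2, h3⟩
  · have h10 := OnePoint.smul_infty_eq_self_iff.1 h2.symm
    have h01 : γ 0 1 = 0 := by
      rw [smul_coe_of_fix h10] at h3
      have := OnePoint.coe_injective h3
      rw [mul_zero, zero_add, eq_comm, div_eq_zero_iff] at this
      exact this.resolve_right (entries_ne_zero_of_fix h10).2
    refine ⟨h10, h01, fun hd => hc ?_⟩
    rw [abs_dilation_eq_one_iff hΓ hγ h10] at hd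
    unfold dilation at hd
    rw [div_eq_one_iff_eq (entries_ne_zero_of_fix h10).2] at hd
    exact mem_center_iff.2 ⟨h01, h10, hd⟩
  · -- an element exchanging the ends has trace zero
    exfalso
    apply hΓ.trace_ne_zero hγ hc
    have h10 : γ 1 0 ≠ 0 := by
      intro h0
      rw [← OnePoint.smul_infty_eq_self_iff] at h0
      rw [h0] at h3
      exact OnePoint.coe_ne_infty _ h3
    have h11 : γ 1 1 = 0 := by
      rw [OnePoint.smul_some_eq_ite] at h2
      by_contra h0
      simp [h0] at h2
    have h00 : γ 0 0 = 0 := by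
      rw [OnePoint.smul_infty_eq_ite, if_neg h10] at h3
      have := OnePoint.coe_injective h3
      rw [eq_comm, div_eq_zero_iff] at this
      exact this.resolve_right h10
    rw [h00, h11, add_zero]

lemma exists_dilation_of_stabilizer (hΓ : IsFiniteAreaSurfaceGroup Γ) {m : Geodesic}
    (hm : m.HasEnds OnePoint.infty ((0 : ℝ) : OnePoint ℝ)) (hs : ¬ HasTrivialStabilizer Γ m) :
    ∃ γ ∈ Γ, ∃ k : ℝ, 1 < k ∧ γ • (OnePoint.infty : OnePoint ℝ) = OnePoint.infty ∧
      ∀ t : ℝ, γ • (t : OnePoint ℝ) = ((k * t : ℝ) : OnePoint ℝ) := by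
  unfold HasTrivialStabilizer at hs
  push Not at hs
  obtain ⟨γ, hγ, hm', hc⟩ := hs
  obtain ⟨h10, h01, hd⟩ := smul_eq_of_stabilizer hΓ hγ hc hm hm'
  obtain ⟨δ, hδ, hδ10, hδk, hfix⟩ := exists_one_lt_dilation hγ h10 hd
  refine ⟨δ, hδ, dilation δ, hδk, OnePoint.smul_infty_eq_self_iff.2 hδ10, fun t => ?_⟩
  have h0 := hfix ((0 : ℝ) : OnePoint ℝ) (by rw [smul_coe_of_fix h10, h01]; simp)
  obtain ⟨t', ht'⟩ := exists_smul_coe_of_fix hδ10 t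
  have := smul_sub_smul_of_fix hδ10 ht' h0
  rw [ht']
  congr 1
  linarith

lemma smul_pow_coe {γ : GL (Fin 2) ℝ} {k : ℝ}
    (h : ∀ t : ℝ, γ • (t : OnePoint ℝ) = ((k * t : ℝ) : OnePoint ℝ)) (n : ℕ) (t : ℝ) :
    (γ ^ n) • (t : OnePoint ℝ) = ((k ^ n * t : ℝ) : OnePoint ℝ) := by
  induction n with
  | zero => simp
  | succ n ih => rw [pow_succ', mul_smul, ih, h]; congr 1; ring

lemma smul_pow_infty {γ : GL (Fin 2) ℝ}
    (h : γ • (OnePoint.infty : OnePoint ℝ) = OnePoint.infty) (n : ℕ) :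
    (γ ^ n) • (OnePoint.infty : OnePoint ℝ) = OnePoint.infty := by
  induction n with
  | zero => simp
  | succ n ih => rw [pow_succ, mul_smul, h, ih]

/-- If `m` covers a closed geodesic, then a leaf asymptotic to `m` spirals onto this closed
geodesic, which thus is in the closed set `Λ`. -/
lemma mem_of_asymptotic_infty (hΓ : IsFiniteAreaSurfaceGroup Γ) (hΛ : IsLamination Γ Λ)
    {m : Geodesic} (hm : m.HasEnds OnePoint.infty ((0 : ℝ) : OnePoint ℝ))
    (hs : ¬ HasTrivialStabilizer Γ m) {t : ℝ} (ht : IsLeaf Λ OnePoint.infty t) : m ∈ Λ := by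
  obtain ⟨γ, hγ, k, hk, hinf, hγt⟩ := exists_dilation_of_stabilizer hΓ hm hs
  rw [hm.mem_iff_isLeaf]
  have hlim : Filter.Tendsto (fun n : ℕ => k⁻¹ ^ n * t) Filter.atTop (𝓝 (0 * t)) :=
    (tendsto_pow_atTop_nhds_zero_of_lt_one (inv_nonneg.2 (by linarith))
      (inv_lt_one_of_one_lt₀ hk)).mul_const t
  rw [zero_mul] at hlim
  refine hΛ.isClosed_isLeaf_infty.mem_of_tendsto hlim (Filter.Eventually.of_forall fun n => ?_)
  have hk0 : k ≠ 0 := by linarith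
  have h1 := hΛ.isLeaf_smul (Γ.inv_mem (Γ.pow_mem hγ n)) ht
  have h2 : (γ ^ n)⁻¹ • (t : OnePoint ℝ) = ((k⁻¹ ^ n * t : ℝ) : OnePoint ℝ) := by
    rw [inv_smul_eq_iff, smul_pow_coe hγt, ← mul_assoc, ← mul_pow, mul_inv_cancel₀ hk0, one_pow,
      one_mul]
  have h3 : (γ ^ n)⁻¹ • (OnePoint.infty : OnePoint ℝ) = OnePoint.infty := by
    rw [inv_smul_eq_iff, smul_pow_infty hinf]
  rwa [h2, h3] at h1

/-- A geodesic that covers a closed geodesic and is asymptotic to a leaf is itself a leaf. -/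
lemma mem_of_asymptotic (hΓ : IsFiniteAreaSurfaceGroup Γ) (hΛ : IsLamination Γ Λ)
    {m : Geodesic} {a b c : OnePoint ℝ} (hm : m.HasEnds a b)
    (hs : ¬ HasTrivialStabilizer Γ m) (hc : IsLeaf Λ a c) : m ∈ Λ := by
  obtain ⟨g, ha, hb⟩ := exists_smul_eq_infty_zero hm.ne
  have h1 := isLeaf_conjLam (g := g).2 hc
  have h2 := hm.smul g
  rw [ha] at h1
  rw [ha, hb] at h2
  rcases eq_infty_or_coe (g • c) with h | ⟨t, h⟩
  · exact absurd h.symm h1.ne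
  rw [h] at h1
  exact smul_mem_conjLam.1 (mem_of_asymptotic_infty (hΓ.conj g) (hΛ.conj g) h2
    (fun h => hs ((hasTrivialStabilizer_smul_iff g).1 h)) h1)

/-- A side of an ideal triangle of leaves has trivial stabilizer: a dilation along it moves one of
the other two sides across the third. -/
lemma IsLamination.hasTrivialStabilizer_of_triangle (hΓ : IsFiniteAreaSurfaceGroup Γ)
    (hΛ : IsLamination Γ Λ) {m : Geodesic} {a b c : OnePoint ℝ} (hm : m.HasEnds a b)
    (hac : IsLeaf Λ a c) (hbc : IsLeaf Λ b c) : HasTrivialStabilizer Γ m := by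
  by_contra hs
  obtain ⟨g, ha, hb⟩ := exists_smul_eq_infty_zero hm.ne
  have h1 := isLeaf_conjLam (g := g).2 hac
  have h1' := isLeaf_conjLam (g := g).2 hbc
  have h2 := hm.smul g
  rw [ha] at h1
  rw [hb] at h1'
  rw [ha, hb] at h2
  rcases eq_infty_or_coe (g • c) with h | ⟨t, h⟩
  · exact absurd h.symm h1.ne
  rw [h] at h1 h1'
  have ht : t ≠ 0 := fun h0 => h1'.ne (by rw [h0])
  obtain ⟨γ, hγ, k, hk, hinf, hγt⟩ := exists_dilation_of_stabilizer (hΓ.conj g) h2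
    (fun h => hs ((hasTrivialStabilizer_smul_iff g).1 h))
  have h3 := (hΛ.conj g).isLeaf_smul hγ h1'
  rw [hγt, hγt, mul_zero] at h3
  refine (hΛ.conj g).not_separates h1 h3 ?_
  rw [separates_infty_coe]
  have := mul_pos_of_neg_of_neg (show 1 - k < 0 by linarith)
    (show -(t ^ 2) < 0 by have := pow_pos (abs_pos.2 ht) 2; rw [sq_abs] at this; linarith)
  linarith

/-! ### Isolated leaves -/

lemma isCompact_box (A B c d : ℝ) (hc : 0 < c) :
    IsCompact {z : ℍ | A ≤ z.re ∧ z.re ≤ B ∧ c ≤ z.im ∧ z.im ≤ d} := by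
  have h := (isCompact_Icc (a := A) (b := B)).reProdIm (isCompact_Icc (a := c) (b := d))
  have h2 := (UpperHalfPlane.isOpenEmbedding_coe.isEmbedding.isInducing.isCompact_preimage_iff
    (K := Set.Icc A B ×ℂ Set.Icc c d) (by
      rintro z ⟨-, hz⟩
      exact ⟨⟨z, lt_of_lt_of_le hc hz.1⟩, rfl⟩)).2 h
  convert h2 using 1
  ext z
  simp [Complex.mem_reProdIm, and_assoc]

lemma finite_of_fix (hΓ : IsFiniteAreaSurfaceGroup Γ) (z : ℍ) (A B c d : ℝ) (hc : 0 < c) :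
    {γ | γ ∈ Γ ∧ γ 1 0 = 0 ∧ A ≤ (γ • z).re ∧ (γ • z).re ≤ B ∧ c ≤ |dilation γ| ∧
      |dilation γ| ≤ d}.Finite := by
  refine (hΓ.finite_inter (isCompact_singleton (x := z))
    (isCompact_box A B (c * z.im) (d * z.im) (mul_pos hc z.im_pos))).subset ?_
  rintro γ ⟨hγ, h10, h1, h2, h3, h4⟩
  refine ⟨hγ, z, rfl, h1, h2, ?_, ?_⟩ <;> rw [smul_im_of_fix h10]
  · exact mul_le_mul_of_nonneg_right h3 z.im_pos.le
  · exact mul_le_mul_of_nonneg_right h4 z.im_pos.le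

/-- If some dilation about `w` belongs to `Γ`, then all elements of `Γ` that fix `∞` fix `w` too:
otherwise the conjugates of such an element under powers of the dilation accumulate. -/
lemma smul_eq_of_dilation (hΓ : IsFiniteAreaSurfaceGroup Γ) {η δ : GL (Fin 2) ℝ} (hη : η ∈ Γ)
    (hδ : δ ∈ Γ) (hη0 : η 1 0 = 0) (hδ0 : δ 1 0 = 0) (hk : 1 < dilation η) {w : ℝ}
    (hw : η • (w : OnePoint ℝ) = (w : OnePoint ℝ)) : δ • (w : OnePoint ℝ) = (w : OnePoint ℝ) := by
  by_contra hne
  obtain ⟨w', hw'⟩ := exists_smul_coe_of_fix hδ0 w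
  have hd : w' - w ≠ 0 := by
    rw [sub_ne_zero]; rintro rfl; exact hne hw'
  set k := dilation η
  have hk0 : k ≠ 0 := by linarith
  have hpow : ∀ n : ℕ, (η ^ n) 1 0 = 0 ∧ dilation (η ^ n) = k ^ n ∧
      (η ^ n) • (w : OnePoint ℝ) = (w : OnePoint ℝ) := by
    intro n
    induction n with
    | zero => simp [dilation]
    | succ n ih =>
      refine ⟨by rw [pow_succ]; exact fix_mul ih.1 hη0, ?_, ?_⟩
      · rw [pow_succ, dilation_mul ih.1 hη0, ih.2.1, pow_succ]
      · rw [pow_succ, mul_smul, hw, ih.2.2]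
  let ζ : ℕ → GL (Fin 2) ℝ := fun n => (η ^ n)⁻¹ * δ * η ^ n
  have hζ0 : ∀ n, ζ n 1 0 = 0 := fun n =>
    fix_mul (fix_mul (fix_inv (hpow n).1) hδ0) (hpow n).1
  have hζd : ∀ n, dilation (ζ n) = dilation δ := fun n => by
    have h1 := dilation_ne_zero (hpow n).1
    rw [dilation_mul (fix_mul (fix_inv (hpow n).1) hδ0) (hpow n).1,
      dilation_mul (fix_inv (hpow n).1) hδ0, dilation_inv (hpow n).1]
    field_simp
  have hζw : ∀ n, ζ n • (w : OnePoint ℝ) = ((w + (k ^ n)⁻¹ * (w' - w) : ℝ) : OnePoint ℝ) := by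
    intro n
    have h1 : (η ^ n)⁻¹ • (w : OnePoint ℝ) = (w : OnePoint ℝ) := by
      rw [inv_smul_eq_iff, (hpow n).2.2]
    obtain ⟨u, hu⟩ := exists_smul_coe_of_fix (fix_inv (hpow n).1) w'
    have h2 := smul_sub_smul_of_fix (fix_inv (hpow n).1) hu h1
    rw [dilation_inv (hpow n).1, (hpow n).2.1] at h2
    change ((η ^ n)⁻¹ * δ * η ^ n) • (w : OnePoint ℝ) = _
    rw [mul_smul, mul_smul, (hpow n).2.2, hw', hu]
    congr 1
    linarith
  let z : ℍ := ⟨⟨w, 1⟩, one_pos⟩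
  have hzre : z.re = w := rfl
  have hre : ∀ n, (ζ n • z).re = w + (k ^ n)⁻¹ * (w' - w) := by
    intro n
    rw [smul_re_of_fix (hζ0 n), hzre]
    have := hζw n
    rw [smul_coe_of_fix (hζ0 n)] at this
    exact OnePoint.coe_injective this
  have hinj : Function.Injective ζ := by
    intro n n' h
    have h1 := hre n
    rw [h, hre n', add_right_inj, mul_left_inj' hd, inv_inj] at h1
    exact ((pow_right_injective₀ (by linarith) (by linarith : k ≠ 1)) h1).symm
  refine Set.infinite_range_of_injective hinj ((finite_of_fix hΓ z (w - |w' - w|) (w + |w' - w|)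
    |dilation δ| |dilation δ| (abs_pos.2 (dilation_ne_zero hδ0))).subset ?_)
  rintro _ ⟨n, rfl⟩
  have hle : |(k ^ n)⁻¹ * (w' - w)| ≤ |w' - w| := by
    rw [abs_mul, abs_of_pos (by positivity)]
    exact mul_le_of_le_one_left (abs_nonneg _) (inv_le_one_of_one_le₀ (one_le_pow₀ hk.le))
  have := abs_le.1 hle
  refine ⟨Γ.mul_mem (Γ.mul_mem (Γ.inv_mem (Γ.pow_mem hη n)) hδ) (Γ.pow_mem hη n), hζ0 n, ?_, ?_,
    by rw [hζd], by rw [hζd]⟩ <;> rw [hre] <;> linarith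

/-- Among the images of `t` under the elements of `Γ` fixing `∞`, only finitely many are close to
`0`, if `0` is not a fixed point of a dilation in `Γ`. -/
lemma exists_finite_orbit (hΓ : IsFiniteAreaSurfaceGroup Γ) {l : Geodesic}
    (hl : l.HasEnds OnePoint.infty ((0 : ℝ) : OnePoint ℝ)) (hs : HasTrivialStabilizer Γ l) (t : ℝ) :
    ∃ ε > 0, {u : ℝ | |u| < ε ∧ ∃ γ ∈ Γ, γ 1 0 = 0 ∧
      γ • (t : OnePoint ℝ) = (u : OnePoint ℝ)}.Finite := by
  by_cases hdil : ∃ η ∈ Γ, η 1 0 = 0 ∧ |dilation η| ≠ 1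
  · obtain ⟨η₀, hη₀, h0, hk₀⟩ := hdil
    obtain ⟨η, hη, hη0, hk, -⟩ := exists_one_lt_dilation hη₀ h0 hk₀
    obtain ⟨w, hw⟩ := exists_fixed_of_dilation hη0 hk.ne'
    have hw0 : w ≠ 0 := by
      rintro rfl
      refine notMem_center_of_dilation_ne_one hk.ne' (hs η hη ?_)
      have h1 := hl.smul η
      rw [hw, OnePoint.smul_infty_eq_self_iff.2 hη0] at h1
      exact h1.eq hl
    have hfix : ∀ γ ∈ Γ, γ 1 0 = 0 → γ • (w : OnePoint ℝ) = (w : OnePoint ℝ) :=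
      fun γ hγ h => smul_eq_of_dilation hΓ hη hγ hη0 h hk hw
    have hwpos := abs_pos.2 hw0
    refine ⟨|w| / 2, by positivity, ?_⟩
    rcases eq_or_ne t w with rfl | ht
    · refine (Set.finite_singleton t).subset ?_
      rintro u ⟨-, γ, hγ, h, hu⟩
      rw [hfix γ hγ h] at hu
      exact (OnePoint.coe_injective hu).symm
    have htpos := abs_pos.2 (sub_ne_zero.2 ht)
    let z : ℍ := ⟨⟨w, 1⟩, one_pos⟩
    have hfin := finite_of_fix hΓ z w w (|w| / 2 / |t - w|) (3 * |w| / 2 / |t - w|)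
      (by positivity)
    refine (hfin.image fun γ => dilation γ * (t - w) + w).subset ?_
    rintro u ⟨hu, γ, hγ, h, hγt⟩
    have h1 := smul_sub_smul_of_fix h hγt (hfix γ hγ h)
    have h2 : |u - w| = |dilation γ| * |t - w| := by rw [h1, abs_mul]
    have h3 : |w| ≤ |u| + |u - w| := by
      have := abs_sub u (u - w)
      rwa [sub_sub_cancel] at this
    have h4 := abs_sub u w
    have hre : (γ • z).re = w := by
      rw [smul_re_of_fix h]
      have := hfix γ hγ h
      rw [smul_coe_of_fix h] at this
      exact OnePoint.coe_injective this
    refine ⟨γ, ⟨hγ, h, hre.ge, hre.le, ?_, ?_⟩, by dsimp only; linarith⟩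
    · rw [div_le_iff₀ htpos, ← h2]; linarith
    · rw [le_div_iff₀ htpos, ← h2]; linarith
  · push Not at hdil
    refine ⟨1, one_pos, ?_⟩
    let z : ℍ := ⟨⟨t, 1⟩, one_pos⟩
    have hfin := finite_of_fix hΓ z (-1) 1 1 1 one_pos
    refine (hfin.image fun γ => (γ • z).re).subset ?_
    rintro u ⟨hu, γ, hγ, h, hγt⟩
    have hre : (γ • z).re = u := by
      rw [smul_re_of_fix h]
      rw [smul_coe_of_fix h] at hγt
      exact OnePoint.coe_injective hγt
    have := abs_lt.1 hu
    have hd := hdil γ hγ h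
    exact ⟨γ, ⟨hγ, h, by rw [hre]; linarith, by rw [hre]; linarith, hd.ge, hd.le⟩, hre⟩

/-- A leaf with trivial stabilizer is not accumulated by leaves asymptotic to it: there are finitely
many leaves on the surface, and by `exists_finite_orbit` the lifts of each of them that end at `∞`
do not accumulate at it. -/
lemma exists_isolated (hΓ : IsFiniteAreaSurfaceGroup Γ)
    (hfin : HasFinitelyManyLeaves Γ Λ) {l : Geodesic}
    (hl : l.HasEnds OnePoint.infty ((0 : ℝ) : OnePoint ℝ)) (hs : HasTrivialStabilizer Γ l) :
    ∃ ε > 0, ∀ t : ℝ, t ≠ 0 → IsLeaf Λ OnePoint.infty t → ε ≤ |t| := by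
  obtain ⟨F, hF, hcov⟩ := hfin
  -- the leaves ending at `∞` that belong to one orbit, with a given end of the representative
  -- moved to `∞`
  let T : OnePoint ℝ → OnePoint ℝ → Set ℝ := fun c d =>
    {t | ∃ γ ∈ Γ, γ • c = OnePoint.infty ∧ γ • d = (t : OnePoint ℝ)}
  have hT : ∀ c d, ∃ ε > 0, {u | |u| < ε ∧ u ∈ T c d}.Finite := by
    intro c d
    rcases (T c d).eq_empty_or_nonempty with h | ⟨t, γ, hγ, h1, h2⟩
    · exact ⟨1, one_pos, by simp [h]⟩
    obtain ⟨ε, hε, h⟩ := exists_finite_orbit hΓ hl hs t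
    refine ⟨ε, hε, h.subset ?_⟩
    rintro u ⟨hu, δ, hδ, h3, h4⟩
    refine ⟨hu, δ * γ⁻¹, Γ.mul_mem hδ (Γ.inv_mem hγ), ?_, ?_⟩
    · rw [← OnePoint.smul_infty_eq_self_iff, ← h1, mul_smul, inv_smul_smul, h3, h1]
    · rw [← h2, mul_smul, inv_smul_smul, h4]
  choose ends₁ ends₂ hends using Geodesic.exists_hasEnds
  choose ε hε hεT using hT
  have hfinite : ∀ f ∈ F, {u | |u| < min (ε (ends₁ f) (ends₂ f)) (ε (ends₂ f) (ends₁ f)) ∧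
      (u ∈ T (ends₁ f) (ends₂ f) ∨ u ∈ T (ends₂ f) (ends₁ f))}.Finite := by
    intro f _
    refine ((hεT (ends₁ f) (ends₂ f)).union (hεT (ends₂ f) (ends₁ f))).subset ?_
    rintro u ⟨hu, h | h⟩
    · exact Or.inl ⟨hu.trans_le (min_le_left _ _), h⟩
    · exact Or.inr ⟨hu.trans_le (min_le_right _ _), h⟩
  have key : ∀ f ∈ F, ∃ ε' > 0, ∀ u : ℝ, u ≠ 0 →
      (u ∈ T (ends₁ f) (ends₂ f) ∨ u ∈ T (ends₂ f) (ends₁ f)) → ε' ≤ |u| := by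
    intro f hf
    have hpos := lt_min (hε (ends₁ f) (ends₂ f)) (hε (ends₂ f) (ends₁ f))
    have hcl := ((hfinite f hf).subset (Set.sdiff_subset (t := {0}))).isClosed
    have h0 : (0 : ℝ) ∉ {u | |u| < min (ε (ends₁ f) (ends₂ f)) (ε (ends₂ f) (ends₁ f)) ∧
      (u ∈ T (ends₁ f) (ends₂ f) ∨ u ∈ T (ends₂ f) (ends₁ f))} \ {0} := by simp
    obtain ⟨r, hr, hball⟩ := Metric.isOpen_iff.1 hcl.isOpen_compl 0 h0
    refine ⟨min r (min (ε (ends₁ f) (ends₂ f)) (ε (ends₂ f) (ends₁ f))), lt_min hr hpos, ?_⟩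
    intro u hu hmem
    by_contra hlt
    push Not at hlt
    have hu' : u ∈ Metric.ball (0 : ℝ) r := by
      rw [Metric.mem_ball, Real.dist_eq, sub_zero]
      exact hlt.trans_le (min_le_left _ _)
    exact hball hu' ⟨⟨hlt.trans_le (min_le_right _ _), hmem⟩, hu⟩
  choose! ε' hε' hbound using key
  obtain ⟨r, hr, hrF⟩ : ∃ r > 0, ∀ f ∈ F, r ≤ ε' f := by
    rcases F.eq_empty_or_nonempty with rfl | hne
    · exact ⟨1, one_pos, by simp⟩
    · obtain ⟨f, hf, hmin⟩ := hF.exists_minimalFor ε' F hne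
      refine ⟨ε' f, hε' f hf, fun f' hf' => ?_⟩
      by_contra h
      exact h (hmin hf' (le_of_not_ge h))
  refine ⟨r, hr, fun t ht hleaf => ?_⟩
  obtain ⟨l', hl', hends'⟩ := hleaf
  obtain ⟨f, hf, γ, hγ, rfl⟩ := hcov l' hl'
  refine (hrF f hf).trans (hbound f hf t ht ?_)
  rcases ((hends f).smul γ).cases hends' with ⟨h1, h2⟩ | ⟨h1, h2⟩
  · exact Or.inl ⟨γ, hγ, h1, h2⟩
  · exact Or.inr ⟨γ, hγ, h2, h1⟩

/-- If there are leaves asymptotic to `l` at `∞` on the positive side, then one of them is next to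
`l`. -/
lemma exists_least_leaf (hΓ : IsFiniteAreaSurfaceGroup Γ) (hΛ : IsLamination Γ Λ)
    (hfin : HasFinitelyManyLeaves Γ Λ) {l : Geodesic}
    (hl : l.HasEnds OnePoint.infty ((0 : ℝ) : OnePoint ℝ)) (hs : HasTrivialStabilizer Γ l)
    (hne : ∃ t : ℝ, 0 < t ∧ IsLeaf Λ OnePoint.infty t) :
    ∃ α : ℝ, 0 < α ∧ IsLeaf Λ OnePoint.infty α ∧
      ∀ t : ℝ, 0 < t → IsLeaf Λ OnePoint.infty t → α ≤ t := by
  obtain ⟨ε, hε, hbound⟩ := exists_isolated hΓ hfin hl hs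
  obtain ⟨t, ht, htl⟩ := hne
  have heq : {t : ℝ | 0 < t ∧ IsLeaf Λ OnePoint.infty t} =
      Set.Ici ε ∩ {t : ℝ | IsLeaf Λ OnePoint.infty t} := by
    ext t
    constructor
    · rintro ⟨h1, h2⟩
      have := hbound t h1.ne' h2
      rw [abs_of_pos h1] at this
      exact ⟨this, h2⟩
    · rintro ⟨h1, h2⟩
      exact ⟨hε.trans_le h1, h2⟩
  have hcl : IsClosed {t : ℝ | 0 < t ∧ IsLeaf Λ OnePoint.infty t} := by
    rw [heq]; exact isClosed_Ici.inter hΛ.isClosed_isLeaf_infty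
  have hbdd : BddBelow {t : ℝ | 0 < t ∧ IsLeaf Λ OnePoint.infty t} := ⟨0, fun t h => h.1.le⟩
  have hmem := hcl.csInf_mem ⟨t, ht, htl⟩ hbdd
  exact ⟨_, hmem.1, hmem.2, fun t h1 h2 => csInf_le hbdd ⟨h1, h2⟩⟩

/-! ### Sets that are open and compact up to null sets -/

/-- A set of geodesics that is open and, up to a null set for each invariant measure, compact.  The
compact set does not depend on the measure. -/
def IsOpenCompact (Γ : Subgroup (GL (Fin 2) ℝ)) (R : Set Geodesic) : Prop :=
  IsOpen R ∧ ∃ K, IsCompact K ∧ ∀ ν, IsInvariantMeasure Γ ν → R =ᵐ[ν] K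

lemma isOpenCompact_empty : IsOpenCompact Γ ∅ :=
  ⟨isOpen_empty, ∅, isCompact_empty, fun _ _ => Filter.EventuallyEq.rfl⟩

lemma IsOpenCompact.union {R R' : Set Geodesic} (h : IsOpenCompact Γ R)
    (h' : IsOpenCompact Γ R') : IsOpenCompact Γ (R ∪ R') := by
  obtain ⟨h1, K, hK, h2⟩ := h
  obtain ⟨h1', K', hK', h2'⟩ := h'
  exact ⟨h1.union h1', K ∪ K', hK.union hK', fun ν hν =>
    Filter.EventuallyEq.union (h2 ν hν) (h2' ν hν)⟩

lemma isCompact_preimage_smul {K : Set Geodesic} (hK : IsCompact K) (g : GL (Fin 2) ℝ) :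
    IsCompact ((fun m => g • m) ⁻¹' K) :=
  (Homeomorph.smul g).isCompact_preimage.2 hK

lemma IsOpenCompact.preimage {g : GL (Fin 2) ℝ} {R : Set Geodesic}
    (h : IsOpenCompact (conjGroup g Γ) R) : IsOpenCompact Γ ((fun m => g • m) ⁻¹' R) := by
  obtain ⟨h1, K, hK, h2⟩ := h
  refine ⟨h1.preimage (continuous_const_smul g), _, isCompact_preimage_smul hK g, fun ν hν => ?_⟩
  exact ((measurable_smul_geodesic g).quasiMeasurePreserving ν).preimage_ae_eq (h2 _ (hν.map g))

/-! ### The reflection and the inversion -/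

/-- The reflection in the geodesic from `0` to `∞`. -/
noncomputable def reflection : GL (Fin 2) ℝ :=
  Matrix.GeneralLinearGroup.mkOfDetNeZero !![-1, 0; 0, 1] (by simp)

/-- The isometry exchanging `0` and `∞`. -/
noncomputable def inversion : GL (Fin 2) ℝ :=
  Matrix.GeneralLinearGroup.mkOfDetNeZero !![0, 1; 1, 0] (by simp)

lemma reflection_smul_coe (t : ℝ) :
    reflection • (t : OnePoint ℝ) = ((-t : ℝ) : OnePoint ℝ) := by
  rw [OnePoint.smul_some_eq_ite]
  simp [reflection, Matrix.GeneralLinearGroup.mkOfDetNeZero]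

lemma reflection_smul_infty :
    reflection • (OnePoint.infty : OnePoint ℝ) = OnePoint.infty := by
  rw [OnePoint.smul_infty_eq_self_iff]
  simp [reflection, Matrix.GeneralLinearGroup.mkOfDetNeZero]

lemma inversion_smul_coe {t : ℝ} (ht : t ≠ 0) :
    inversion • (t : OnePoint ℝ) = ((t⁻¹ : ℝ) : OnePoint ℝ) := by
  rw [OnePoint.smul_some_eq_ite]
  simp [inversion, Matrix.GeneralLinearGroup.mkOfDetNeZero, ht]

lemma inversion_smul_zero :
    inversion • ((0 : ℝ) : OnePoint ℝ) = OnePoint.infty := by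
  rw [OnePoint.smul_some_eq_ite]
  simp [inversion, Matrix.GeneralLinearGroup.mkOfDetNeZero]

lemma inversion_smul_infty :
    inversion • (OnePoint.infty : OnePoint ℝ) = ((0 : ℝ) : OnePoint ℝ) := by
  rw [OnePoint.smul_infty_eq_ite]
  simp [inversion, Matrix.GeneralLinearGroup.mkOfDetNeZero]

/-- If there are leaves asymptotic to `l` at `0` on the negative side, then one of them is next to
`l`. -/
lemma exists_greatest_leaf (hΓ : IsFiniteAreaSurfaceGroup Γ) (hΛ : IsLamination Γ Λ)
    (hfin : HasFinitelyManyLeaves Γ Λ) {l : Geodesic}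
    (hl : l.HasEnds OnePoint.infty ((0 : ℝ) : OnePoint ℝ)) (hs : HasTrivialStabilizer Γ l)
    (hne : ∃ s : ℝ, s < 0 ∧ IsLeaf Λ ((0 : ℝ) : OnePoint ℝ) s) :
    ∃ β : ℝ, 0 < β ∧ IsLeaf Λ ((0 : ℝ) : OnePoint ℝ) ((-β : ℝ) : OnePoint ℝ) ∧
      ∀ s : ℝ, s < 0 → IsLeaf Λ ((0 : ℝ) : OnePoint ℝ) s → -β ≤ s := by
  set g := reflection * inversion
  have hg0 : g • ((0 : ℝ) : OnePoint ℝ) = OnePoint.infty := by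
    rw [mul_smul, inversion_smul_zero, reflection_smul_infty]
  have hginf : g • (OnePoint.infty : OnePoint ℝ) = ((0 : ℝ) : OnePoint ℝ) := by
    rw [mul_smul, inversion_smul_infty, reflection_smul_coe, neg_zero]
  have hgt : ∀ t : ℝ, t ≠ 0 → g • (t : OnePoint ℝ) = ((-t⁻¹ : ℝ) : OnePoint ℝ) := fun t ht => by
    rw [mul_smul, inversion_smul_coe ht, reflection_smul_coe]
  have hl' := hl.smul g
  rw [hg0, hginf] at hl'
  have hleaf : ∀ s : ℝ, s ≠ 0 → (IsLeaf (conjLam g Λ) OnePoint.infty ((-s⁻¹ : ℝ) : OnePoint ℝ) ↔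
      IsLeaf Λ ((0 : ℝ) : OnePoint ℝ) s) := fun s hs => by
    rw [← hg0, ← hgt s hs, isLeaf_conjLam]
  obtain ⟨s, hs0, hsl⟩ := hne
  obtain ⟨α, hα, h1, h2⟩ := exists_least_leaf (hΓ.conj g) (hΛ.conj g) (hfin.conj g) hl'.symm
    ((hasTrivialStabilizer_smul_iff g).2 hs)
    ⟨-s⁻¹, neg_pos.2 (inv_lt_zero.2 hs0), (hleaf s hs0.ne).2 hsl⟩
  refine ⟨α⁻¹, inv_pos.2 hα, ?_, fun u hu hul => ?_⟩
  · rw [← hleaf _ (neg_ne_zero.2 (inv_ne_zero hα.ne')), inv_neg, neg_neg, inv_inv]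
    exact h1
  · have h3 := h2 (-u⁻¹) (neg_pos.2 (inv_lt_zero.2 hu)) ((hleaf u hu.ne).2 hul)
    rw [← inv_neg] at h3
    have h4 := (le_inv_comm₀ hα (neg_pos.2 hu)).1 h3
    linarith

/-! ### The rectangle of geodesics crossing a leaf in boundary intersections -/

/-- The geodesics joining `(α, ∞)` to `(-β, 0)` form a rectangle in the space of geodesics; the leaf
from `∞` to `0` is asymptotic to the leaves from `∞` to `α` and from `0` to `-β`.  The geodesics in
the boundary of the rectangle have one of the four ends `∞`, `α`, `0`, `-β`.  By
`exists_endNeighborhood` they form a null set, after removal of an open set that contains no simple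
geodesic in the rectangle itself, unless they cover closed geodesics.  In this last case they would
be leaves, but they cross one of the three leaves mentioned, or are equal to the first of them, or
are sides of an ideal triangle of leaves. -/
lemma isOpenCompact_joining (hΓ : IsFiniteAreaSurfaceGroup Γ) (hΛ : IsLamination Γ Λ)
    {l : Geodesic} (hl : l.HasEnds OnePoint.infty ((0 : ℝ) : OnePoint ℝ)) (hlΛ : l ∈ Λ)
    (hs : HasTrivialStabilizer Γ l) {α β : ℝ} (hα : 0 < α) (hβ : 0 < β)
    (hαl : IsLeaf Λ OnePoint.infty α)
    (hβl : IsLeaf Λ ((0 : ℝ) : OnePoint ℝ) ((-β : ℝ) : OnePoint ℝ)) :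
    IsOpenCompact Γ (joining ((fun t : ℝ => (t : OnePoint ℝ)) '' Set.Ioi α)
      ((fun t : ℝ => (t : OnePoint ℝ)) '' Set.Ioo (-β) 0)) := by
  have hl0 : IsLeaf Λ OnePoint.infty ((0 : ℝ) : OnePoint ℝ) := hl.mem_iff_isLeaf.1 hlΛ
  choose V hVo hVs hVn using fun e => exists_endNeighborhood hΓ e
  have hopen : IsOpenMap (fun t : ℝ => (t : OnePoint ℝ)) :=
    OnePoint.isOpenEmbedding_coe.isOpenMap
  set U₁ : Set (OnePoint ℝ) := ((fun t : ℝ => (t : OnePoint ℝ)) '' Set.Iio α)ᶜ with hU₁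
  set U₂ : Set (OnePoint ℝ) := (fun t : ℝ => (t : OnePoint ℝ)) '' Set.Icc (-β) 0 with hU₂
  have hK : IsCompact (joining U₁ U₂) := by
    refine isCompact_joining (hopen _ isOpen_Iio).isClosed_compl.isCompact
      (isCompact_Icc.image OnePoint.continuous_coe) ?_
    rw [Set.disjoint_left]
    rintro _ h ⟨t, ht, rfl⟩
    exact h ⟨t, ht.2.trans_lt hα, rfl⟩
  set E : Set (OnePoint ℝ) := {OnePoint.infty, ((α : ℝ) : OnePoint ℝ), ((0 : ℝ) : OnePoint ℝ),
    ((-β : ℝ) : OnePoint ℝ)} with hE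
  have hEfin : E.Finite := by simp [E]
  refine ⟨isOpen_joining (hopen _ isOpen_Ioi) (hopen _ isOpen_Ioo),
    joining U₁ U₂ \ ⋃ e ∈ E, V e, hK.diff (isOpen_biUnion fun e _ => hVo e), fun ν hν => ?_⟩
  have hnull : ∀ᵐ m ∂ν, ∀ e ∈ E, ¬ (m ∈ endingAt e ∧ m ∉ V e ∧ HasTrivialStabilizer Γ m) := by
    rw [ae_ball_iff hEfin.countable]
    intro e _
    exact measure_eq_zero_iff_ae_notMem.1 (hVn e ν hν)
  rw [Filter.eventuallyEq_set]
  filter_upwards [hnull, hν.simple] with m hm hsm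
  constructor
  · rintro ⟨_, ⟨q, hq, rfl⟩, _, ⟨p, hp, rfl⟩, h⟩
    refine ⟨⟨_, ?_, _, ⟨p, ⟨hp.1.le, hp.2.le⟩, rfl⟩, h⟩, ?_⟩
    · rintro ⟨t, ht, e⟩
      rw [OnePoint.coe_injective e] at ht
      exact lt_asymm (Set.mem_Iio.1 ht) hq
    · simp only [Set.mem_iUnion, not_exists]
      intro e he hmV
      have h1 := hVs e m hmV hsm
      rw [mem_endingAt_iff h] at h1
      have hq' : α < q := hq
      simp only [hE, Set.mem_insert_iff, Set.mem_singleton_iff] at he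
      rcases he with rfl | rfl | rfl | rfl
      · simp [OnePoint.infty_ne_coe] at h1
      all_goals
        simp only [OnePoint.coe_eq_coe] at h1
        rcases h1 with h1 | h1 <;> linarith [hp.1, hp.2]
  · rintro ⟨⟨a, ha, _, ⟨p, hp, rfl⟩, h⟩, hmV⟩
    simp only [Set.mem_iUnion, not_exists] at hmV
    -- a geodesic in the boundary of the rectangle that is not in the null set
    have hbd : ∀ e ∈ E, m ∈ endingAt e → ¬ HasTrivialStabilizer Γ m := fun e he hme ht =>
      hm e he ⟨hme, hmV e he, ht⟩
    have hmem : ∀ e ∈ E, ∀ c, IsLeaf Λ e c → ∀ b, m.HasEnds e b → m ∈ Λ := fun e he c hc b hb =>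
      mem_of_asymptotic hΓ hΛ hb (hbd e he ⟨b, hb⟩) hc
    by_contra hnot
    have hp1 := hp.1
    have hp2 := hp.2
    rcases eq_infty_or_coe a with rfl | ⟨q, rfl⟩
    · have hmΛ := hmem _ (by simp [hE]) _ hl0 _ h
      have hnt := hbd _ (by simp [hE]) ⟨_, h⟩
      rcases hp.2.lt_or_eq with h0 | rfl
      · rcases hp.1.lt_or_eq with h1 | rfl
        · have h2 := hΛ.not_separates hβl (h.mem_iff_isLeaf.1 hmΛ)
          apply h2
          apply Separates.symm
          rw [separates_infty_coe]
          exact mul_neg_of_pos_of_neg (by linarith) (by linarith)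
        · exact hnt (hΛ.hasTrivialStabilizer_of_triangle hΓ h hl0 hβl.symm)
      · rw [h.eq hl] at hnt
        exact hnt hs
    · have hq : α ≤ q := by
        by_contra hq
        exact ha ⟨q, not_le.1 hq, rfl⟩
      have hend : (q : OnePoint ℝ) ∈ E ∨ (p : OnePoint ℝ) ∈ E := by
        by_contra hcon
        simp only [hE, Set.mem_insert_iff, Set.mem_singleton_iff, OnePoint.coe_eq_coe, not_or] at hcon
        obtain ⟨⟨-, h1, -⟩, -, -, h2, h3⟩ := hcon
        exact hnot ⟨_, ⟨q, lt_of_le_of_ne hq (Ne.symm h1), rfl⟩, _,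
          ⟨p, ⟨lt_of_le_of_ne hp.1 (Ne.symm h3), lt_of_le_of_ne hp.2 h2⟩, rfl⟩, h⟩
      have hnt : ¬ HasTrivialStabilizer Γ m := by
        rcases hend with he | he
        · exact hbd _ he ⟨_, h⟩
        · exact hbd _ he ⟨_, h.symm⟩
      have hleafE : ∀ e ∈ E, ∃ c, IsLeaf Λ e c := by
        intro e he
        simp only [hE, Set.mem_insert_iff, Set.mem_singleton_iff] at he
        rcases he with rfl | rfl | rfl | rfl
        exacts [⟨_, hl0⟩, ⟨_, hαl.symm⟩, ⟨_, hβl⟩, ⟨_, hβl.symm⟩]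
      have hmΛ : m ∈ Λ := by
        rcases hend with he | he
        · obtain ⟨c, hc⟩ := hleafE _ he
          exact hmem _ he c hc _ h
        · obtain ⟨c, hc⟩ := hleafE _ he
          exact hmem _ he c hc _ h.symm
      rw [h.mem_iff_isLeaf] at hmΛ
      rcases hp.2.lt_or_eq with h0 | rfl
      · refine hΛ.not_separates hl0 hmΛ ?_
        rw [separates_infty_zero]
        exact mul_neg_of_pos_of_neg (by linarith) h0
      · rcases hq.lt_or_eq with h1 | rfl
        · refine hΛ.not_separates hαl hmΛ ?_
          rw [separates_infty_coe]
          exact mul_neg_of_pos_of_neg (by linarith) (by linarith)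
        · exact hnt (hΛ.hasTrivialStabilizer_of_triangle hΓ h hαl.symm hl0.symm)

/-! ### Boundary intersections -/

lemma IsBoundaryIntersection.crosses {l m : Geodesic} (h : IsBoundaryIntersection Λ l m) :
    Crosses l m := by
  obtain ⟨c, d, p, q, hl, hm, hs, -⟩ := h
  exact ⟨c, d, p, q, hl, hm, hs⟩

lemma AsymptoticToward.conjLam {c d p q : OnePoint ℝ} (h : AsymptoticToward Λ c d p q)
    (g : GL (Fin 2) ℝ) :
    AsymptoticToward (conjLam g Λ) (g • c) (g • d) (g • p) (g • q) := by
  obtain ⟨l', hl', d', h1, h2, h3, h4⟩ := h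
  refine ⟨g • l', smul_mem_conjLam.2 hl', g • d', h1.smul g, ?_, (separates_smul g).2 h3, ?_⟩
  · simpa using h2
  · rwa [separates_smul]

lemma IsBoundaryIntersection.conjLam {l m : Geodesic} (h : IsBoundaryIntersection Λ l m)
    (g : GL (Fin 2) ℝ) : IsBoundaryIntersection (conjLam g Λ) (g • l) (g • m) := by
  obtain ⟨c, d, p, q, hl, hm, hs, h1, h2⟩ := h
  exact ⟨_, _, _, _, hl.smul g, hm.smul g, (separates_smul g).2 hs, h1.conjLam g, h2.conjLam g⟩

lemma conjLam_inv_conjLam (g : GL (Fin 2) ℝ) : conjLam g⁻¹ (conjLam g Λ) = Λ := by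
  ext m
  simp [conjLam]

lemma isBoundaryIntersection_conjLam {g : GL (Fin 2) ℝ} {l m : Geodesic} :
    IsBoundaryIntersection (conjLam g Λ) (g • l) (g • m) ↔ IsBoundaryIntersection Λ l m := by
  refine ⟨fun h => ?_, fun h => h.conjLam g⟩
  have := h.conjLam g⁻¹
  rwa [conjLam_inv_conjLam, inv_smul_smul, inv_smul_smul] at this

lemma IsLamination.conjLam_eq (hΛ : IsLamination Γ Λ) {γ : GL (Fin 2) ℝ} (hγ : γ ∈ Γ) :
    conjLam γ Λ = Λ := by
  ext m
  refine ⟨fun h => ?_, fun h => hΛ.invariant _ (Γ.inv_mem hγ) m h⟩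
  have := hΛ.invariant γ hγ _ h
  rwa [smul_inv_smul] at this

/-- The geodesics that join `p < 0` to `q > 0` and cross the leaf from `∞` to `0` in a boundary
intersection with an asymptotic leaf at `∞` on the side of `q` and one at `0` on the side of
`p`. -/
def boundaryRect (Λ : Set Geodesic) : Set Geodesic :=
  {m | ∃ p q : ℝ, m.HasEnds p q ∧ p < 0 ∧
    (∃ t : ℝ, IsLeaf Λ OnePoint.infty t ∧ 0 < t ∧ t < q) ∧
    ∃ s : ℝ, IsLeaf Λ ((0 : ℝ) : OnePoint ℝ) s ∧ s < p}

lemma asymptoticToward_infty_zero {p q : ℝ} (hp : p < 0) (hq : 0 < q) :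
    AsymptoticToward Λ OnePoint.infty ((0 : ℝ) : OnePoint ℝ) p q ↔
      ∃ t : ℝ, IsLeaf Λ OnePoint.infty t ∧ 0 < t ∧ t < q := by
  constructor
  · rintro ⟨l', hl', d', h1, h2, h3, h4⟩
    rcases eq_infty_or_coe d' with rfl | ⟨t, rfl⟩
    · exact absurd rfl h1.ne
    rw [separates_infty_coe] at h3
    rw [separates_infty_zero, not_lt] at h4
    have ht : t ≠ 0 := by rintro rfl; exact h2 rfl
    have ht0 : 0 < t := lt_of_le_of_ne (nonneg_of_mul_nonneg_left h4 hq) ht.symm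
    refine ⟨t, ⟨l', hl', h1⟩, ht0, ?_⟩
    by_contra hqt
    exact absurd h3 (not_lt.2 (mul_nonneg_of_nonpos_of_nonpos (by linarith) (by linarith)))
  · rintro ⟨t, ⟨l', hl', h1⟩, h2, h3⟩
    refine ⟨l', hl', t, h1, ?_, ?_, ?_⟩
    · rw [Ne, OnePoint.coe_eq_coe]; exact h2.ne'
    · rw [separates_infty_coe]
      exact mul_neg_of_neg_of_pos (by linarith) (by linarith)
    · rw [separates_infty_zero, not_lt]
      exact (mul_pos h2 hq).le

lemma asymptoticToward_zero_infty {p q : ℝ} (hp : p < 0) (hq : 0 < q) :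
    AsymptoticToward Λ ((0 : ℝ) : OnePoint ℝ) OnePoint.infty q p ↔
      ∃ s : ℝ, IsLeaf Λ ((0 : ℝ) : OnePoint ℝ) s ∧ s < p := by
  have hpq := mul_neg_of_neg_of_pos hp hq
  have e : ∀ s : ℝ, Separates ((0 : ℝ) : OnePoint ℝ) s q p ↔ 0 < (s - q) * (s - p) := by
    intro s
    rw [separates_coe, show (0 - q) * (0 - p) * (s - q) * (s - p) =
      -((-(p * q)) * ((s - q) * (s - p))) by ring, neg_lt_zero,
      mul_pos_iff_of_pos_left (neg_pos.2 hpq)]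
  have e' : ∀ s : ℝ, Separates ((0 : ℝ) : OnePoint ℝ) OnePoint.infty s p ↔ s * p < 0 := fun s =>
    ⟨fun h => separates_infty_zero.1 h.swap_left, fun h => (separates_infty_zero.2 h).swap_left⟩
  constructor
  · rintro ⟨l', hl', d', h1, h2, h3, h4⟩
    rcases eq_infty_or_coe d' with rfl | ⟨s, rfl⟩
    · exact absurd rfl h2
    rw [e] at h3
    rw [e', not_lt] at h4
    have hs : s ≤ 0 := by
      by_contra hs
      exact absurd h4 (not_le.2 (mul_neg_of_pos_of_neg (not_le.1 hs) hp))
    refine ⟨s, ⟨l', hl', h1⟩, ?_⟩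
    by_contra hsp
    exact absurd h3 (not_lt.2 (mul_nonpos_of_nonpos_of_nonneg (by linarith) (by linarith)))
  · rintro ⟨s, ⟨l', hl', h1⟩, h2⟩
    refine ⟨l', hl', s, h1, OnePoint.coe_ne_infty s, ?_, ?_⟩
    · rw [e]
      exact mul_pos_of_neg_of_neg (by linarith) (by linarith)
    · rw [e', not_lt]
      exact (mul_pos_of_neg_of_neg (by linarith) hp).le

lemma mem_boundaryRect_or {m : Geodesic} {c d p q : OnePoint ℝ}
    (hc : c = OnePoint.infty) (hd : d = ((0 : ℝ) : OnePoint ℝ))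
    (hm : m.HasEnds p q) (hs : Separates c d p q) (h1 : AsymptoticToward Λ c d p q)
    (h2 : AsymptoticToward Λ d c q p) :
    m ∈ boundaryRect Λ ∨ reflection • m ∈ boundaryRect (conjLam reflection Λ) := by
  subst hc hd
  obtain ⟨p, q, rfl, rfl, hpq⟩ := exists_of_separates_infty_zero hs
  rcases mul_neg_iff.1 hpq with ⟨hp, hq⟩ | ⟨hp, hq⟩
  · right
    have h1' := h1.conjLam reflection
    have h2' := h2.conjLam reflection
    have hm' := hm.smul reflection
    rw [reflection_smul_infty, reflection_smul_coe, reflection_smul_coe, reflection_smul_coe,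
      neg_zero] at h1' h2'
    rw [reflection_smul_coe, reflection_smul_coe] at hm'
    exact ⟨-p, -q, hm', neg_neg_of_pos hp,
      (asymptoticToward_infty_zero (neg_neg_of_pos hp) (neg_pos.2 hq)).1 h1',
      (asymptoticToward_zero_infty (neg_neg_of_pos hp) (neg_pos.2 hq)).1 h2'⟩
  · left
    exact ⟨p, q, hm, hp, (asymptoticToward_infty_zero hp hq).1 h1,
      (asymptoticToward_zero_infty hp hq).1 h2⟩

lemma isBoundaryIntersection_of_mem_boundaryRect {l m : Geodesic}
    (hl : l.HasEnds OnePoint.infty ((0 : ℝ) : OnePoint ℝ)) (hm : m ∈ boundaryRect Λ) :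
    IsBoundaryIntersection Λ l m := by
  obtain ⟨p, q, hpq, hp, ht, hs⟩ := hm
  have hq : 0 < q := by
    obtain ⟨t, -, h1, h2⟩ := ht
    exact h1.trans h2
  exact ⟨_, _, _, _, hl, hpq, separates_infty_zero.2 (mul_neg_of_neg_of_pos hp hq),
    (asymptoticToward_infty_zero hp hq).2 ht, (asymptoticToward_zero_infty hp hq).2 hs⟩

/-- There are two kinds of boundary intersections with the leaf from `∞` to `0`, according to the
side on which the leaves asymptotic to it at `∞` are; the reflection exchanges them. -/
lemma setOf_isBoundaryIntersection {l : Geodesic}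
    (hl : l.HasEnds OnePoint.infty ((0 : ℝ) : OnePoint ℝ)) :
    {m | IsBoundaryIntersection Λ l m} = boundaryRect Λ ∪
      (fun m => reflection • m) ⁻¹' boundaryRect (conjLam reflection Λ) := by
  have hl' := hl.smul reflection
  rw [reflection_smul_infty, reflection_smul_coe, neg_zero] at hl'
  ext m
  constructor
  · rintro ⟨c, d, p, q, hcd, hm, hs, h1, h2⟩
    rcases hcd.cases hl with ⟨hc, hd⟩ | ⟨hc, hd⟩
    · exact mem_boundaryRect_or hc hd hm hs h1 h2
    · exact mem_boundaryRect_or hd hc hm.symm hs.swap_left.swap_right h2 h1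
  · rintro (h | h)
    · exact isBoundaryIntersection_of_mem_boundaryRect hl h
    · exact isBoundaryIntersection_conjLam.1 (isBoundaryIntersection_of_mem_boundaryRect hl' h)

lemma isOpenCompact_boundaryRect (hΓ : IsFiniteAreaSurfaceGroup Γ) (hΛ : IsLamination Γ Λ)
    (hfin : HasFinitelyManyLeaves Γ Λ) {l : Geodesic}
    (hl : l.HasEnds OnePoint.infty ((0 : ℝ) : OnePoint ℝ)) (hlΛ : l ∈ Λ)
    (hs : HasTrivialStabilizer Γ l) : IsOpenCompact Γ (boundaryRect Λ) := by
  rcases (boundaryRect Λ).eq_empty_or_nonempty with h | ⟨m, p, q, -, hp, ⟨t, ht, ht0, -⟩, s, hs', hsp⟩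
  · rw [h]; exact isOpenCompact_empty
  obtain ⟨α, hα, h1, h2⟩ := exists_least_leaf hΓ hΛ hfin hl hs ⟨t, ht0, ht⟩
  obtain ⟨β, hβ, h3, h4⟩ := exists_greatest_leaf hΓ hΛ hfin hl hs ⟨s, hsp.trans hp, hs'⟩
  convert isOpenCompact_joining hΓ hΛ hl hlΛ hs hα hβ h1 h3 using 1
  ext m
  constructor
  · rintro ⟨p, q, hm, hp, ⟨t, ht, ht0, htq⟩, s, hs', hsp⟩
    exact ⟨_, ⟨q, (h2 t ht0 ht).trans_lt htq, rfl⟩, _,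
      ⟨p, ⟨(h4 s (hsp.trans hp) hs').trans_lt hsp, hp⟩, rfl⟩, hm.symm⟩
  · rintro ⟨_, ⟨q, hq, rfl⟩, _, ⟨p, hp, rfl⟩, hm⟩
    exact ⟨p, q, hm.symm, hp.2, ⟨α, h1, hα, hq⟩, -β, h3, hp.1⟩

/-- The boundary intersections with a leaf that does not cover a closed leaf form an open set that
is compact up to a null set. -/
lemma isOpenCompact_isBoundaryIntersection (hΓ : IsFiniteAreaSurfaceGroup Γ)
    (hΛ : IsLamination Γ Λ) (hfin : HasFinitelyManyLeaves Γ Λ) {l : Geodesic} (hlΛ : l ∈ Λ)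
    (hs : HasTrivialStabilizer Γ l) : IsOpenCompact Γ {m | IsBoundaryIntersection Λ l m} := by
  have key : ∀ (Γ : Subgroup (GL (Fin 2) ℝ)) (Λ : Set Geodesic) (l : Geodesic),
      IsFiniteAreaSurfaceGroup Γ → IsLamination Γ Λ → HasFinitelyManyLeaves Γ Λ → l ∈ Λ →
      HasTrivialStabilizer Γ l → l.HasEnds OnePoint.infty ((0 : ℝ) : OnePoint ℝ) →
      IsOpenCompact Γ {m | IsBoundaryIntersection Λ l m} := by
    intro Γ Λ l hΓ hΛ hfin hlΛ hs hl
    rw [setOf_isBoundaryIntersection hl]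
    have hl' := hl.smul reflection
    rw [reflection_smul_infty, reflection_smul_coe, neg_zero] at hl'
    exact (isOpenCompact_boundaryRect hΓ hΛ hfin hl hlΛ hs).union
      (isOpenCompact_boundaryRect (hΓ.conj _) (hΛ.conj _) (hfin.conj _) hl'
        (smul_mem_conjLam.2 hlΛ) ((hasTrivialStabilizer_smul_iff _).2 hs)).preimage
  obtain ⟨a, b, hab⟩ := l.exists_hasEnds
  obtain ⟨g, ha, hb⟩ := exists_smul_eq_infty_zero hab.ne
  have hl := hab.smul g
  rw [ha, hb] at hl
  convert (key _ _ _ (hΓ.conj g) (hΛ.conj g) (hfin.conj g) (smul_mem_conjLam.2 hlΛ)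
    ((hasTrivialStabilizer_smul_iff _).2 hs) hl).preimage using 1
  ext m
  exact isBoundaryIntersection_conjLam.symm

/-! ### Functionals that are trapped between open and compact sets -/

/-- For each invariant measure `ν₀` there are an open set and a compact set, of the same measure with
respect to `ν₀`, whose measures with respect to any invariant measure are a lower and an upper bound
for the functional `F`. -/
def IsTame (Γ : Subgroup (GL (Fin 2) ℝ)) (F : Measure Geodesic → ℝ≥0∞) : Prop :=
  ∀ ν₀, IsInvariantMeasure Γ ν₀ → ∃ B K : Set Geodesic, IsOpen B ∧ IsCompact K ∧
    (∀ ν, IsInvariantMeasure Γ ν → ν B ≤ F ν ∧ F ν ≤ ν K) ∧ ν₀ K ≤ ν₀ B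

lemma IsOpenCompact.isTame {R : Set Geodesic} (h : IsOpenCompact Γ R) :
    IsTame Γ fun ν => ν R := by
  obtain ⟨hR, K, hK, h⟩ := h
  exact fun ν₀ hν₀ => ⟨R, K, hR, hK, fun ν hν => ⟨le_rfl, (measure_congr (h ν hν)).le⟩,
    (measure_congr (h ν₀ hν₀)).ge⟩

lemma IsTame.conj {g : GL (Fin 2) ℝ} {F : Measure Geodesic → ℝ≥0∞}
    (h : IsTame (conjGroup g Γ) F) : IsTame Γ fun ν => F (ν.map fun m => g • m) := by
  intro ν₀ hν₀
  obtain ⟨B, K, hB, hK, h1, h2⟩ := h _ (hν₀.map g)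
  have hm := measurable_smul_geodesic g
  refine ⟨_, _, hB.preimage (continuous_const_smul g), isCompact_preimage_smul hK g,
    fun ν hν => ?_, ?_⟩
  · have := h1 _ (hν.map g)
    rwa [Measure.map_apply hm hB.measurableSet, Measure.map_apply hm hK.measurableSet] at this
  · rwa [Measure.map_apply hm hB.measurableSet, Measure.map_apply hm hK.measurableSet] at h2

/-! ### Diagonal elements -/

lemma smul_coe_of_diag {γ : GL (Fin 2) ℝ} (h10 : γ 1 0 = 0) (h01 : γ 0 1 = 0) (t : ℝ) :
    γ • (t : OnePoint ℝ) = ((dilation γ * t : ℝ) : OnePoint ℝ) := by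
  rw [smul_coe_of_fix h10, h01, zero_div, add_zero]; rfl

lemma diag_of_smul_eq {γ : GL (Fin 2) ℝ} (h : γ • (OnePoint.infty : OnePoint ℝ) = OnePoint.infty)
    (h0 : γ • ((0 : ℝ) : OnePoint ℝ) = ((0 : ℝ) : OnePoint ℝ)) : γ 1 0 = 0 ∧ γ 0 1 = 0 := by
  have h10 := OnePoint.smul_infty_eq_self_iff.1 h
  refine ⟨h10, ?_⟩
  rw [smul_coe_of_fix h10] at h0
  have := OnePoint.coe_injective h0
  rw [mul_zero, zero_add, div_eq_zero_iff] at this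
  exact this.resolve_right (entries_ne_zero_of_fix h10).2

lemma diag_zpow {γ : GL (Fin 2) ℝ} (h10 : γ 1 0 = 0) (h01 : γ 0 1 = 0) (n : ℤ) :
    (γ ^ n) 1 0 = 0 ∧ (γ ^ n) 0 1 = 0 ∧ dilation (γ ^ n) = dilation γ ^ n := by
  have hinf := OnePoint.smul_infty_eq_self_iff.2 h10
  have h0 : γ • ((0 : ℝ) : OnePoint ℝ) = ((0 : ℝ) : OnePoint ℝ) := by
    rw [smul_coe_of_diag h10 h01, mul_zero]
  have h1 : (γ ^ n) • (OnePoint.infty : OnePoint ℝ) = OnePoint.infty :=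
    Subgroup.zpow_mem (MulAction.stabilizer (GL (Fin 2) ℝ) (OnePoint.infty : OnePoint ℝ)) hinf n
  have h2 : (γ ^ n) • ((0 : ℝ) : OnePoint ℝ) = ((0 : ℝ) : OnePoint ℝ) :=
    Subgroup.zpow_mem (MulAction.stabilizer (GL (Fin 2) ℝ) ((0 : ℝ) : OnePoint ℝ)) h0 n
  obtain ⟨h3, h4⟩ := diag_of_smul_eq h1 h2
  refine ⟨h3, h4, ?_⟩
  have hpow : ∀ k : ℕ, (γ ^ k) 1 0 = 0 ∧ dilation (γ ^ k) = dilation γ ^ k := by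
    intro k
    induction k with
    | zero => simp [dilation]
    | succ k ih =>
      refine ⟨by rw [pow_succ]; exact fix_mul ih.1 h10, ?_⟩
      rw [pow_succ, dilation_mul ih.1 h10, ih.2, pow_succ]
  cases n with
  | ofNat k => simpa using (hpow k).2
  | negSucc k =>
    rw [zpow_negSucc, zpow_negSucc, dilation_inv (hpow _).1, (hpow _).2]

/-! ### Crossing points -/

lemma crosses_infty_zero_iff {l m : Geodesic}
    (hl : l.HasEnds OnePoint.infty ((0 : ℝ) : OnePoint ℝ)) :
    Crosses l m ↔ ∃ p q : ℝ, m.HasEnds p q ∧ p < 0 ∧ 0 < q := by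
  obtain ⟨a, b, hab⟩ := m.exists_hasEnds
  rw [crosses_iff hl hab]
  constructor
  · intro h
    obtain ⟨p, q, rfl, rfl, hpq⟩ := exists_of_separates_infty_zero h
    rcases mul_neg_iff.1 hpq with ⟨hp, hq⟩ | ⟨hp, hq⟩
    · exact ⟨q, p, hab.symm, hq, hp⟩
    · exact ⟨p, q, hab, hp, hq⟩
  · rintro ⟨p, q, h, hp, hq⟩
    rw [← crosses_iff hl hab, crosses_iff hl h, separates_infty_zero]
    exact mul_neg_of_neg_of_pos hp hq

/-- For a geodesic with finite ends, the product of the ends (and `0` if one end is `∞`).  As a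
quotient of continuous functions it is measurable. -/
noncomputable def prodEnds (m : Geodesic) : ℝ :=
  endsFun (fun a b => dirEntry 0 1 a * dirEntry 0 1 b) (fun _ _ => mul_comm _ _) m /
    endsFun (fun a b => dirEntry 1 1 a * dirEntry 1 1 b) (fun _ _ => mul_comm _ _) m

lemma prodEnds_eq {m : Geodesic} {p q : ℝ} (h : m.HasEnds p q) : prodEnds m = p * q := by
  unfold prodEnds
  rw [endsFun_eq _ h, endsFun_eq _ h]
  have h1 : p ^ 2 + 1 ≠ 0 := by positivity
  have h2 : q ^ 2 + 1 ≠ 0 := by positivity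
  simp only [dirEntry, homCoord_coe_zero, homCoord_coe_one, one_pow, mul_one]
  field_simp

lemma measurable_prodEnds : Measurable prodEnds := by
  have := continuous_dirEntry
  refine Measurable.div (continuous_endsFun _ ?_).measurable (continuous_endsFun _ ?_).measurable <;>
    fun_prop

/-- The height at which a geodesic crosses the imaginary axis, if it does so. -/
noncomputable def crossHeight (m : Geodesic) : ℝ := √(-prodEnds m)

lemma measurable_crossHeight : Measurable crossHeight := measurable_prodEnds.neg.sqrt

lemma mem_points_iff_crossHeight {l m : Geodesic}
    (hl : l.HasEnds OnePoint.infty ((0 : ℝ) : OnePoint ℝ)) (hm : Crosses l m) {z : ℍ} :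
    z ∈ l.points ∧ z ∈ m.points ↔ z.re = 0 ∧ z.im = crossHeight m := by
  obtain ⟨p, q, hpq, hp, hq⟩ := (crosses_infty_zero_iff hl).1 hm
  have hneg := mul_neg_of_neg_of_pos hp hq
  rw [mem_points_infty_zero hl, mem_points_coe hpq, crossHeight, prodEnds_eq hpq]
  refine and_congr_right fun h => ?_
  rw [h, eq_comm (a := z.im), Real.sqrt_eq_iff_eq_sq (by linarith) z.im_pos.le]
  constructor <;> intro h <;> linarith

lemma crossHeight_pos {l m : Geodesic}
    (hl : l.HasEnds OnePoint.infty ((0 : ℝ) : OnePoint ℝ)) (hm : Crosses l m) :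
    0 < crossHeight m := by
  obtain ⟨p, q, hpq, hp, hq⟩ := (crosses_infty_zero_iff hl).1 hm
  rw [crossHeight, prodEnds_eq hpq]
  exact Real.sqrt_pos.2 (by linarith [mul_neg_of_neg_of_pos hp hq])

lemma points_inter_nonempty {l m : Geodesic} (h : Crosses l m) :
    (l.points ∩ m.points).Nonempty := by
  obtain ⟨a, b, hab⟩ := l.exists_hasEnds
  obtain ⟨g, ha, hb⟩ := exists_smul_eq_infty_zero hab.ne
  have hl := hab.smul g
  rw [ha, hb] at hl
  have h' := (crosses_smul g).2 h
  obtain ⟨z, hz⟩ : ∃ z : ℍ, z ∈ (g • l).points ∧ z ∈ (g • m).points :=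
    ⟨⟨⟨0, crossHeight (g • m)⟩, crossHeight_pos hl h'⟩,
      (mem_points_iff_crossHeight hl h').2 ⟨rfl, rfl⟩⟩
  refine ⟨g⁻¹ • z, ?_, ?_⟩ <;> rw [← smul_mem_points_iff g, smul_inv_smul]
  exacts [hz.1, hz.2]

lemma dilation_of_smul {γ : GL (Fin 2) ℝ} (h10 : γ 1 0 = 0) (h01 : γ 0 1 = 0) {m : Geodesic}
    {p q : ℝ} (h : m.HasEnds p q) :
    (γ • m).HasEnds ((dilation γ * p : ℝ) : OnePoint ℝ) ((dilation γ * q : ℝ) : OnePoint ℝ) := by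
  have := h.smul γ
  rwa [smul_coe_of_diag h10 h01, smul_coe_of_diag h10 h01] at this

lemma smul_eq_of_diag {γ : GL (Fin 2) ℝ} (h10 : γ 1 0 = 0) (h01 : γ 0 1 = 0) {l : Geodesic}
    (hl : l.HasEnds OnePoint.infty ((0 : ℝ) : OnePoint ℝ)) : γ • l = l := by
  have := hl.smul γ
  rw [smul_coe_of_diag h10 h01, mul_zero, OnePoint.smul_infty_eq_self_iff.2 h10] at this
  exact this.eq hl

lemma crossHeight_smul {γ : GL (Fin 2) ℝ} (h10 : γ 1 0 = 0) (h01 : γ 0 1 = 0) {m : Geodesic}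
    {p q : ℝ} (h : m.HasEnds p q) : crossHeight (γ • m) = |dilation γ| * crossHeight m := by
  rw [crossHeight, crossHeight, prodEnds_eq h, prodEnds_eq (dilation_of_smul h10 h01 h),
    ← Real.sqrt_sq_eq_abs, ← Real.sqrt_mul (sq_nonneg _)]
  congr 1; ring

/-- For a geodesic with finite ends, the greater absolute value of the ends. -/
noncomputable def maxEnds (m : Geodesic) : ℝ :=
  endsFun (fun a b => max |homCoord a 0| |homCoord b 0|) (fun _ _ => max_comm _ _) m

lemma maxEnds_eq {m : Geodesic} {p q : ℝ} (h : m.HasEnds p q) : maxEnds m = max |p| |q| := by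
  unfold maxEnds
  rw [endsFun_eq _ h]; simp

lemma maxEnds_smul {γ : GL (Fin 2) ℝ} (h10 : γ 1 0 = 0) (h01 : γ 0 1 = 0) {m : Geodesic}
    {p q : ℝ} (h : m.HasEnds p q) : maxEnds (γ • m) = |dilation γ| * maxEnds m := by
  rw [maxEnds_eq h, maxEnds_eq (dilation_of_smul h10 h01 h), abs_mul, abs_mul,
    mul_max_of_nonneg _ _ (abs_nonneg _)]

/-! ### Fundamental domains of a cyclic group of dilations -/

/-- A set of geodesics that meets each orbit of the powers of `h` at most once has at most the
measure of any set that meets all orbits through it. -/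
lemma measure_le_of_zpow {ν : Measure Geodesic} {h : GL (Fin 2) ℝ}
    (hν : ∀ n : ℤ, ∀ A : Set Geodesic, MeasurableSet A → ν ((fun m => (h ^ n) • m) ⁻¹' A) = ν A)
    {A D : Set Geodesic} (hA : MeasurableSet A) (hD : MeasurableSet D)
    (hinj : ∀ m ∈ A, ∀ n : ℤ, (h ^ n) • m ∈ A → n = 0)
    (hcov : ∀ m ∈ A, ∃ n : ℤ, (h ^ n) • m ∈ D) : ν A ≤ ν D := by
  have hm : ∀ γ : GL (Fin 2) ℝ, Measurable fun m : Geodesic => γ • m := measurable_smul_geodesic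
  calc ν A ≤ ν (⋃ n : ℤ, A ∩ (fun m => (h ^ n) • m) ⁻¹' D) := by
        refine measure_mono fun m hm => ?_
        obtain ⟨n, hn⟩ := hcov m hm
        exact Set.mem_iUnion.2 ⟨n, hm, hn⟩
    _ ≤ ∑' n : ℤ, ν (A ∩ (fun m => (h ^ n) • m) ⁻¹' D) := measure_iUnion_le _
    _ = ∑' n : ℤ, ν ((fun m => (h ^ n)⁻¹ • m) ⁻¹' A ∩ D) := by
        congr 1; funext n
        rw [← hν n _ ((hm _ hA).inter hD)]
        congr 1; ext m; simp
    _ = ν (⋃ n : ℤ, (fun m => (h ^ n)⁻¹ • m) ⁻¹' A ∩ D) := by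
        rw [measure_iUnion _ fun n => (hm _ hA).inter hD]
        intro i j hij
        rw [Function.onFun, Set.disjoint_left]
        rintro m ⟨h1, -⟩ ⟨h2, -⟩
        apply hij
        have h3 : (h ^ (i - j)) • ((h ^ i)⁻¹ • m) ∈ A := by
          rw [← mul_smul, ← zpow_neg, ← zpow_add, show i - j + -i = -j by ring, zpow_neg]
          exact h2
        have := hinj _ h1 _ h3
        omega
    _ ≤ ν D := measure_mono (Set.iUnion_subset fun n => Set.inter_subset_right)

/-- If the powers of `h` multiply both `f` and `f'` by the powers of `k`, then the invariant measures
of `{r ≤ f < k r}` and `{r' ≤ f' < k r'}`, both of which are fundamental domains, are comparable. -/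
lemma measure_window_le {ν : Measure Geodesic} {h : GL (Fin 2) ℝ}
    (hν : ∀ n : ℤ, ∀ A : Set Geodesic, MeasurableSet A → ν ((fun m => (h ^ n) • m) ⁻¹' A) = ν A)
    {C : Set Geodesic} (hC : ∀ m ∈ C, ∀ n : ℤ, (h ^ n) • m ∈ C) {k : ℝ} (hk : 1 < k)
    {f f' : Geodesic → ℝ} (hf : ∀ m ∈ C, ∀ n : ℤ, f ((h ^ n) • m) = k ^ n * f m)
    (hf' : ∀ m ∈ C, ∀ n : ℤ, f' ((h ^ n) • m) = k ^ n * f' m)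
    (hpos : ∀ m ∈ C, 0 < f' m) {r r' : ℝ} (hr : 0 < r) (hr' : 0 < r')
    (hmeas : MeasurableSet {m | m ∈ C ∧ r ≤ f m ∧ f m < k * r})
    (hmeas' : MeasurableSet {m | m ∈ C ∧ r' ≤ f' m ∧ f' m < k * r'}) :
    ν {m | m ∈ C ∧ r ≤ f m ∧ f m < k * r} ≤ ν {m | m ∈ C ∧ r' ≤ f' m ∧ f' m < k * r'} := by
  have hk0 : 0 < k := by linarith
  refine measure_le_of_zpow hν hmeas hmeas' ?_ ?_
  · rintro m ⟨hm, h1, h2⟩ n ⟨-, h3, h4⟩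
    rw [hf m hm] at h3 h4
    have hn := zpow_pos hk0 n
    have h5 : k ^ n < k ^ (1 : ℤ) := by
      rw [zpow_one]
      by_contra hcon
      have := mul_le_mul (not_lt.1 hcon) h1 hr.le hn.le
      linarith
    have h6 : k ^ (0 : ℤ) < k ^ (n + 1) := by
      rw [zpow_zero, zpow_add_one₀ hk0.ne']
      by_contra hcon
      have h7 := mul_le_mul_of_nonneg_right (not_lt.1 hcon) hr.le
      have h8 := mul_lt_mul_of_pos_left h2 hn
      linarith
    have h7 := (zpow_lt_zpow_iff_right₀ hk).1 h5
    have h8 := (zpow_lt_zpow_iff_right₀ hk).1 h6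
    omega
  · rintro m ⟨hm, -, -⟩
    obtain ⟨n, h1, h2⟩ := exists_mem_Ico_zpow (div_pos (hpos m hm) hr') hk
    refine ⟨-n, hC m hm _, ?_, ?_⟩ <;> rw [hf' m hm, zpow_neg]
    · rw [le_div_iff₀ hr'] at h1
      rwa [← div_eq_inv_mul, le_div_iff₀ (zpow_pos hk0 n), mul_comm]
    · rw [div_lt_iff₀ hr', zpow_add_one₀ hk0.ne'] at h2
      rw [← div_eq_inv_mul, div_lt_iff₀ (zpow_pos hk0 n)]
      linarith

/-! ### Leaves that cover closed leaves -/

/-- The stabilizer of a closed leaf contains a shortest dilation. -/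
lemma exists_generator (hΓ : IsFiniteAreaSurfaceGroup Γ) {l : Geodesic}
    (hl : l.HasEnds OnePoint.infty ((0 : ℝ) : OnePoint ℝ)) (hs : ¬ HasTrivialStabilizer Γ l) :
    ∃ h ∈ Γ, h 1 0 = 0 ∧ h 0 1 = 0 ∧ 1 < |dilation h| ∧
      ∀ γ ∈ Γ, γ • l = l → 1 < |dilation γ| → |dilation h| ≤ |dilation γ| := by
  obtain ⟨η, hη, k, hk, hinf, hηt⟩ := exists_dilation_of_stabilizer hΓ hl hs
  have hη0 := diag_of_smul_eq hinf (by rw [hηt, mul_zero])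
  have hηk : dilation η = k := by
    have := smul_coe_of_diag hη0.1 hη0.2 1
    rw [hηt] at this
    have := OnePoint.coe_injective this
    linarith
  set S : Set (GL (Fin 2) ℝ) := {γ | γ ∈ Γ ∧ γ • l = l ∧ 1 < |dilation γ| ∧ |dilation γ| ≤ k}
  have hdiag : ∀ γ ∈ Γ, γ • l = l → 1 < |dilation γ| → γ 1 0 = 0 ∧ γ 0 1 = 0 := by
    intro γ hγ hγl hd
    have hc : γ ∉ Subgroup.center (GL (Fin 2) ℝ) := by
      apply notMem_center_of_dilation_ne_one
      intro h1
      rw [h1, abs_one] at hd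
      exact lt_irrefl _ hd
    obtain ⟨h1, h2, -⟩ := smul_eq_of_stabilizer hΓ hγ hc hl hγl
    exact ⟨h1, h2⟩
  have hfin : S.Finite := by
    refine (finite_of_fix hΓ UpperHalfPlane.I 0 0 1 k one_pos).subset ?_
    rintro γ ⟨hγ, hγl, h1, h2⟩
    obtain ⟨h10, h01⟩ := hdiag γ hγ hγl h1
    have hre : (γ • UpperHalfPlane.I).re = 0 := by
      rw [smul_re_of_fix h10, h01, UpperHalfPlane.I_re]; simp
    exact ⟨hγ, h10, hre.ge, hre.le, h1.le, h2⟩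
  have hηS : η ∈ S := by
    refine ⟨hη, smul_eq_of_diag hη0.1 hη0.2 hl, ?_, ?_⟩ <;> rw [hηk, abs_of_pos (by linarith)]
    exact hk
  obtain ⟨h, hhS, hmin⟩ := hfin.exists_minimalFor (fun γ => |dilation γ|) S ⟨η, hηS⟩
  obtain ⟨h10, h01⟩ := hdiag h hhS.1 hhS.2.1 hhS.2.2.1
  refine ⟨h, hhS.1, h10, h01, hhS.2.2.1, fun γ hγ hγl hd => ?_⟩
  by_contra hlt
  push Not at hlt
  exact absurd (hmin ⟨hγ, hγl, hd, hlt.le.trans hhS.2.2.2⟩ hlt.le) (not_le.2 hlt)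

/-- Almost no geodesic is asymptotic to a geodesic that covers a closed geodesic. -/
lemma IsInvariantMeasure.measure_ending_zero {ν : Measure Geodesic} (hν : IsInvariantMeasure Γ ν)
    {h : GL (Fin 2) ℝ} (hh : h ∈ Γ) (h10 : h 1 0 = 0) (h01 : h 0 1 = 0) (hk : 1 < |dilation h|) :
    ν {m | ∃ q : ℝ, m.HasEnds ((0 : ℝ) : OnePoint ℝ) q} = 0 := by
  set g := inversion
  set δ := g * h⁻¹ * g⁻¹
  have hg1 : g • ((1 : ℝ) : OnePoint ℝ) = ((1 : ℝ) : OnePoint ℝ) := by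
    rw [inversion_smul_coe one_ne_zero, inv_one]
  have hginf : g⁻¹ • (OnePoint.infty : OnePoint ℝ) = ((0 : ℝ) : OnePoint ℝ) := by
    rw [inv_smul_eq_iff, inversion_smul_zero]
  have hg0 : g⁻¹ • ((0 : ℝ) : OnePoint ℝ) = OnePoint.infty := by
    rw [inv_smul_eq_iff, inversion_smul_infty]
  have hi10 := fix_inv h10
  have hi0 : h⁻¹ • ((0 : ℝ) : OnePoint ℝ) = ((0 : ℝ) : OnePoint ℝ) := by
    rw [inv_smul_eq_iff, smul_coe_of_diag h10 h01, mul_zero]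
  have hiinf := OnePoint.smul_infty_eq_self_iff.2 hi10
  have hi01 := (diag_of_smul_eq hiinf hi0).2
  have hδinf : δ • (OnePoint.infty : OnePoint ℝ) = OnePoint.infty := by
    rw [mul_smul, mul_smul, hginf, hi0, inversion_smul_zero]
  have hδ0 : δ • ((0 : ℝ) : OnePoint ℝ) = ((0 : ℝ) : OnePoint ℝ) := by
    rw [mul_smul, mul_smul, hg0, hiinf, inversion_smul_infty]
  obtain ⟨hδ10, hδ01⟩ := diag_of_smul_eq hδinf hδ0
  have hδd : dilation δ = dilation h := by
    have h1 := smul_coe_of_diag hδ10 hδ01 1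
    have h2 : g⁻¹ • ((1 : ℝ) : OnePoint ℝ) = ((1 : ℝ) : OnePoint ℝ) := by
      rw [inv_smul_eq_iff, hg1]
    rw [mul_smul, mul_smul, h2, smul_coe_of_diag hi10 hi01, dilation_inv h10, mul_one,
      inversion_smul_coe (inv_ne_zero (dilation_ne_zero h10)), inv_inv, mul_one] at h1
    exact (OnePoint.coe_injective h1).symm
  have hnull := (hν.map g).measure_endingAt_of_dilation (w := 0) hk (γ := δ)
    (conj_mem_conjGroup (Γ.inv_mem hh)) hδinf fun t => ⟨_, smul_coe_of_diag hδ10 hδ01 t, by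
      rw [hδd, sub_zero, sub_zero, abs_mul]⟩
  have hemb : MeasurableEmbedding fun m : Geodesic => g • m :=
    (Homeomorph.smul g).measurableEmbedding
  rw [hemb.map_apply] at hnull
  refine measure_mono_null ?_ hnull
  rintro m ⟨q, hq⟩
  have hq0 : q ≠ 0 := by rintro rfl; exact hq.ne rfl
  have h1 := hq.smul g
  rw [inversion_smul_zero, inversion_smul_coe hq0] at h1
  exact ⟨q⁻¹, h1, inv_ne_zero hq0⟩

/-- The geodesics whose ends belong to two given sets of real numbers. -/
abbrev joiningReal (s t : Set ℝ) : Set Geodesic :=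
  joining ((fun x : ℝ => (x : OnePoint ℝ)) '' s) ((fun x : ℝ => (x : OnePoint ℝ)) '' t)

lemma mem_joiningReal {s t : Set ℝ} {m : Geodesic} :
    m ∈ joiningReal s t ↔ ∃ p ∈ s, ∃ q ∈ t, m.HasEnds p q := by
  constructor
  · rintro ⟨_, ⟨p, hp, rfl⟩, _, ⟨q, hq, rfl⟩, h⟩
    exact ⟨p, hp, q, hq, h⟩
  · rintro ⟨p, hp, q, hq, h⟩
    exact ⟨_, ⟨p, hp, rfl⟩, _, ⟨q, hq, rfl⟩, h⟩

lemma isOpen_joiningReal {s t : Set ℝ} (hs : IsOpen s) (ht : IsOpen t) :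
    IsOpen (joiningReal s t) :=
  isOpen_joining (OnePoint.isOpenEmbedding_coe.isOpenMap _ hs)
    (OnePoint.isOpenEmbedding_coe.isOpenMap _ ht)

lemma isCompact_joiningReal {s t : Set ℝ} (hs : IsCompact s) (ht : IsCompact t)
    (hd : Disjoint s t) : IsCompact (joiningReal s t) :=
  isCompact_joining (hs.image OnePoint.continuous_coe) (ht.image OnePoint.continuous_coe)
    ((Set.disjoint_image_iff OnePoint.coe_injective).2 hd)

/-- The geodesics joining the two half lines (including `0`) whose ends have the greatest absolute
value `r`. -/
def maxLevel (r : ℝ) : Set Geodesic :=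
  joiningReal {-r} (Set.Icc 0 r) ∪ joiningReal (Set.Icc (-r) 0) {r}

lemma isCompact_maxLevel {r : ℝ} (hr : 0 < r) : IsCompact (maxLevel r) := by
  refine (isCompact_joiningReal isCompact_singleton isCompact_Icc ?_).union
    (isCompact_joiningReal isCompact_Icc isCompact_singleton ?_)
  · rw [Set.disjoint_singleton_left]
    rintro ⟨h, -⟩
    linarith
  · rw [Set.disjoint_singleton_right]
    rintro ⟨-, h⟩
    linarith

lemma maxEnds_of_mem_maxLevel {r : ℝ} (hr : 0 < r) {m : Geodesic} (hm : m ∈ maxLevel r) :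
    maxEnds m = r := by
  rcases hm with hm | hm <;> obtain ⟨p, hp, q, hq, h⟩ := mem_joiningReal.1 hm <;>
    rw [maxEnds_eq h]
  · rw [Set.mem_singleton_iff.1 hp, abs_neg, abs_of_pos hr, abs_of_nonneg hq.1, max_eq_left hq.2]
  · rw [Set.mem_singleton_iff.1 hq, abs_of_pos hr, abs_of_nonpos hp.2, max_eq_right]
    linarith [hp.1]

lemma IsInvariantMeasure.sigmaFinite {ν : Measure Geodesic} (hν : IsInvariantMeasure Γ ν) :
    SigmaFinite ν := by
  have : IsFiniteMeasureOnCompacts ν := ⟨fun K hK => hν.finite K hK⟩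
  have : IsLocallyFiniteMeasure ν := isLocallyFiniteMeasure_of_isFiniteMeasureOnCompacts
  infer_instance

/-- The sets `maxLevel r` are disjoint, so only countably many of them have positive measure. -/
lemma exists_maxLevel_null {ν : Measure Geodesic} [SFinite ν] {k : ℝ} (hk : 1 < k) :
    ∃ r > 0, ν (maxLevel r) = 0 ∧ ν (maxLevel (k * r)) = 0 := by
  have hk0 : 0 < k := by linarith
  have hcount : {r : Set.Ioi (0 : ℝ) | 0 < ν (maxLevel r)}.Countable := by
    refine Measure.countable_meas_pos_of_disjoint_iUnion
      (fun r => (isCompact_maxLevel r.2).measurableSet) ?_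
    intro r r' hne
    rw [Function.onFun, Set.disjoint_left]
    intro m h1 h2
    exact hne (Subtype.ext
      ((maxEnds_of_mem_maxLevel r.2 h1).symm.trans (maxEnds_of_mem_maxLevel r'.2 h2)))
  set S : Set ℝ := Subtype.val '' {r : Set.Ioi (0 : ℝ) | 0 < ν (maxLevel r)} with hS
  have hSc : S.Countable := hcount.image _
  have hnot : ∀ r : ℝ, 0 < r → r ∉ S → ν (maxLevel r) = 0 := by
    intro r hr hrS
    by_contra h
    exact hrS ⟨⟨r, hr⟩, pos_iff_ne_zero.2 h, rfl⟩
  have hSk : ((fun r => k * r) ⁻¹' S).Countable :=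
    hSc.preimage (mul_right_injective₀ hk0.ne')
  obtain ⟨r, hr, hrpos⟩ := (hSc.union hSk).dense_compl ℝ |>.inter_open_nonempty (Set.Ioi 0) isOpen_Ioi
    ⟨1, Set.mem_Ioi.2 one_pos⟩ |>.imp fun r hr => And.symm hr
  rw [Set.mem_compl_iff, Set.mem_union, not_or] at hr
  exact ⟨r, hrpos, hnot r hrpos hr.1, hnot _ (mul_pos hk0 hrpos) hr.2⟩

/-- The measure of the set of geodesics that cross a segment of length one period of a leaf covering
a closed leaf.  The ends of the segment may carry positive measure, but the geodesics whose greatest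
end in absolute value lies in `[r, k r)` form another fundamental domain, the boundary of which is a
null set for a suitable `r` depending on the measure. -/
lemma isTame_crossHeight {l : Geodesic}
    (hl : l.HasEnds OnePoint.infty ((0 : ℝ) : OnePoint ℝ)) {h : GL (Fin 2) ℝ} (hh : h ∈ Γ)
    (h10 : h 1 0 = 0) (h01 : h 0 1 = 0) (hk : 1 < |dilation h|) :
    IsTame Γ fun ν => ν {m | Crosses l m ∧ 1 ≤ crossHeight m ∧ crossHeight m < |dilation h|} := by
  intro ν₀ hν₀
  have := hν₀.sigmaFinite
  set k := |dilation h|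
  obtain ⟨r, hr, hr1, hr2⟩ := exists_maxLevel_null (ν := ν₀) hk
  have hkr : r < k * r := lt_mul_of_one_lt_left hr hk
  set B := joiningReal (Set.Ioo (-(k * r)) (-r)) (Set.Ioo 0 (k * r)) ∪
    joiningReal (Set.Ioo (-(k * r)) 0) (Set.Ioo r (k * r)) with hB
  set K := joiningReal (Set.Icc (-(k * r)) (-r)) (Set.Icc 0 (k * r)) ∪
    joiningReal (Set.Icc (-(k * r)) 0) (Set.Icc r (k * r)) with hK
  set Q := {m | m ∈ {m | Crosses l m} ∧ r ≤ maxEnds m ∧ maxEnds m < k * r} with hQ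
  have hKc : IsCompact K := by
    refine (isCompact_joiningReal isCompact_Icc isCompact_Icc ?_).union
      (isCompact_joiningReal isCompact_Icc isCompact_Icc ?_) <;>
    · rw [Set.disjoint_left]
      rintro x ⟨-, h1⟩ ⟨h2, -⟩
      linarith
  have hmemQ : ∀ {m : Geodesic}, m ∈ Q ↔ ∃ p q : ℝ, m.HasEnds p q ∧ p < 0 ∧ 0 < q ∧
      (r ≤ -p ∨ r ≤ q) ∧ -p < k * r ∧ q < k * r := by
    intro m
    have e : ∀ {p q : ℝ}, m.HasEnds p q → p < 0 → 0 < q → maxEnds m = max (-p) q := by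
      intro p q h hp hq
      rw [maxEnds_eq h, abs_of_neg hp, abs_of_pos hq]
    constructor
    · rintro ⟨hm, h1, h2⟩
      obtain ⟨p, q, hpq, hp, hq⟩ := (crosses_infty_zero_iff hl).1 hm
      rw [e hpq hp hq] at h1 h2
      exact ⟨p, q, hpq, hp, hq, le_max_iff.1 h1, max_lt_iff.1 h2⟩
    · rintro ⟨p, q, hpq, hp, hq, h1, h2⟩
      refine ⟨(crosses_infty_zero_iff hl).2 ⟨p, q, hpq, hp, hq⟩, ?_⟩
      rw [e hpq hp hq]
      exact ⟨le_max_iff.2 h1, max_lt_iff.2 h2⟩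
  have hQm : MeasurableSet Q := by
    have : Q = joiningReal (Set.Ioo (-(k * r)) 0) (Set.Ioo 0 (k * r)) \
        joiningReal (Set.Ioo (-r) 0) (Set.Ioo 0 r) := by
      ext m
      rw [hmemQ, Set.mem_sdiff, mem_joiningReal, mem_joiningReal]
      constructor
      · rintro ⟨p, q, hpq, hp, hq, h1, h2, h3⟩
        refine ⟨⟨p, ⟨by linarith, hp⟩, q, ⟨hq, h3⟩, hpq⟩, ?_⟩
        rintro ⟨p', hp', q', hq', h'⟩
        rcases hpq.cases h' with ⟨e1, e2⟩ | ⟨e1, e2⟩ <;>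
          rw [OnePoint.coe_eq_coe] at e1 e2 <;> subst e1 e2
        · rcases h1 with h1 | h1 <;> linarith [hp'.1, hq'.2]
        · linarith [hp'.2]
      · rintro ⟨⟨p, hp, q, hq, h⟩, hnot⟩
        refine ⟨p, q, h, hp.2, hq.1, ?_, by linarith [hp.1], hq.2⟩
        by_contra hcon
        push Not at hcon
        exact hnot ⟨p, ⟨by linarith [hcon.1], hp.2⟩, q, ⟨hq.1, hcon.2⟩, h⟩
    rw [this]
    exact (isOpen_joiningReal isOpen_Ioo isOpen_Ioo).measurableSet.diff
      (isOpen_joiningReal isOpen_Ioo isOpen_Ioo).measurableSet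
  have hPm : MeasurableSet {m | m ∈ {m | Crosses l m} ∧ 1 ≤ crossHeight m ∧
      crossHeight m < k * 1} :=
    (isOpen_crosses l).measurableSet.inter
      ((measurableSet_le measurable_const measurable_crossHeight).inter
        (measurableSet_lt measurable_crossHeight measurable_const))
  have heq : ∀ ν, IsInvariantMeasure Γ ν →
      ν {m | Crosses l m ∧ 1 ≤ crossHeight m ∧ crossHeight m < k} = ν Q := by
    intro ν hν
    have hinv : ∀ n : ℤ, ∀ A : Set Geodesic, MeasurableSet A →
        ν ((fun m => (h ^ n) • m) ⁻¹' A) = ν A :=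
      fun n => hν.invariant _ (Γ.zpow_mem hh n)
    have hC : ∀ m ∈ {m | Crosses l m}, ∀ n : ℤ, (h ^ n) • m ∈ {m | Crosses l m} := by
      intro m hm n
      obtain ⟨h1, h2, -⟩ := diag_zpow h10 h01 n
      have := (crosses_smul (h ^ n)).2 hm
      rwa [smul_eq_of_diag h1 h2 hl] at this
    have hf : ∀ m ∈ {m | Crosses l m}, ∀ n : ℤ,
        crossHeight ((h ^ n) • m) = k ^ n * crossHeight m := by
      intro m hm n
      obtain ⟨h1, h2, h3⟩ := diag_zpow h10 h01 n
      obtain ⟨p, q, hpq, -⟩ := (crosses_infty_zero_iff hl).1 hm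
      rw [crossHeight_smul h1 h2 hpq, h3, abs_zpow]
    have hf' : ∀ m ∈ {m | Crosses l m}, ∀ n : ℤ,
        maxEnds ((h ^ n) • m) = k ^ n * maxEnds m := by
      intro m hm n
      obtain ⟨h1, h2, h3⟩ := diag_zpow h10 h01 n
      obtain ⟨p, q, hpq, -⟩ := (crosses_infty_zero_iff hl).1 hm
      rw [maxEnds_smul h1 h2 hpq, h3, abs_zpow]
    have hpos : ∀ m ∈ {m | Crosses l m}, 0 < maxEnds m := by
      intro m hm
      obtain ⟨p, q, hpq, -, hq⟩ := (crosses_infty_zero_iff hl).1 hm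
      rw [maxEnds_eq hpq]
      exact lt_max_of_lt_right (abs_pos.2 hq.ne')
    have h1 := measure_window_le hinv hC hk hf hf' hpos one_pos hr hPm hQm
    have h2 := measure_window_le hinv hC hk hf' hf (fun m hm => crossHeight_pos hl hm) hr one_pos
      hQm hPm
    rw [mul_one] at h1 h2
    exact le_antisymm h1 h2
  refine ⟨B, K, (isOpen_joiningReal isOpen_Ioo isOpen_Ioo).union
    (isOpen_joiningReal isOpen_Ioo isOpen_Ioo), hKc, fun ν hν => ?_, ?_⟩
  · beta_reduce
    rw [heq ν hν]
    refine ⟨measure_mono ?_, measure_mono ?_⟩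
    · rintro m (hm | hm) <;> obtain ⟨p, hp, q, hq, h⟩ := mem_joiningReal.1 hm <;>
        obtain ⟨hp1, hp2⟩ := hp <;> obtain ⟨hq1, hq2⟩ := hq
      · exact hmemQ.2 ⟨p, q, h, by linarith, hq1, Or.inl (by linarith), by linarith, hq2⟩
      · exact hmemQ.2 ⟨p, q, h, hp2, by linarith, Or.inr hq1.le, by linarith, hq2⟩
    · intro m hm
      obtain ⟨p, q, hpq, hp, hq, h1 | h1, h2, h3⟩ := hmemQ.1 hm
      · exact Or.inl (mem_joiningReal.2 ⟨p, ⟨by linarith, by linarith⟩, q, ⟨hq.le, h3.le⟩, hpq⟩)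
      · exact Or.inr (mem_joiningReal.2 ⟨p, ⟨by linarith, hp.le⟩, q, ⟨h1, h3.le⟩, hpq⟩)
  · have hsub : K ⊆ B ∪ (maxLevel r ∪ maxLevel (k * r) ∪
        {m | ∃ q : ℝ, m.HasEnds ((0 : ℝ) : OnePoint ℝ) q}) := by
      intro m hm
      obtain ⟨p, q, hpq, hp1, hp2, hq1, hq2, hor⟩ : ∃ p q : ℝ, m.HasEnds p q ∧ -(k * r) ≤ p ∧
          p ≤ 0 ∧ 0 ≤ q ∧ q ≤ k * r ∧ (p ≤ -r ∨ r ≤ q) := by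
        rcases hm with hm | hm <;> obtain ⟨p, hp, q, hq, h⟩ := mem_joiningReal.1 hm
        · exact ⟨p, q, h, hp.1, by linarith [hp.2], hq.1, hq.2, Or.inl hp.2⟩
        · exact ⟨p, q, h, hp.1, hp.2, by linarith [hq.1], hq.2, Or.inr hq.1⟩
      rcases hp2.lt_or_eq with hp2 | rfl
      swap
      · exact Or.inr (Or.inr ⟨q, hpq⟩)
      rcases hq1.lt_or_eq with hq1 | rfl
      swap
      · exact Or.inr (Or.inr ⟨p, hpq.symm⟩)
      rcases hp1.lt_or_eq with hp1 | rfl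
      swap
      · exact Or.inr (Or.inl (Or.inr (Or.inl (mem_joiningReal.2
          ⟨_, rfl, q, ⟨hq1.le, hq2⟩, hpq⟩))))
      rcases hq2.lt_or_eq with hq2 | rfl
      swap
      · exact Or.inr (Or.inl (Or.inr (Or.inr (mem_joiningReal.2
          ⟨p, ⟨hp1.le, hp2.le⟩, _, rfl, hpq⟩))))
      rcases lt_trichotomy p (-r) with h1 | rfl | h1
      · exact Or.inl (Or.inl (mem_joiningReal.2 ⟨p, ⟨hp1, h1⟩, q, ⟨hq1, hq2⟩, hpq⟩))
      · rcases le_or_gt q r with h2 | h2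
        · exact Or.inr (Or.inl (Or.inl (Or.inl (mem_joiningReal.2
            ⟨_, rfl, q, ⟨hq1.le, h2⟩, hpq⟩))))
        · exact Or.inl (Or.inr (mem_joiningReal.2 ⟨_, ⟨hp1, hp2⟩, q, ⟨h2, hq2⟩, hpq⟩))
      · have h2 : r ≤ q := hor.resolve_left (not_le.2 h1)
        rcases h2.lt_or_eq with h2 | rfl
        · exact Or.inl (Or.inr (mem_joiningReal.2 ⟨p, ⟨hp1, hp2⟩, q, ⟨h2, hq2⟩, hpq⟩))
        · exact Or.inr (Or.inl (Or.inl (Or.inr (mem_joiningReal.2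
            ⟨p, ⟨h1.le, hp2.le⟩, _, rfl, hpq⟩))))
    have hnull : ν₀ (maxLevel r ∪ maxLevel (k * r) ∪
        {m | ∃ q : ℝ, m.HasEnds ((0 : ℝ) : OnePoint ℝ) q}) = 0 := by
      rw [measure_union_null_iff, measure_union_null_iff]
      exact ⟨⟨hr1, hr2⟩, hν₀.measure_ending_zero hh h10 h01 hk⟩
    calc ν₀ K ≤ ν₀ (B ∪ _) := measure_mono hsub
      _ ≤ ν₀ B + ν₀ _ := measure_union_le _ _
      _ = ν₀ B := by rw [hnull, add_zero]

/-- If the leaves asymptotic to the leaf from `∞` to `0` are permuted by a dilation, then one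
boundary intersection forces all crossing geodesics to cross in boundary intersections. -/
lemma crosses_subset_boundaryRect {l : Geodesic}
    (hl : l.HasEnds OnePoint.infty ((0 : ℝ) : OnePoint ℝ)) {k : ℝ} (hk : 1 < k)
    (hinf : ∀ t : ℝ, IsLeaf Λ OnePoint.infty t → IsLeaf Λ OnePoint.infty ((k⁻¹ * t : ℝ) : OnePoint ℝ))
    (hzero : ∀ s : ℝ, IsLeaf Λ ((0 : ℝ) : OnePoint ℝ) s →
      IsLeaf Λ ((0 : ℝ) : OnePoint ℝ) ((k * s : ℝ) : OnePoint ℝ))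
    (hne : (boundaryRect Λ).Nonempty) : {m | Crosses l m} ⊆ boundaryRect Λ := by
  obtain ⟨-, p, q, -, hp, ⟨t, ht, ht0, -⟩, s, hs, hsp⟩ := hne
  have hs0 : 0 < -s := by linarith
  have hinf' : ∀ n : ℕ, IsLeaf Λ OnePoint.infty ((k⁻¹ ^ n * t : ℝ) : OnePoint ℝ) := by
    intro n
    induction n with
    | zero => simpa using ht
    | succ n ih => rw [pow_succ', mul_assoc]; exact hinf _ ih
  have hzero' : ∀ n : ℕ, IsLeaf Λ ((0 : ℝ) : OnePoint ℝ) ((k ^ n * s : ℝ) : OnePoint ℝ) := by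
    intro n
    induction n with
    | zero => simpa using hs
    | succ n ih => rw [pow_succ', mul_assoc]; exact hzero _ ih
  intro m hm
  obtain ⟨p', q', hm, hp', hq'⟩ := (crosses_infty_zero_iff hl).1 hm
  obtain ⟨n, hn⟩ := exists_pow_lt_of_lt_one (div_pos hq' ht0) (inv_lt_one_of_one_lt₀ hk)
  obtain ⟨n', hn'⟩ := pow_unbounded_of_one_lt (-p' / -s) hk
  rw [lt_div_iff₀ ht0] at hn
  rw [div_lt_iff₀ hs0] at hn'
  have : 0 < k⁻¹ := inv_pos.2 (by linarith)
  exact ⟨p', q', hm, hp', ⟨_, hinf' n, by positivity, hn⟩, _, hzero' n', by linarith⟩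

/-- A set of representatives of the points of the leaf `l` modulo its stabilizer, such that the
measure of the boundary intersections on it is tame. -/
structure IsSegment (Γ : Subgroup (GL (Fin 2) ℝ)) (Λ : Set Geodesic) (l : Geodesic) (D : Set ℍ) :
    Prop where
  measurableSet : MeasurableSet D
  subset : D ⊆ l.points
  injecting : ∀ z ∈ D, ∀ γ ∈ Γ, γ • l = l → γ • z ∈ D → γ ∈ Subgroup.center (GL (Fin 2) ℝ)
  covering : ∀ z ∈ l.points, ∃ γ ∈ Γ, γ • l = l ∧ γ • z ∈ D
  isTame : IsTame Γ fun ν =>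
    ν {m | IsBoundaryIntersection Λ l m ∧ (l.points ∩ m.points ∩ D).Nonempty}

lemma IsSegment.preimage {g : GL (Fin 2) ℝ} {l : Geodesic} {D : Set ℍ}
    (h : IsSegment (conjGroup g Γ) (conjLam g Λ) (g • l) D) :
    IsSegment Γ Λ l ((fun z => g • z) ⁻¹' D) where
  measurableSet := (continuous_const_smul g).measurable h.measurableSet
  subset z hz := (smul_mem_points_iff g).1 (h.subset hz)
  injecting z hz γ hγ hl hγz := by
    rw [← conj_mem_center_iff (g := g)]
    refine h.injecting _ hz _ (conj_mem_conjGroup hγ) ?_ ?_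
    · simp [mul_smul, hl]
    · simpa [mul_smul] using hγz
  covering z hz := by
    obtain ⟨γ, hγ, hl, hD⟩ := h.covering _ ((smul_mem_points_iff g).2 hz)
    refine ⟨_, mem_conjGroup.1 hγ, ?_, ?_⟩
    · rw [mul_smul, mul_smul, hl, inv_smul_smul]
    · simpa [mul_smul] using hD
  isTame := by
    convert h.isTame.conj using 2 with ν
    have hemb : MeasurableEmbedding fun m : Geodesic => g • m :=
      (Homeomorph.smul g).measurableEmbedding
    rw [hemb.map_apply]
    congr 1
    ext m
    refine and_congr isBoundaryIntersection_conjLam.symm ?_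
    constructor
    · rintro ⟨z, ⟨h1, h2⟩, h3⟩
      exact ⟨g • z, ⟨(smul_mem_points_iff g).2 h1, (smul_mem_points_iff g).2 h2⟩, h3⟩
    · rintro ⟨z, ⟨h1, h2⟩, h3⟩
      refine ⟨g⁻¹ • z, ⟨?_, ?_⟩, ?_⟩
      · rwa [← smul_mem_points_iff g, smul_inv_smul]
      · rwa [← smul_mem_points_iff g, smul_inv_smul]
      · rwa [Set.mem_preimage, smul_inv_smul]

lemma measurableSet_points (l : Geodesic) : MeasurableSet l.points := by
  obtain ⟨a, b, hab⟩ := l.exists_hasEnds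
  obtain ⟨g, ha, hb⟩ := exists_smul_eq_infty_zero hab.ne
  have hl := hab.smul g
  rw [ha, hb] at hl
  have : l.points = (fun z : ℍ => (g • z).re) ⁻¹' {0} := by
    ext z
    rw [← smul_mem_points_iff g, mem_points_infty_zero hl]; rfl
  rw [this]
  exact (UpperHalfPlane.continuous_re.comp (continuous_const_smul g)).measurable
    (measurableSet_singleton 0)

/-- A leaf that does not cover a closed leaf embeds into the surface. -/
lemma isSegment_of_hasTrivialStabilizer (hΓ : IsFiniteAreaSurfaceGroup Γ)
    (hΛ : IsLamination Γ Λ) (hfin : HasFinitelyManyLeaves Γ Λ) {l : Geodesic} (hlΛ : l ∈ Λ)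
    (hs : HasTrivialStabilizer Γ l) : IsSegment Γ Λ l l.points where
  measurableSet := measurableSet_points l
  subset := subset_rfl
  injecting _ _ γ hγ hl _ := hs γ hγ hl
  covering z hz := ⟨1, Γ.one_mem, one_smul _ _, by rwa [one_smul]⟩
  isTame := by
    convert (isOpenCompact_isBoundaryIntersection hΓ hΛ hfin hlΛ hs).isTame using 3 with ν
    ext m
    refine and_iff_left_of_imp fun h => ?_
    rw [Set.inter_assoc, Set.inter_comm m.points, ← Set.inter_assoc, Set.inter_self]
    exact points_inter_nonempty h.crosses

/-- On a leaf that covers a closed leaf one takes a segment whose length is one period. -/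
lemma isSegment_of_not_hasTrivialStabilizer (hΓ : IsFiniteAreaSurfaceGroup Γ)
    (hΛ : IsLamination Γ Λ) {l : Geodesic}
    (hl : l.HasEnds OnePoint.infty ((0 : ℝ) : OnePoint ℝ)) (hs : ¬ HasTrivialStabilizer Γ l) :
    ∃ D, IsSegment Γ Λ l D := by
  obtain ⟨h, hh, h10, h01, hk, hmin⟩ := exists_generator hΓ hl hs
  set k := |dilation h| with hkdef
  have hk0 : 0 < k := by linarith
  have hdiag : ∀ γ ∈ Γ, γ ∉ Subgroup.center (GL (Fin 2) ℝ) → γ • l = l →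
      k ≤ |dilation γ| ∨ |dilation γ| * k ≤ 1 := by
    intro γ hγ hc hγl
    obtain ⟨h1, h2, h3⟩ := smul_eq_of_stabilizer hΓ hγ hc hl hγl
    rcases h3.lt_or_gt with h3 | h3
    · have hpos := abs_pos.2 (dilation_ne_zero h1)
      have := hmin γ⁻¹ (Γ.inv_mem hγ) (by rw [inv_smul_eq_iff, hγl])
        (by rw [dilation_inv h1, abs_inv]; exact (one_lt_inv₀ hpos).2 h3)
      rw [dilation_inv h1, abs_inv, le_inv_comm₀ hk0 hpos] at this
      right
      rwa [← le_div_iff₀ hk0, one_div]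
    · exact Or.inl (hmin γ hγ hγl h3)
  refine ⟨{z | z.re = 0 ∧ 1 ≤ z.im ∧ z.im < k}, ?_, ?_, ?_, ?_, ?_⟩
  · exact (UpperHalfPlane.continuous_re.measurable (measurableSet_singleton 0)).inter
      ((measurableSet_le measurable_const UpperHalfPlane.continuous_im.measurable).inter
        (measurableSet_lt UpperHalfPlane.continuous_im.measurable measurable_const))
  · rintro z ⟨hz, -⟩
    exact (mem_points_infty_zero hl).2 hz
  · rintro z ⟨-, hz1, hz2⟩ γ hγ hγl ⟨-, hz3, hz4⟩
    by_contra hc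
    obtain ⟨h1, -, -⟩ := smul_eq_of_stabilizer hΓ hγ hc hl hγl
    rw [smul_im_of_fix h1] at hz3 hz4
    change 1 ≤ |dilation γ| * z.im at hz3
    change |dilation γ| * z.im < k at hz4
    have hpos := abs_pos.2 (dilation_ne_zero h1)
    rcases hdiag γ hγ hc hγl with h2 | h2
    · have := mul_le_mul h2 hz1 zero_le_one hpos.le
      linarith
    · have := mul_lt_mul_of_pos_left hz2 hpos
      linarith
  · intro z hz
    rw [mem_points_infty_zero hl] at hz
    obtain ⟨n, hn1, hn2⟩ := exists_mem_Ico_zpow z.im_pos hk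
    obtain ⟨h1, h2, h3⟩ := diag_zpow h10 h01 (-n)
    refine ⟨h ^ (-n), Γ.zpow_mem hh _, smul_eq_of_diag h1 h2 hl, ?_, ?_⟩
    · rw [smul_re_of_fix h1, hz, h2]; simp
    · have him : ((h ^ (-n)) • z).im = (k ^ n)⁻¹ * z.im := by
        rw [smul_im_of_fix h1]
        change |dilation (h ^ (-n))| * z.im = _
        rw [h3, abs_zpow, zpow_neg]
      have hkn := zpow_pos hk0 n
      rw [him, ← div_eq_inv_mul]
      rw [zpow_add_one₀ hk0.ne'] at hn2
      exact ⟨(one_le_div hkn).2 hn1, (div_lt_iff₀ hkn).2 (by linarith)⟩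
  · -- the square of the generator preserves the sides of the leaf
    set κ := k ^ 2
    have hκ : 1 < κ := one_lt_pow₀ hk two_ne_zero
    obtain ⟨hh10, hh01, hhd⟩ := diag_zpow h10 h01 2
    obtain ⟨hi10, hi01, hid⟩ := diag_zpow h10 h01 (-2)
    have hd2 : dilation (h ^ (2 : ℤ)) = κ := by
      rw [hhd, zpow_ofNat]; exact (sq_abs _).symm
    have hdi : dilation (h ^ (-2 : ℤ)) = κ⁻¹ := by
      rw [hid, zpow_neg, zpow_ofNat]; congr 1; exact (sq_abs _).symm
    have hinf : ∀ t : ℝ, IsLeaf Λ OnePoint.infty t →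
        IsLeaf Λ OnePoint.infty ((κ⁻¹ * t : ℝ) : OnePoint ℝ) := by
      intro t ht
      have := hΛ.isLeaf_smul (Γ.zpow_mem hh (-2)) ht
      rwa [smul_coe_of_diag hi10 hi01, OnePoint.smul_infty_eq_self_iff.2 hi10, hdi] at this
    have hzero : ∀ s : ℝ, IsLeaf Λ ((0 : ℝ) : OnePoint ℝ) s →
        IsLeaf Λ ((0 : ℝ) : OnePoint ℝ) ((κ * s : ℝ) : OnePoint ℝ) := by
      intro s hs
      have := hΛ.isLeaf_smul (Γ.zpow_mem hh 2) hs
      rwa [smul_coe_of_diag hh10 hh01, smul_coe_of_diag hh10 hh01, hd2, mul_zero] at this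
    have hl' := hl.smul reflection
    rw [reflection_smul_infty, reflection_smul_coe, neg_zero] at hl'
    have hinfR : ∀ t : ℝ, IsLeaf (conjLam reflection Λ) OnePoint.infty t ↔
        IsLeaf Λ OnePoint.infty ((-t : ℝ) : OnePoint ℝ) := fun t => by
      have := isLeaf_conjLam (Λ := Λ) (g := reflection) (a := OnePoint.infty) (b := ((-t : ℝ) :))
      rwa [reflection_smul_infty, reflection_smul_coe, neg_neg] at this
    have hzeroR : ∀ t : ℝ, IsLeaf (conjLam reflection Λ) ((0 : ℝ) : OnePoint ℝ) t ↔
        IsLeaf Λ ((0 : ℝ) : OnePoint ℝ) ((-t : ℝ) : OnePoint ℝ) := fun t => by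
      have := isLeaf_conjLam (Λ := Λ) (g := reflection) (a := ((0 : ℝ) : OnePoint ℝ))
        (b := ((-t : ℝ) :))
      rwa [reflection_smul_coe, reflection_smul_coe, neg_neg, neg_zero] at this
    have hall : {m | IsBoundaryIntersection Λ l m} = ∅ ∨
        {m | IsBoundaryIntersection Λ l m} = {m | Crosses l m} := by
      rcases (boundaryRect Λ).eq_empty_or_nonempty with h1 | h1
      · rcases (boundaryRect (conjLam reflection Λ)).eq_empty_or_nonempty with h2 | h2
        · left
          rw [setOf_isBoundaryIntersection hl, h1, h2]; simp
        · right
          refine subset_antisymm (fun m hm => hm.crosses) fun m hm => ?_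
          have h3 := crosses_subset_boundaryRect hl' hκ
            (fun t ht => by
              rw [hinfR] at ht ⊢
              have := hinf _ ht
              rwa [mul_neg] at this)
            (fun t ht => by
              rw [hzeroR] at ht ⊢
              have := hzero _ ht
              rwa [mul_neg] at this) h2
          exact isBoundaryIntersection_conjLam.1 (isBoundaryIntersection_of_mem_boundaryRect hl'
            (h3 ((crosses_smul reflection).2 hm)))
      · right
        refine subset_antisymm (fun m hm => hm.crosses) fun m hm => ?_
        exact isBoundaryIntersection_of_mem_boundaryRect hl
          (crosses_subset_boundaryRect hl hκ hinf hzero h1 hm)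
    rcases hall with hall | hall
    · convert isOpenCompact_empty.isTame using 3 with ν
      ext m
      have : ¬ IsBoundaryIntersection Λ l m := fun hm =>
        (Set.eq_empty_iff_forall_notMem.1 hall) m hm
      simp [this]
    · convert isTame_crossHeight hl hh h10 h01 hk using 3 with ν
      ext m
      have : IsBoundaryIntersection Λ l m ↔ Crosses l m := Set.ext_iff.1 hall m
      rw [Set.mem_ofPred_eq, Set.mem_ofPred_eq, this]
      refine and_congr_right fun hm => ?_
      constructor
      · rintro ⟨z, hz, -, hz1, hz2⟩
        obtain ⟨-, him⟩ := (mem_points_iff_crossHeight hl hm).1 hz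
        rw [← him]
        exact ⟨hz1, hz2⟩
      · rintro ⟨h1, h2⟩
        let z : ℍ := ⟨⟨0, crossHeight m⟩, crossHeight_pos hl hm⟩
        exact ⟨z, (mem_points_iff_crossHeight hl hm).2 ⟨rfl, rfl⟩, rfl, h1, h2⟩

/-- Every leaf has a set of representatives as above. -/
lemma exists_isSegment (hΓ : IsFiniteAreaSurfaceGroup Γ)
    (hΛ : IsLamination Γ Λ) (hfin : HasFinitelyManyLeaves Γ Λ) {l : Geodesic} (hlΛ : l ∈ Λ) :
    ∃ D, IsSegment Γ Λ l D := by
  by_cases hs : HasTrivialStabilizer Γ l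
  · exact ⟨_, isSegment_of_hasTrivialStabilizer hΓ hΛ hfin hlΛ hs⟩
  obtain ⟨a, b, hab⟩ := l.exists_hasEnds
  obtain ⟨g, ha, hb⟩ := exists_smul_eq_infty_zero hab.ne
  have hl := hab.smul g
  rw [ha, hb] at hl
  obtain ⟨D, hD⟩ := isSegment_of_not_hasTrivialStabilizer (hΓ.conj g) (hΛ.conj g) hl
    (fun h => hs ((hasTrivialStabilizer_smul_iff g).1 h))
  exact ⟨_, hD.preimage⟩

/-! ### Tame functionals are continuous -/

lemma MeasuredLamination.regular (μ : MeasuredLamination Γ) : μ.toMeasure.Regular := by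
  have : IsFiniteMeasureOnCompacts μ.toMeasure := ⟨fun K hK => μ.finite_of_isCompact K hK⟩
  have : IsLocallyFiniteMeasure μ.toMeasure := isLocallyFiniteMeasure_of_isFiniteMeasureOnCompacts
  let := TopologicalSpace.metrizableSpaceMetric Geodesic
  infer_instance

lemma MeasuredLamination.continuous_integral (f : CompactlySupportedContinuousMap Geodesic ℝ) :
    Continuous fun μ : MeasuredLamination Γ => ∫ g, f g ∂μ.toMeasure :=
  continuous_iInf_dom (i := f) continuous_induced_dom

lemma MeasuredLamination.integrable (μ : MeasuredLamination Γ)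
    (f : CompactlySupportedContinuousMap Geodesic ℝ) : Integrable f μ.toMeasure := by
  have : IsFiniteMeasureOnCompacts μ.toMeasure := ⟨fun K hK => μ.finite_of_isCompact K hK⟩
  exact f.continuous.integrable_of_hasCompactSupport f.hasCompactSupport

lemma MeasuredLamination.real_le_integral (μ : MeasuredLamination Γ)
    (f : CompactlySupportedContinuousMap Geodesic ℝ) (hf : ∀ x, 0 ≤ f x) {K : Set Geodesic}
    (hK : IsCompact K) (h1 : ∀ x ∈ K, f x = 1) : μ.toMeasure.real K ≤ ∫ g, f g ∂μ.toMeasure := by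
  rw [← integral_indicator_one hK.measurableSet]
  refine integral_mono ?_ (μ.integrable f) fun x => ?_
  · exact (integrable_indicator_iff hK.measurableSet).2
      (integrableOn_const (μ.finite_of_isCompact K hK).ne)
  · by_cases hx : x ∈ K
    · simp [hx, h1 x hx]
    · simp [hx, hf x]

lemma MeasuredLamination.integral_le_real (μ : MeasuredLamination Γ)
    (f : CompactlySupportedContinuousMap Geodesic ℝ) (hf : ∀ x, f x ≤ 1) {B : Set Geodesic}
    (hB : IsOpen B) (hfin : μ.toMeasure B ≠ ⊤) (h0 : ∀ x ∉ B, f x = 0) :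
    ∫ g, f g ∂μ.toMeasure ≤ μ.toMeasure.real B := by
  rw [← integral_indicator_one hB.measurableSet]
  refine integral_mono (μ.integrable f) ?_ fun x => ?_
  · exact (integrable_indicator_iff hB.measurableSet).2 (integrableOn_const hfin)
  · by_cases hx : x ∈ B
    · simp [hx, hf x]
    · simp [hx, h0 x hx]

lemma exists_bump {K U : Set Geodesic} (hK : IsCompact K) (hU : IsOpen U) (hKU : K ⊆ U) :
    ∃ f : CompactlySupportedContinuousMap Geodesic ℝ, (∀ x, 0 ≤ f x) ∧ (∀ x, f x ≤ 1) ∧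
      (∀ x ∈ K, f x = 1) ∧ ∀ x ∉ U, f x = 0 := by
  obtain ⟨f, h1, h2, h3, h4⟩ := exists_continuous_one_zero_of_isCompact hK hU.isClosed_compl
    (Set.disjoint_compl_right_iff_subset.2 hKU)
  exact ⟨⟨f, h3⟩, fun x => (h4 x).1, fun x => (h4 x).2, fun x hx => h1 hx, fun x hx => h2 hx⟩

lemma IsTame.lt_top {F : Measure Geodesic → ℝ≥0∞} (hF : IsTame Γ F) (μ : MeasuredLamination Γ) :
    F μ.toMeasure < ⊤ := by
  obtain ⟨B, K, -, hK, h1, -⟩ := hF _ μ.isInvariantMeasure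
  exact (h1 _ μ.isInvariantMeasure).2.trans_lt (μ.finite_of_isCompact K hK)

/-- The functional is close to its value at `μ` as it is squeezed between the measures of the open
set, which are lower semicontinuous, and those of the compact set, which are upper
semicontinuous. -/
lemma IsTame.continuous {F : Measure Geodesic → ℝ≥0∞} (hF : IsTame Γ F) :
    Continuous fun μ : MeasuredLamination Γ => (F μ.toMeasure).toReal := by
  rw [continuous_iff_continuousAt]
  intro μ₀
  obtain ⟨B, K, hB, hK, h1, h2⟩ := hF _ μ₀.isInvariantMeasure
  have hreg := μ₀.regular
  have hKfin : ∀ μ : MeasuredLamination Γ, μ.toMeasure K ≠ ⊤ :=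
    fun μ => (μ.finite_of_isCompact K hK).ne
  have hBfin : ∀ μ : MeasuredLamination Γ, μ.toMeasure B ≠ ⊤ := fun μ =>
    ((h1 _ μ.isInvariantMeasure).1.trans (h1 _ μ.isInvariantMeasure).2).trans_lt
      (hKfin μ).lt_top |>.ne
  have hle : ∀ μ : MeasuredLamination Γ, μ.toMeasure.real B ≤ (F μ.toMeasure).toReal ∧
      (F μ.toMeasure).toReal ≤ μ.toMeasure.real K := fun μ =>
    ⟨ENNReal.toReal_mono (hF.lt_top μ).ne (h1 _ μ.isInvariantMeasure).1,
      ENNReal.toReal_mono (hKfin μ) (h1 _ μ.isInvariantMeasure).2⟩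
  have hKB : μ₀.toMeasure.real K ≤ μ₀.toMeasure.real B := ENNReal.toReal_mono (hBfin μ₀) h2
  rw [ContinuousAt, tendsto_order]
  constructor
  · intro a ha
    have ha' : a < μ₀.toMeasure.real B := by linarith [(hle μ₀).2]
    obtain ⟨K', hK'B, hK', hlt⟩ : ∃ K' ⊆ B, IsCompact K' ∧ a < μ₀.toMeasure.real K' := by
      rcases lt_or_ge a 0 with h | h
      · exact ⟨∅, Set.empty_subset _, isCompact_empty, by simpa using h⟩
      · have := (ENNReal.ofReal_lt_iff_lt_toReal h (hBfin μ₀)).2 ha'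
        obtain ⟨K', h3, h4, h5⟩ := hB.exists_lt_isCompact this
        exact ⟨K', h3, h4, (ENNReal.ofReal_lt_iff_lt_toReal h
          (μ₀.finite_of_isCompact K' h4).ne).1 h5⟩
    obtain ⟨f, hf0, hf1, hfK, hfB⟩ := exists_bump hK' hB hK'B
    have h3 := hlt.trans_le (μ₀.real_le_integral f hf0 hK' hfK)
    filter_upwards [(MeasuredLamination.continuous_integral f).continuousAt.eventually_const_lt h3]
      with μ hμ
    exact (hμ.trans_le (μ.integral_le_real f hf1 hB (hBfin μ) hfB)).trans_le (hle μ).1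
  · intro a ha
    have ha' : μ₀.toMeasure.real K < a := by linarith [(hle μ₀).1]
    have h0 : 0 ≤ a := le_trans ENNReal.toReal_nonneg ha.le
    obtain ⟨U, hKU, hU, hlt⟩ := K.exists_isOpen_lt_of_lt _
      ((ENNReal.lt_ofReal_iff_toReal_lt (hKfin μ₀)).2 ha')
    obtain ⟨f, hf0, hf1, hfK, hfU⟩ := exists_bump hK hU hKU
    have h3 := μ₀.integral_le_real f hf1 hU (hlt.trans_le le_top).ne hfU
    have h4 := h3.trans_lt ((ENNReal.lt_ofReal_iff_toReal_lt (hlt.trans_le le_top).ne).1 hlt)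
    filter_upwards [(MeasuredLamination.continuous_integral f).continuousAt.eventually_lt_const h4]
      with μ hμ
    exact ((hle μ).2.trans (μ.real_le_integral f hf0 hK hfK)).trans_lt hμ

/-! ### The boundary mass as an invariant measure -/

lemma isOpen_boundaryRect : IsOpen (boundaryRect Λ) := by
  have : boundaryRect Λ = ⋃ t ∈ {t : ℝ | IsLeaf Λ OnePoint.infty t ∧ 0 < t},
      ⋃ s ∈ {s : ℝ | IsLeaf Λ ((0 : ℝ) : OnePoint ℝ) s},
        joiningReal (Set.Ioo s 0) (Set.Ioi t) := by
    ext m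
    simp only [Set.mem_iUnion]
    constructor
    · rintro ⟨p, q, hm, hp, ⟨t, h1, h2, h3⟩, s, h4, h5⟩
      exact ⟨t, ⟨h1, h2⟩, s, h4, mem_joiningReal.2 ⟨p, ⟨h5, hp⟩, q, h3, hm⟩⟩
    · rintro ⟨t, ⟨h1, h2⟩, s, h4, h⟩
      obtain ⟨p, ⟨h5, hp⟩, q, h3, hm⟩ := mem_joiningReal.1 h
      exact ⟨p, q, hm, hp, ⟨t, h1, h2, h3⟩, s, h4, h5⟩
  rw [this]
  exact isOpen_biUnion fun t _ => isOpen_biUnion fun s _ =>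
    isOpen_joiningReal isOpen_Ioo isOpen_Ioi

lemma isOpen_setOf_isBoundaryIntersection (Λ : Set Geodesic) (l : Geodesic) :
    IsOpen {m | IsBoundaryIntersection Λ l m} := by
  obtain ⟨a, b, hab⟩ := l.exists_hasEnds
  obtain ⟨g, ha, hb⟩ := exists_smul_eq_infty_zero hab.ne
  have hl := hab.smul g
  rw [ha, hb] at hl
  have : {m | IsBoundaryIntersection Λ l m} =
      (fun m => g • m) ⁻¹' {m | IsBoundaryIntersection (conjLam g Λ) (g • l) m} := by
    ext m
    exact isBoundaryIntersection_conjLam.symm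
  rw [this, setOf_isBoundaryIntersection hl]
  exact (isOpen_boundaryRect.union (isOpen_boundaryRect.preimage
    (continuous_const_smul reflection))).preimage (continuous_const_smul g)

lemma continuous_axisPt : Continuous axisPt := by
  rw [UpperHalfPlane.isOpenEmbedding_coe.isEmbedding.continuous_iff]
  have : ((fun z : ℍ => (z : ℂ)) ∘ axisPt) = fun s => (Real.exp s : ℂ) * Complex.I := by
    funext s
    apply Complex.ext
    · simp [axisPt, -Complex.ofReal_exp]
    · simp [axisPt, -Complex.ofReal_exp]
  rw [this]
  fun_prop

/-- The point at which a geodesic crosses `l` depends measurably on the geodesic. -/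
lemma exists_crossing_point (l : Geodesic) : ∃ x : Geodesic → ℍ, Measurable x ∧
    ∀ m, Crosses l m → ∀ z, z ∈ l.points ∧ z ∈ m.points ↔ z = x m := by
  obtain ⟨a, b, hab⟩ := l.exists_hasEnds
  obtain ⟨g, ha, hb⟩ := exists_smul_eq_infty_zero hab.ne
  have hl := hab.smul g
  rw [ha, hb] at hl
  refine ⟨fun m => g⁻¹ • axisPt (Real.log (crossHeight (g • m))), ?_, fun m hm z => ?_⟩
  · exact ((continuous_const_smul g⁻¹).comp continuous_axisPt).measurable.comp
      ((Real.measurable_log.comp measurable_crossHeight).comp (measurable_smul_geodesic g))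
  · have hm' := (crosses_smul g).2 hm
    rw [eq_inv_smul_iff, ← smul_mem_points_iff g, ← smul_mem_points_iff g (g := m),
      mem_points_iff_crossHeight hl hm']
    have hpos := crossHeight_pos hl hm'
    constructor
    · rintro ⟨h1, h2⟩
      ext1
      apply Complex.ext
      · exact h1
      · exact h2.trans (Real.exp_log hpos).symm
    · intro h
      rw [h, axisPt_re, axisPt_im, Real.exp_log hpos]
      exact ⟨rfl, rfl⟩

lemma measurableSet_boundary_inter (Λ : Set Geodesic) (l : Geodesic) {A : Set ℍ}
    (hA : MeasurableSet A) :
    MeasurableSet {m | IsBoundaryIntersection Λ l m ∧ (l.points ∩ m.points ∩ A).Nonempty} := by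
  obtain ⟨x, hx, h⟩ := exists_crossing_point l
  have : {m | IsBoundaryIntersection Λ l m ∧ (l.points ∩ m.points ∩ A).Nonempty} =
      {m | IsBoundaryIntersection Λ l m} ∩ x ⁻¹' A := by
    ext m
    refine and_congr_right fun hm => ⟨?_, fun hA => ⟨x m, (h m hm.crosses _).2 rfl, hA⟩⟩
    rintro ⟨z, hz, hzA⟩
    rwa [(h m hm.crosses z).1 hz] at hzA
  rw [this]
  exact (isOpen_setOf_isBoundaryIntersection Λ l).measurableSet.inter (hx hA)

/-- The boundary mass is a measure on the hyperbolic plane: it is the sum over the leaves of the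
images of the restrictions of `μ` under the maps to the crossing points. -/
lemma exists_measure_eq_boundaryMass (Λ : Set Geodesic) (μ : Measure Geodesic) :
    ∃ ν : Measure ℍ, ∀ A, MeasurableSet A → ν A = boundaryMass Λ μ A := by
  choose x hx h using exists_crossing_point
  refine ⟨Measure.sum fun l : Λ =>
    (μ.restrict {m | IsBoundaryIntersection Λ l m}).map (x l), fun A hA => ?_⟩
  rw [Measure.sum_apply _ hA]
  unfold boundaryMass
  congr 1
  funext l
  rw [Measure.map_apply (hx l) hA, Measure.restrict_apply (hx l hA), Set.inter_comm]
  congr 1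
  ext m
  refine and_congr_right fun hm => ⟨fun hA => ⟨x l m, (h l m hm.crosses _).2 rfl, hA⟩, ?_⟩
  rintro ⟨z, hz, hzA⟩
  rwa [(h l m hm.crosses z).1 hz] at hzA

lemma boundaryMass_preimage (hΛ : IsLamination Γ Λ) {μ : Measure Geodesic}
    (hμ : IsInvariantMeasure Γ μ) {γ : GL (Fin 2) ℝ} (hγ : γ ∈ Γ) {A : Set ℍ}
    (hA : MeasurableSet A) :
    boundaryMass Λ μ ((fun z => γ • z) ⁻¹' A) = boundaryMass Λ μ A := by
  let e : Λ ≃ Λ :=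
    { toFun := fun l => ⟨γ • l.1, hΛ.invariant γ hγ _ l.2⟩
      invFun := fun l => ⟨γ⁻¹ • l.1, hΛ.invariant γ⁻¹ (Γ.inv_mem hγ) _ l.2⟩
      left_inv := fun l => Subtype.ext (inv_smul_smul γ l.1)
      right_inv := fun l => Subtype.ext (smul_inv_smul γ l.1) }
  unfold boundaryMass
  rw [← e.tsum_eq fun l : Λ => μ {m | IsBoundaryIntersection Λ l m ∧
    (l.1.points ∩ m.points ∩ A).Nonempty}]
  congr 1
  funext l
  rw [← hμ.invariant γ hγ _ (measurableSet_boundary_inter Λ (e l) hA)]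
  congr 1
  ext m
  have h1 := isBoundaryIntersection_conjLam (Λ := Λ) (g := γ) (l := l) (m := m)
  rw [hΛ.conjLam_eq hγ] at h1
  refine and_congr h1.symm ?_
  constructor
  · rintro ⟨z, ⟨h1, h2⟩, h3⟩
    exact ⟨γ • z, ⟨(smul_mem_points_iff γ).2 h1, (smul_mem_points_iff γ).2 h2⟩, h3⟩
  · rintro ⟨z, ⟨h1, h2⟩, h3⟩
    refine ⟨γ⁻¹ • z, ⟨?_, ?_⟩, ?_⟩
    · rw [← smul_mem_points_iff γ, smul_inv_smul]; exact h1
    · rw [← smul_mem_points_iff γ, smul_inv_smul]; exact h2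
    · rw [Set.mem_preimage, smul_inv_smul]; exact h3

/-! ### The alternation number as a finite sum -/

lemma IsLamination.eq_of_mem_points (hΛ : IsLamination Γ Λ) {l l' : Geodesic} (hl : l ∈ Λ)
    (hl' : l' ∈ Λ) {z : ℍ} (hz : z ∈ l.points) (hz' : z ∈ l'.points) : l = l' := by
  by_contra hne
  exact hΛ.not_crosses l hl l' hl' (crosses_of_mem_points hne hz hz')

lemma exists_representatives (hΛ : IsLamination Γ Λ) (hfin : HasFinitelyManyLeaves Γ Λ) :
    ∃ R : Finset Geodesic, (∀ r ∈ R, r ∈ Λ) ∧ (∀ l ∈ Λ, ∃ r ∈ R, ∃ γ ∈ Γ, l = γ • r) ∧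
      ∀ r ∈ R, ∀ r' ∈ R, ∀ γ ∈ Γ, γ • r = r' → r = r' := by
  classical
  obtain ⟨F, hF, hcov⟩ := hfin
  let o : Geodesic → Geodesic := fun g =>
    (Quotient.mk (MulAction.orbitRel Γ Geodesic) g).out
  have ho : ∀ g, ∃ γ ∈ Γ, o g = γ • g := by
    intro g
    obtain ⟨γ, h⟩ := (MulAction.orbitRel_apply.1 (Quotient.mk_out (s := MulAction.orbitRel Γ Geodesic) g))
    exact ⟨γ, γ.2, h.symm⟩
  have hoeq : ∀ g, ∀ γ ∈ Γ, o (γ • g) = o g := by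
    intro g γ hγ
    have : Quotient.mk (MulAction.orbitRel Γ Geodesic) (γ • g) = Quotient.mk _ g :=
      Quotient.sound (MulAction.orbitRel_apply.2 ⟨⟨γ, hγ⟩, rfl⟩)
    change Quotient.out _ = Quotient.out _
    rw [this]
  have hfinite : (o '' Λ).Finite := by
    refine (hF.image o).subset ?_
    rintro _ ⟨l, hl, rfl⟩
    obtain ⟨f, hf, γ, hγ, rfl⟩ := hcov l hl
    exact ⟨f, hf, (hoeq f γ hγ).symm⟩
  have hidem : ∀ g, o (o g) = o g := by
    intro g
    obtain ⟨γ, hγ, h⟩ := ho g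
    rw [h, hoeq _ _ hγ, ← h]
  refine ⟨hfinite.toFinset, ?_, ?_, ?_⟩
  · intro r hr
    obtain ⟨l, hl, rfl⟩ := hfinite.mem_toFinset.1 hr
    obtain ⟨γ, hγ, h⟩ := ho l
    rw [h]
    exact hΛ.invariant γ hγ l hl
  · intro l hl
    obtain ⟨γ, hγ, h⟩ := ho l
    refine ⟨o l, hfinite.mem_toFinset.2 ⟨l, hl, rfl⟩, γ⁻¹, Γ.inv_mem hγ, ?_⟩
    rw [h, inv_smul_smul]
  · intro r hr r' hr' γ hγ h
    obtain ⟨l, -, rfl⟩ := hfinite.mem_toFinset.1 hr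
    obtain ⟨l', -, rfl⟩ := hfinite.mem_toFinset.1 hr'
    rw [← hidem l', ← h, hoeq _ _ hγ, hidem]

lemma countable_leaves (hΓ : IsFiniteAreaSurfaceGroup Γ) (hfin : HasFinitelyManyLeaves Γ Λ) :
    Λ.Countable := by
  obtain ⟨F, hF, hcov⟩ := hfin
  have := hΓ.countable
  refine (hF.countable.biUnion (t := fun f _ => Set.range fun γ : Γ => (γ : GL (Fin 2) ℝ) • f)
    fun f _ => Set.countable_range _).mono fun l hl => ?_
  obtain ⟨f, hf, γ, hγ, rfl⟩ := hcov l hl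
  exact Set.mem_biUnion hf ⟨⟨γ, hγ⟩, rfl⟩

/-- The alternation number is the sum, over the leaves on the surface, of the measures of the
boundary intersections with these leaves. -/
lemma alternationNumber_eq_sum (hΓ : IsFiniteAreaSurfaceGroup Γ) (hΛ : IsLamination Γ Λ)
    (hfin : HasFinitelyManyLeaves Γ Λ) {R : Finset Geodesic} (hR : ∀ r ∈ R, r ∈ Λ)
    (hcov : ∀ l ∈ Λ, ∃ r ∈ R, ∃ γ ∈ Γ, l = γ • r)
    (huniq : ∀ r ∈ R, ∀ r' ∈ R, ∀ γ ∈ Γ, γ • r = r' → r = r') {D : Geodesic → Set ℍ}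
    (hD : ∀ r ∈ R, IsSegment Γ Λ r (D r)) (μ : MeasuredLamination Γ) :
    alternationNumber Γ Λ μ = ∑ r ∈ R, μ.toMeasure
      {m | IsBoundaryIntersection Λ r m ∧ (r.points ∩ m.points ∩ D r).Nonempty} := by
  set T : Set ℍ := ⋃ r ∈ R, D r with hT
  have hTm : MeasurableSet T := R.measurableSet_biUnion fun r hr => (hD r hr).measurableSet
  have hmemT : ∀ {z}, z ∈ T ↔ ∃ r ∈ R, z ∈ D r := by simp [hT]
  have hsum : boundaryMass Λ μ.toMeasure T = ∑ r ∈ R, μ.toMeasure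
      {m | IsBoundaryIntersection Λ r m ∧ (r.points ∩ m.points ∩ D r).Nonempty} := by
    unfold boundaryMass
    rw [tsum_subtype Λ fun l => μ.toMeasure
      {m | IsBoundaryIntersection Λ l m ∧ (l.points ∩ m.points ∩ T).Nonempty}]
    rw [tsum_eq_sum (s := R)]
    · refine Finset.sum_congr rfl fun r hr => ?_
      rw [Set.indicator_of_mem (hR r hr)]
      congr 1
      ext m
      refine and_congr_right fun _ => ⟨?_, ?_⟩
      · rintro ⟨z, ⟨h1, h2⟩, h3⟩
        obtain ⟨r', hr', h4⟩ := hmemT.1 h3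
        have := hΛ.eq_of_mem_points (hR r hr) (hR r' hr') h1 ((hD r' hr').subset h4)
        subst this
        exact ⟨z, ⟨h1, h2⟩, h4⟩
      · rintro ⟨z, h1, h2⟩
        exact ⟨z, h1, hmemT.2 ⟨r, hr, h2⟩⟩
    · intro l hl
      by_cases hlΛ : l ∈ Λ
      · rw [Set.indicator_of_mem hlΛ]
        refine measure_mono_null ?_ (measure_empty (μ := μ.toMeasure))
        rintro m ⟨-, z, ⟨h1, h2⟩, h3⟩
        obtain ⟨r', hr', h4⟩ := hmemT.1 h3
        have := hΛ.eq_of_mem_points hlΛ (hR r' hr') h1 ((hD r' hr').subset h4)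
        subst this
        exact hl hr'
      · exact Set.indicator_of_notMem hlΛ _
  rw [← hsum]
  apply le_antisymm
  · refine iSup_le fun A => iSup_le fun hA => iSup_le fun hinj => ?_
    obtain ⟨ν, hν⟩ := exists_measure_eq_boundaryMass Λ μ.toMeasure
    set L : Set ℍ := ⋃ l ∈ Λ, l.points with hL
    have hLm : MeasurableSet L :=
      MeasurableSet.biUnion (countable_leaves hΓ hfin) fun l _ => measurableSet_points l
    have hAL : boundaryMass Λ μ.toMeasure A ≤ boundaryMass Λ μ.toMeasure (A ∩ L) := by
      refine ENNReal.tsum_le_tsum fun l => measure_mono ?_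
      rintro m ⟨h1, z, ⟨h2, h3⟩, h4⟩
      exact ⟨h1, z, ⟨h2, h3⟩, h4, Set.mem_biUnion l.2 h2⟩
    refine hAL.trans ?_
    rw [← hν _ (hA.inter hLm), ← hν _ hTm]
    refine measure_le_of_injecting hΓ (fun γ hγ B hB => ?_) (hA.inter hLm) hTm ?_ ?_
    · rw [hν _ ((continuous_const_smul γ).measurable hB), hν _ hB,
        boundaryMass_preimage hΛ μ.isInvariantMeasure hγ hB]
    · rintro z ⟨hz, -⟩ γ hγ ⟨hγz, -⟩
      exact hΓ.mem_center_of_smul_eq hγ (hinj z hz γ hγ hγz)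
    · rintro z ⟨-, hz⟩
      simp only [hL, Set.mem_iUnion] at hz
      obtain ⟨l, hl, hz⟩ := hz
      obtain ⟨r, hr, γ, hγ, rfl⟩ := hcov l hl
      have hz' : γ⁻¹ • z ∈ r.points := by rwa [← smul_mem_points_iff γ, smul_inv_smul]
      obtain ⟨δ, hδ, -, h⟩ := (hD r hr).covering _ hz'
      refine ⟨δ * γ⁻¹, Γ.mul_mem hδ (Γ.inv_mem hγ), hmemT.2 ⟨r, hr, ?_⟩⟩
      rwa [mul_smul]
  · refine le_iSup_of_le T (le_iSup_of_le hTm (le_iSup_of_le ?_ le_rfl))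
    intro z hz γ hγ hγz
    obtain ⟨r, hr, h1⟩ := hmemT.1 hz
    obtain ⟨r', hr', h2⟩ := hmemT.1 hγz
    have h3 : γ • r = r' := hΛ.eq_of_mem_points (hΛ.invariant γ hγ r (hR r hr)) (hR r' hr')
      ((smul_mem_points_iff γ).2 ((hD r hr).subset h1)) ((hD r' hr').subset h2)
    obtain rfl := huniq r hr r' hr' γ hγ h3
    exact smul_upperHalfPlane_of_mem_center ((hD r hr).injecting z h1 γ hγ h3 h2) z

end HypLam

theorem proposition3p2 (Γ : Subgroup (GL (Fin 2) ℝ)) (hΓ : HypLam.IsFiniteAreaSurfaceGroup Γ)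
    (Λ : Set HypLam.Geodesic) (hmax : HypLam.IsMaximalLamination Γ Λ)
    (hfin : HypLam.HasFinitelyManyLeaves Γ Λ) :
    (∀ μ : HypLam.MeasuredLamination Γ, HypLam.alternationNumber Γ Λ μ < ⊤) ∧
      Continuous (fun μ : HypLam.MeasuredLamination Γ =>
        (HypLam.alternationNumber Γ Λ μ).toReal) := by
  have hΛ := hmax.prop
  obtain ⟨R, hR, hcov, huniq⟩ := HypLam.exists_representatives hΛ hfin
  choose! D hD using fun r (hr : r ∈ R) => HypLam.exists_isSegment hΓ hΛ hfin (hR r hr)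
  simp only [HypLam.alternationNumber_eq_sum hΓ hΛ hfin hR hcov huniq hD]
  refine ⟨fun μ => ENNReal.sum_lt_top.2 fun r hr => (hD r hr).isTame.lt_top μ, ?_⟩
  have h : ∀ μ : HypLam.MeasuredLamination Γ, (∑ r ∈ R, μ.toMeasure
      {m | HypLam.IsBoundaryIntersection Λ r m ∧ (r.points ∩ m.points ∩ D r).Nonempty}).toReal =
      ∑ r ∈ R, (μ.toMeasure {m | HypLam.IsBoundaryIntersection Λ r m ∧
        (r.points ∩ m.points ∩ D r).Nonempty}).toReal := fun μ =>
    ENNReal.toReal_sum fun r hr => ((hD r hr).isTame.lt_top μ).ne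
  simp only [h]
  exact continuous_finsetSum _ fun r hr => (hD r hr).isTame.continuous
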